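/- Let $\phi=e^{123}+e^{145}+e^{167}+e^{246}-e^{257}-e^{347}-e^{356}$ on $\mathbf R^7$. A $G_2$-structure on a smooth $7$-manifold $M$ is a smooth $3$-form $\sigma$ such that at each $x\in M$ there is a linear isomorphism $u:T_xM\to\mathbf R^7$ with $u^*\phi=\sigma_x$. Pulling back the standard metric and orientation of $\mathbf R^7$ by $u$ gives a Riemannian metric $g$ and an orientation on $M$, which depend only on $\sigma$; let $*$ be the Hodge star, $\nabla$ the Levi-Civita connection and ${}_\#:T^*M\to TM$ the musical isomorphism of $g$. The $G_2$-structure is torsion free if $\nabla$ is a $G_2$-connection, i.e. $\nabla\sigma=0$. Let $\Omega^3_{27}$ be the space of smooth $3$-forms $\gamma$ with $\gamma\wedge\sigma=0$ and $\gamma\wedge*\sigma=0$, and let $\pi^3_{27}$ be the pointwise orthogonal projection of $3$-forms onto forms of this type. Define $d^7_{27}:\Omega^1\to\Omega^3_{27}$ by $d^7_{27}\alpha=\pi^3_{27}\,d*(\alpha\wedge*\sigma)$, and let $d^{27}_7=(d^7_{27})^*:\Omega^3_{27}\to\Omega^1$ be its formal adjoint: $d^{27}_7\gamma$ is the unique smooth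 $1$-form with $\int_M\langle d^{27}_7\gamma,\alpha\rangle\,\mathrm{vol}_g=\int_M\langle\gamma,d^7_{27}\alpha\rangle\,\mathrm{vol}_g$ for all compactly supported smooth $1$-forms $\alpha$. For $\gamma\in\Omega^3_{27}$ let $\mathbf j_\sigma(\gamma)(v,w)=*\big((v\lrcorner\sigma)\wedge(w\lrcorner\sigma)\wedge\gamma\big)$, and for a symmetric $2$-tensor $h$ let $\operatorname{div}(h)=g^{jl}g^{ik}h_{ij,k}e_l$, where $h_{ij,k}=(\nabla_{e_k}h)(e_i,e_j)$ for a local frame $(e_i)$. There is a universal constant $A\neq 0$ such that for every smooth $7$-manifold $M$, every torsion-free $G_2$-structure $\sigma$ on $M$ and every $\gamma\in\Omega^3_{27}$, the form $d^{27}_7\gamma$ exists and is unique, and $$(d^{27}_7\gamma)_\#=A\cdot\operatorname{div}(\mathbf j_\sigma(\gamma)).$$ -/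

import Mathlib

open scoped Manifold ContDiff

noncomputable section

set_option linter.unusedSectionVars false

namespace G2

/-- The model space `ℝ⁷` with its Euclidean structure. -/
abbrev E7 : Type := EuclideanSpace ℝ (Fin 7)

/-- The standard basis vectors `e₁, …, e₇` (indexed from `0`). -/
def stdVec (i : Fin 7) : E7 := EuclideanSpace.single i (1 : ℝ)

/-! ### Exterior algebra of a finite-dimensional real vector space -/

section Algebra

variable {V : Type*} [AddCommGroup V] [Module ℝ V] [TopologicalSpace V]
  [IsTopologicalAddGroup V] [ContinuousSMul ℝ V]

/-- The tensor product `α ⊗ β` of two alternating forms, as a multilinear map. -/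
def tensorForm {k l : ℕ} (α : V [⋀^Fin k]→L[ℝ] ℝ) (β : V [⋀^Fin l]→L[ℝ] ℝ) :
    ContinuousMultilinearMap ℝ (fun _ : Fin (k + l) => V) ℝ where
  toMultilinearMap := (LinearMap.mul' ℝ ℝ).compMultilinearMap
    ((α.toMultilinearMap.domCoprod β.toMultilinearMap).domDomCongr finSumFinEquiv)
  cont := by
    change Continuous fun v : Fin (k + l) → V =>
      α (fun i => v (finSumFinEquiv (Sum.inl i))) * β (fun i => v (finSumFinEquiv (Sum.inr i)))
    exact (α.cont.comp (by fun_prop)).mul (β.cont.comp (by fun_prop))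

theorem tensorForm_apply {k l : ℕ} (α : V [⋀^Fin k]→L[ℝ] ℝ) (β : V [⋀^Fin l]→L[ℝ] ℝ)
    (v : Fin (k + l) → V) :
    tensorForm α β v = α (fun i => v (Fin.castAdd l i)) * β (fun i => v (Fin.natAdd k i)) :=
  rfl

/-- The wedge product
`(α ∧ β)(v) = 1/(k! l!) ∑_s sign(s) α(v_{s(1)}, …, v_{s(k)}) β(v_{s(k+1)}, …, v_{s(k+l)})`. -/
def wedge {k l : ℕ} (α : V [⋀^Fin k]→L[ℝ] ℝ) (β : V [⋀^Fin l]→L[ℝ] ℝ) :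
    V [⋀^Fin (k + l)]→L[ℝ] ℝ :=
  ((k.factorial : ℝ) * (l.factorial : ℝ))⁻¹ •
    ContinuousMultilinearMap.alternatization (tensorForm α β)

theorem wedge_apply {k l : ℕ} (α : V [⋀^Fin k]→L[ℝ] ℝ) (β : V [⋀^Fin l]→L[ℝ] ℝ)
    (v : Fin (k + l) → V) :
    wedge α β v = ((k.factorial : ℝ) * (l.factorial : ℝ))⁻¹ *
      ∑ s : Equiv.Perm (Fin (k + l)), (Equiv.Perm.sign s : ℤ) •
        (α (fun i => v (s (Fin.castAdd l i))) * β (fun i => v (s (Fin.natAdd k i)))) := by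
  simp [wedge, ContinuousMultilinearMap.alternatization_apply_apply, tensorForm_apply,
    Function.comp_def, Units.smul_def]

/-- The interior product `v ⌟ η`. -/
def interior {k : ℕ} (v : V) (η : V [⋀^Fin (k + 1)]→L[ℝ] ℝ) : V [⋀^Fin k]→L[ℝ] ℝ where
  toMultilinearMap := (η.toAlternatingMap.curryLeft v).toMultilinearMap
  cont := by
    change Continuous fun w : Fin k → V => η (Matrix.vecCons v w)
    exact η.cont.comp (by fun_prop)
  map_eq_zero_of_eq' := (η.toAlternatingMap.curryLeft v).map_eq_zero_of_eq'

theorem interior_apply {k : ℕ} (v : V) (η : V [⋀^Fin (k + 1)]→L[ℝ] ℝ) (w : Fin k → V) :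
    interior v η w = η (Matrix.vecCons v w) :=
  rfl

/-- The elementary form `e^{i₁} ∧ ⋯ ∧ e^{iₖ}` on `ℝ⁷`:
its value on `v₁, …, vₖ` is the determinant of the matrix with entries `(v_a)_{i_b}`. -/
def elemForm {k : ℕ} (i : Fin k → Fin 7) : E7 [⋀^Fin k]→L[ℝ] ℝ where
  toMultilinearMap := ((Matrix.detRowAlternating : (Fin k → ℝ) [⋀^Fin k]→ₗ[ℝ] ℝ).compLinearMap
    (LinearMap.pi fun b => (EuclideanSpace.proj (𝕜 := ℝ) (i b)).toLinearMap)).toMultilinearMap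
  cont := by
    change Continuous fun v : Fin k → E7 => Matrix.det (Matrix.of fun a b => v a (i b))
    exact Continuous.matrix_det (by fun_prop)
  map_eq_zero_of_eq' := (AlternatingMap.compLinearMap _ _).map_eq_zero_of_eq'

theorem elemForm_apply {k : ℕ} (i : Fin k → Fin 7) (v : Fin k → E7) :
    elemForm i v = Matrix.det (Matrix.of fun a b => v a (i b)) :=
  rfl

/-- The model 3-form
`φ = e¹²³ + e¹⁴⁵ + e¹⁶⁷ + e²⁴⁶ - e²⁵⁷ - e³⁴⁷ - e³⁵⁶` on `ℝ⁷` (indices shifted by one). -/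
def phi : E7 [⋀^Fin 3]→L[ℝ] ℝ :=
  elemForm ![0, 1, 2] + elemForm ![0, 3, 4] + elemForm ![0, 5, 6] + elemForm ![1, 3, 5]
    - elemForm ![1, 4, 6] - elemForm ![2, 3, 6] - elemForm ![2, 4, 5]

/-! In the rest of this section `u : V ≃ ℝ⁷` is a linear coframe. The structures below are those
for which `u` is an oriented isometry to `ℝ⁷` with its standard metric and orientation. -/

/-- The oriented orthonormal frame `u⁻¹ e₁, …, u⁻¹ e₇`. -/
def frame (u : V ≃L[ℝ] E7) (i : Fin 7) : V := u.symm (stdVec i)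

/-- The inner product on `k`-forms for which the forms `u^*(e^{i₁} ∧ ⋯ ∧ e^{iₖ})` with
`i₁ < ⋯ < iₖ` are orthonormal. -/
def formInner {k : ℕ} (u : V ≃L[ℝ] E7) : LinearMap.BilinForm ℝ (V [⋀^Fin k]→L[ℝ] ℝ) :=
  LinearMap.mk₂ ℝ
    (fun α β => (k.factorial : ℝ)⁻¹ *
      ∑ i : Fin k → Fin 7, α (fun a => frame u (i a)) * β (fun a => frame u (i a)))
    (fun α α' β => by simp [add_mul, Finset.sum_add_distrib, mul_add])
    (fun c α β => by simp [Finset.mul_sum, mul_left_comm, mul_assoc])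
    (fun α β β' => by simp [Finset.sum_add_distrib, mul_add])
    (fun c α β => by simp [Finset.mul_sum, mul_left_comm])

theorem formInner_apply {k : ℕ} (u : V ≃L[ℝ] E7) (α β : V [⋀^Fin k]→L[ℝ] ℝ) :
    formInner u α β = (k.factorial : ℝ)⁻¹ *
      ∑ i : Fin k → Fin 7, α (fun a => frame u (i a)) * β (fun a => frame u (i a)) :=
  rfl

/-- The Hodge star `Λᵏ → Λˡ`, `k + l = 7`: the coefficient of `*β` along
`u^*(e^{i₁} ∧ ⋯ ∧ e^{iₗ})` is the value of `β ∧ u^*(e^{i₁} ∧ ⋯ ∧ e^{iₗ})` on the oriented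
orthonormal frame. Equivalently `α ∧ *β = ⟨α, β⟩ vol` for all `k`-forms `α`. -/
def hodge {k l : ℕ} (h : k + l = 7) (u : V ≃L[ℝ] E7) (β : V [⋀^Fin k]→L[ℝ] ℝ) :
    V [⋀^Fin l]→L[ℝ] ℝ :=
  (l.factorial : ℝ)⁻¹ • ∑ i : Fin l → Fin 7,
    wedge β ((elemForm i).compContinuousLinearMap (u : V →L[ℝ] E7))
      (fun a => frame u (Fin.cast h a)) •
    (elemForm i).compContinuousLinearMap (u : V →L[ℝ] E7)

/-- The `3`-form `u^* φ`. -/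
def pullPhi (u : V ≃L[ℝ] E7) : V [⋀^Fin 3]→L[ℝ] ℝ :=
  phi.compContinuousLinearMap (u : V →L[ℝ] E7)

/-- `Λ³₂₇ = {γ ∈ Λ³ | γ ∧ σ = 0, γ ∧ *σ = 0}` for `σ = u^* φ`. -/
def Lambda27 (u : V ≃L[ℝ] E7) : Submodule ℝ (V [⋀^Fin 3]→L[ℝ] ℝ) where
  carrier := {γ | wedge γ (pullPhi u) = 0 ∧
    wedge γ (hodge (k := 3) (l := 4) rfl u (pullPhi u)) = 0}
  zero_mem' := by
    have key : ∀ {l : ℕ} (ξ : V [⋀^Fin l]→L[ℝ] ℝ),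
        wedge (0 : V [⋀^Fin 3]→L[ℝ] ℝ) ξ = 0 := by
      intro l ξ
      ext v
      rw [wedge_apply]
      simp
    exact ⟨key _, key _⟩
  add_mem' := by
    rintro a b ⟨ha, ha'⟩ ⟨hb, hb'⟩
    have key : ∀ {l : ℕ} (ξ : V [⋀^Fin l]→L[ℝ] ℝ), wedge (a + b) ξ = wedge a ξ + wedge b ξ := by
      intro l ξ
      ext v
      simp [wedge_apply, add_mul, mul_add, Finset.sum_add_distrib]
    exact ⟨by rw [key, ha, hb, add_zero], by rw [key, ha', hb', add_zero]⟩
  smul_mem' := by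
    rintro c a ⟨ha, ha'⟩
    have key : ∀ {l : ℕ} (ξ : V [⋀^Fin l]→L[ℝ] ℝ), wedge (c • a) ξ = c • wedge a ξ := by
      intro l ξ
      ext v
      simp [wedge_apply, Finset.mul_sum, mul_assoc, mul_left_comm]
    exact ⟨by rw [key, ha, smul_zero], by rw [key, ha', smul_zero]⟩

theorem formInner_self_eq_zero {k : ℕ} (u : V ≃L[ℝ] E7) (α : V [⋀^Fin k]→L[ℝ] ℝ)
    (h : formInner u α α = 0) : α = 0 := by
  have hk : ((k.factorial : ℝ)⁻¹) ≠ 0 := by positivity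
  rw [formInner_apply, mul_eq_zero, or_iff_right hk,
    Finset.sum_eq_zero_iff_of_nonneg (fun i _ => mul_self_nonneg _)] at h
  let b : Module.Basis (Fin 7) ℝ V :=
    (EuclideanSpace.basisFun (Fin 7) ℝ).toBasis.map u.symm.toLinearEquiv
  have hb : ∀ i, b i = frame u i := fun i => by simp [b, frame, stdVec]
  have : α.toAlternatingMap = 0 := by
    refine Module.Basis.ext_alternating b fun i _ => ?_
    simpa [hb] using mul_self_eq_zero.1 (h i (Finset.mem_univ i))
  ext v
  exact DFunLike.congr_fun this v

theorem finiteDimensional_forms (k : ℕ) (u : V ≃L[ℝ] E7) :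
    FiniteDimensional ℝ (V [⋀^Fin k]→L[ℝ] ℝ) := by
  let L : (V [⋀^Fin k]→L[ℝ] ℝ) →ₗ[ℝ] ((Fin k → Fin 7) → ℝ) :=
    { toFun := fun α i => α (fun a => frame u (i a))
      map_add' := fun _ _ => rfl
      map_smul' := fun _ _ => rfl }
  refine FiniteDimensional.of_injective L ((injective_iff_map_eq_zero L).2 fun α hα => ?_)
  refine formInner_self_eq_zero u α ?_
  have : ∀ i : Fin k → Fin 7, α (fun a => frame u (i a)) = 0 := fun i => congrFun hα i
  simp [formInner_apply, this]

theorem isCompl_Lambda27 (u : V ≃L[ℝ] E7) :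
    IsCompl (Lambda27 u) ((formInner u).orthogonal (Lambda27 u)) := by
  have := finiteDimensional_forms 3 u
  have hrefl : (formInner (k := 3) u).IsRefl := fun α β h => by
    rw [formInner_apply] at h ⊢
    simpa only [mul_comm (β _)] using h
  rw [LinearMap.BilinForm.isCompl_orthogonal_iff_disjoint hrefl, Submodule.disjoint_def]
  intro γ hγ hγ'
  exact formInner_self_eq_zero u γ (hγ' γ hγ)

/-- `π³₂₇`, the orthogonal projection of `Λ³` onto `Λ³₂₇`. -/
def proj27 (u : V ≃L[ℝ] E7) (η : V [⋀^Fin 3]→L[ℝ] ℝ) : V [⋀^Fin 3]→L[ℝ] ℝ :=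
  Submodule.projection _ _ (isCompl_Lambda27 u) η

end Algebra

/-! ### Differential forms and tensors on a 7-manifold -/

section Manifold

variable {M : Type*} [TopologicalSpace M] [ChartedSpace E7 M]

/-- The coordinate isomorphism `T_x M → ℝ⁷` given by the preferred chart at `x`. -/
def chartDeriv (x : M) : TangentSpace (𝓡 7) x →L[ℝ] E7 :=
  mfderiv (𝓡 7) 𝓘(ℝ, E7) (extChartAt (𝓡 7) x) x

/-- The derivative at `y` of the inverse of the preferred chart at `p`. -/
def chartInvDeriv (p : M) (y : E7) :
    E7 →L[ℝ] TangentSpace (𝓡 7) ((extChartAt (𝓡 7) p).symm y) :=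
  mfderiv 𝓘(ℝ, E7) (𝓡 7) (extChartAt (𝓡 7) p).symm y

variable (M) in
/-- Fields of exterior `k`-forms on `M` (no regularity). -/
abbrev Form (k : ℕ) : Type _ := ∀ x : M, TangentSpace (𝓡 7) x [⋀^Fin k]→L[ℝ] ℝ

variable (M) in
/-- Fields of covariant `k`-tensors on `M`, as functions of `k` tangent vectors. -/
abbrev TensorField (k : ℕ) : Type _ := ∀ x : M, (Fin k → TangentSpace (𝓡 7) x) → ℝ

/-- The coordinate expression of a form in the preferred chart at `p`. -/
def Form.inChart {k : ℕ} (η : Form M k) (p : M) (y : E7) : E7 [⋀^Fin k]→L[ℝ] ℝ :=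
  (η ((extChartAt (𝓡 7) p).symm y)).compContinuousLinearMap (chartInvDeriv p y)

/-- The form is smooth: its coordinate expressions are. -/
def Form.IsSmooth {k : ℕ} (η : Form M k) : Prop :=
  ∀ p : M, ContDiffOn ℝ ∞ (Form.inChart η p) (extChartAt (𝓡 7) p).target

/-- The form has compact support. -/
def Form.IsCompactlySupported {k : ℕ} (η : Form M k) : Prop :=
  IsCompact (closure {x : M | η x ≠ 0})

/-- The exterior derivative, computed at `x` in the preferred chart at `x`. -/
def Form.d {k : ℕ} (η : Form M k) : Form M (k + 1) := fun x =>
  (extDeriv (Form.inChart η x) (extChartAt (𝓡 7) x x)).compContinuousLinearMap (chartDeriv x)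

/-- The coordinate expression of a covariant tensor field in the preferred chart at `p`. -/
def TensorField.inChart {k : ℕ} (T : TensorField M k) (p : M) (y : E7) (w : Fin k → E7) : ℝ :=
  T ((extChartAt (𝓡 7) p).symm y) (fun i => chartInvDeriv p y (w i))

variable (M) in
/-- A `G₂`-structure on `M`: a smooth `3`-form `σ` such that every `σ_x` is the pull-back of `φ`
under some linear isomorphism `T_x M → ℝ⁷`. -/
structure G2Structure where
  form : Form M 3
  smooth : Form.IsSmooth form
  definite : ∀ x : M, ∃ u : TangentSpace (𝓡 7) x ≃L[ℝ] E7, form x = pullPhi u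

namespace G2Structure

variable (S : G2Structure M)

/-- A coframe `u : T_x M → ℝ⁷` with `u^* φ = σ_x`. It is unique up to `G₂ ⊂ SO(7)`, so the metric,
the Hodge star and the other objects built from it below do not depend on the choice. -/
def coframe (x : M) : TangentSpace (𝓡 7) x ≃L[ℝ] E7 := Classical.choose (S.definite x)

theorem form_eq (x : M) : S.form x = pullPhi (S.coframe x) := Classical.choose_spec (S.definite x)

/-- The metric `g^σ`, the pull-back of the standard metric under the coframe. -/
def metric : TensorField M 2 := fun x v =>
  inner ℝ (S.coframe x (v 0)) (S.coframe x (v 1))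

/-- The Hodge star `*_σ` on `k`-forms at the point `x`. -/
def star {k l : ℕ} (h : k + l = 7) (x : M) (β : TangentSpace (𝓡 7) x [⋀^Fin k]→L[ℝ] ℝ) :
    TangentSpace (𝓡 7) x [⋀^Fin l]→L[ℝ] ℝ :=
  hodge h (S.coframe x) β

/-- The `4`-form `*_σ σ`. -/
def starForm : Form M 4 := fun x => S.star (k := 3) (l := 4) rfl x (S.form x)

/-- The inner product on `k`-forms at `x` induced by `g^σ`. -/
def innerAt {k : ℕ} (x : M) (α β : TangentSpace (𝓡 7) x [⋀^Fin k]→L[ℝ] ℝ) : ℝ :=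
  formInner (S.coframe x) α β

/-- The vector `β_#` dual to a `1`-form `β` at `x`: in the orthonormal frame `f` it is
`∑ᵢ β(fᵢ) fᵢ`. -/
def sharp (x : M) (β : TangentSpace (𝓡 7) x [⋀^Fin 1]→L[ℝ] ℝ) : TangentSpace (𝓡 7) x :=
  ∑ i : Fin 7, β ![frame (S.coframe x) i] • frame (S.coframe x) i

/-! #### The Levi-Civita connection -/

/-- The Gram matrix `(g_ij)` of the metric in the preferred chart at `p`. -/
def gram (p : M) (y : E7) : Matrix (Fin 7) (Fin 7) ℝ :=
  Matrix.of fun i j => TensorField.inChart S.metric p y ![stdVec i, stdVec j]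

/-- `D_v g (w, z)`: the derivative of the coordinate expression of the metric. -/
def metricDeriv (p : M) (y v w z : E7) : ℝ :=
  fderiv ℝ (fun y' => TensorField.inChart S.metric p y' ![w, z]) y v

/-- The Christoffel symbols of the Levi-Civita connection of `g^σ` in the preferred chart at `p`:
`Γ(v, w)^k = ∑ₗ g^{kl} · ½ (D_v g (w, eₗ) + D_w g (v, eₗ) - D_{eₗ} g (v, w))`. -/
def christoffel (p : M) (y v w : E7) : E7 :=
  ∑ k : Fin 7, (∑ l : Fin 7, (S.gram p y)⁻¹ k l * ((1 / 2 : ℝ) *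
    (S.metricDeriv p y v w (stdVec l) + S.metricDeriv p y w v (stdVec l)
      - S.metricDeriv p y (stdVec l) v w))) • stdVec k

/-- The Levi-Civita covariant derivative of a covariant `k`-tensor field,
`(∇_v T)(w₁, …, wₖ) = D_v T (w₁, …, wₖ) - ∑ᵢ T(w₁, …, Γ(v, wᵢ), …, wₖ)`,
computed at `x` in the preferred chart at `x`. -/
def covDeriv {k : ℕ} (T : TensorField M k) (x : M) (v : TangentSpace (𝓡 7) x)
    (w : Fin k → TangentSpace (𝓡 7) x) : ℝ :=
  let y : E7 := extChartAt (𝓡 7) x x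
  let v' : E7 := chartDeriv x v
  let w' : Fin k → E7 := fun i => chartDeriv x (w i)
  fderiv ℝ (fun y' => TensorField.inChart T x y' w') y v'
    - ∑ i : Fin k, TensorField.inChart T x y
        (Function.update w' i (S.christoffel x y v' (w' i)))

/-- The `G₂`-structure is torsion free: the Levi-Civita connection of `g^σ` is a `G₂`-connection,
that is, `∇^σ σ = 0`. -/
def TorsionFree : Prop :=
  ∀ (x : M) (v : TangentSpace (𝓡 7) x) (w : Fin 3 → TangentSpace (𝓡 7) x),
    S.covDeriv (fun x' w' => S.form x' w') x v w = 0

/-- The divergence `g^{jl} g^{ik} h_{ij,k} eₗ` of a `2`-tensor `h`, in an orthonormal frame. -/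
def div (h : TensorField M 2) (x : M) : TangentSpace (𝓡 7) x :=
  ∑ i : Fin 7, ∑ j : Fin 7,
    S.covDeriv h x (frame (S.coframe x) i) ![frame (S.coframe x) i, frame (S.coframe x) j] •
      frame (S.coframe x) j

/-- `j_σ(γ)(v, w) = *_σ((v ⌟ σ) ∧ (w ⌟ σ) ∧ γ)`. -/
def j (γ : Form M 3) : TensorField M 2 := fun x v =>
  S.star (k := 2 + 2 + 3) (l := 0) rfl x
    (wedge (wedge (interior (v 0) (S.form x)) (interior (v 1) (S.form x))) (γ x)) ![]

/-! #### The operators `d⁷₂₇` and `d²⁷₇` -/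

/-- `γ` is a smooth section of `Λ³₂₇`, i.e. a smooth `3`-form with `γ ∧ σ = 0` and
`γ ∧ *σ = 0`. -/
def IsOmega27 (γ : Form M 3) : Prop :=
  Form.IsSmooth γ ∧ ∀ x : M, wedge (γ x) (S.form x) = 0 ∧ wedge (γ x) (S.starForm x) = 0

/-- `d⁷₂₇ α = π³₂₇ d *(α ∧ *σ)` for a `1`-form `α`. -/
def d7_27 (α : Form M 1) : Form M 3 := fun x =>
  proj27 (S.coframe x)
    (Form.d (k := 2) (fun x' => S.star (k := 1 + 4) (l := 2) rfl x'
      (wedge (α x') (S.starForm x'))) x)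

/-- The Riemannian volume measure of `g^σ`: the measure which in the chart at `p` has density
`√det(g_ij)` with respect to Lebesgue measure, for every `p`. It is the supremum over `p` of these
measures on the chart domains. -/
def vol [MeasurableSpace M] : MeasureTheory.Measure M :=
  ⨆ p : M, MeasureTheory.Measure.map (extChartAt (𝓡 7) p).symm
    (((MeasureTheory.volume : MeasureTheory.Measure E7).restrict
      (extChartAt (𝓡 7) p).target).withDensity
        (fun y => ENNReal.ofReal (Real.sqrt (S.gram p y).det)))

/-- `β = d²⁷₇ γ`, where `d²⁷₇ = (d⁷₂₇)^*` is the formal adjoint of `d⁷₂₇ : Ω¹ → Ω³₂₇`: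
`β` is the smooth `1`-form with `∫ ⟨β, α⟩ vol = ∫ ⟨γ, d⁷₂₇ α⟩ vol` for all compactly supported
smooth `1`-forms `α`. -/
def IsD27_7 [MeasurableSpace M] (γ : Form M 3) (β : Form M 1) : Prop :=
  Form.IsSmooth β ∧ ∀ α : Form M 1, Form.IsSmooth α → Form.IsCompactlySupported α →
    ∫ x, S.innerAt x (β x) (α x) ∂S.vol = ∫ x, S.innerAt x (γ x) (S.d7_27 α x) ∂S.vol

open Classical in
/-- The operator `d²⁷₇ : Ω³₂₇ → Ω¹`, with the value `0` where the formal adjoint is not defined. -/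
def d27_7 [MeasurableSpace M] (γ : Form M 3) : Form M 1 :=
  if h : ∃ β : Form M 1, S.IsD27_7 γ β then Classical.choose h else 0

end G2Structure

end Manifold

end G2

end

noncomputable section

set_option linter.unusedSectionVars false

namespace G2

/-! ### Elementary forms -/

/-! Let `X = α_#`. On the model space `*(α ∧ *φ) = X ⌟ φ`, so `d⁷₂₇ α = π³₂₇ d(X ⌟ σ)`
(`hodge_wedge_hodge`, `d7_27_eq`). Since `∇σ = 0` and the Levi-Civita connection is symmetric, `d(X
⌟ σ)` is the alternation of `σ(∇_a X, b, c)` (`extDeriv_starWedge`). Pairing with `γ` in `Λ³₂₇`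
makes the projection disappear, and the antisymmetry of `γ` leaves `⟨γ, d⁷₂₇ α⟩ = ½ ∑ σ(∇ᵢX, a, b)
γ(i, a, b)` over an orthonormal frame (`formInner_alternation`).

The same contraction is `j_σ(γ)`. The `8`-form `φ ∧ (w ⌟ φ) ∧ γ` vanishes, hence so does its
interior product with `v`; together with `γ ∧ φ = 0` and `φ ∧ (w ⌟ φ) = 2 * (w ⌟ φ)` this yields
`j(v, w) = ∑ φ(w, a, b) γ(v, a, b)` (`topWedge_interior_interior`). Therefore `⟨γ, d⁷₂₇ α⟩ = ½ ∑ jᵢₖ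
∇ᵢαₖ`, which differs from `-½ ⟨div j, α⟩` by half the divergence of the vector field dual to `j(·,
α_#)` (`innerAt_d7_27_sub`). The divergence theorem (`integral_fluxDiv`) makes `-½ div j` an
adjoint, so `A = -½`; testing against a bump function times the difference of two candidates gives
uniqueness (`isD27_7_unique`).

Much of the work is regularity and chart independence. The coframe is chosen point by point, with no
continuity. The metric is nevertheless smooth: `(v ⌟ σ) ∧ (w ⌟ σ) ∧ σ` equals `6 det(u) g(v, w)`,
and its determinant recovers `det u` as a ninth root (`contDiffOn_det_chartCoframe`). Frame traces
become traces against the inverse Gram matrix (`sum_frame_eq`) and are then visibly smooth.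
Covariant derivatives at `x` are taken in the chart at `x`, so differentiating and integrating over
a fixed chart requires the transformation law of the Christoffel symbols (`christoffel_trans`),
which is deduced from the uniqueness of the Levi-Civita connection. The volume is a supremum of
chart measures, and these agree on overlaps (`vol_restrict`). -/

theorem elemForm_stdVec {k : ℕ} (I J : Fin k → Fin 7) :
    elemForm I (fun a => stdVec (J a)) =
      Matrix.det (Matrix.of fun a b => if I b = J a then (1 : ℝ) else 0) := by
  rw [elemForm_apply]
  congr 1
  ext a b
  simp [stdVec]

theorem elemForm_perm {k : ℕ} (I : Fin k → Fin 7) (s : Equiv.Perm (Fin k)) :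
    elemForm (I ∘ s) = (Equiv.Perm.sign s : ℝ) • elemForm I := by
  ext v
  simp only [ContinuousAlternatingMap.smul_apply, smul_eq_mul]
  rw [elemForm_apply, elemForm_apply, ← Matrix.det_permute']
  rfl

theorem elemForm_eq_zero {k : ℕ} (I : Fin k → Fin 7) {a b : Fin k} (hab : a ≠ b)
    (h : I a = I b) : elemForm I = 0 := by
  ext v
  rw [elemForm_apply]
  exact Matrix.det_zero_of_column_eq hab fun c => by simp [h]

/-- Expanding the determinant of Kronecker symbols over permutations `s` leaves only `I = J ∘ s`,
and there the two signs cancel. So every `s` contributes `c J`, even if `J` has repeated entries,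
and the factorial counts the permutations. -/
theorem sum_mul_elemForm {k : ℕ} (c : (Fin k → Fin 7) → ℝ)
    (hc : ∀ (s : Equiv.Perm (Fin k)) I, c (I ∘ s) = (Equiv.Perm.sign s : ℝ) * c I)
    (J : Fin k → Fin 7) :
    (k.factorial : ℝ)⁻¹ * ∑ I, c I * elemForm I (fun a => stdVec (J a)) = c J := by
  have h : ∀ I : Fin k → Fin 7, c I * elemForm I (fun a => stdVec (J a)) =
      ∑ s : Equiv.Perm (Fin k), if I = J ∘ s then c J else 0 := by
    intro I
    rw [elemForm_stdVec, Matrix.det_apply', Finset.mul_sum]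
    refine Finset.sum_congr rfl fun s _ => ?_
    simp only [Matrix.of_apply, Finset.prod_ite_zero, Finset.prod_const_one, Finset.mem_univ,
      true_imp_iff]
    by_cases hI : I = J ∘ s
    · subst hI
      simp only [Function.comp_apply, implies_true, if_true, mul_one]
      rw [hc, mul_comm, ← mul_assoc]
      norm_cast
      simp
    · have : ¬ ∀ i, I i = J (s i) := fun h => hI (funext h)
      simp [hI, this]
  simp_rw [h]
  rw [Finset.sum_comm]
  simp [Fintype.card_perm]
  field_simp

theorem ext_stdVec {k : ℕ} {α β : E7 [⋀^Fin k]→L[ℝ] ℝ}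
    (h : ∀ J : Fin k → Fin 7, α (fun a => stdVec (J a)) = β (fun a => stdVec (J a))) : α = β := by
  have : α.toAlternatingMap = β.toAlternatingMap := by
    refine Module.Basis.ext_alternating (EuclideanSpace.basisFun (Fin 7) ℝ).toBasis fun i _ => ?_
    simpa [stdVec] using h i
  ext v
  exact DFunLike.congr_fun this v

theorem form_expand {k : ℕ} (η : E7 [⋀^Fin k]→L[ℝ] ℝ) :
    η = (k.factorial : ℝ)⁻¹ • ∑ I : Fin k → Fin 7, η (fun a => stdVec (I a)) • elemForm I := by
  refine ext_stdVec fun J => ?_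
  rw [← sum_mul_elemForm (fun I => η (fun a => stdVec (I a))) (fun s I => ?_) J]
  · simp [ContinuousAlternatingMap.sum_apply]
  · have := η.toAlternatingMap.map_perm (fun a => stdVec (I a)) s
    simpa [Units.smul_def, Function.comp_def] using this

/-- Multilinear identities between forms reduce through this to identities between index tuples,
where only permutation signs remain. -/
theorem form_induction {k : ℕ} {p : (E7 [⋀^Fin k]→L[ℝ] ℝ) → Prop} (h0 : ∀ I, p (elemForm I))
    (hadd : ∀ α β, p α → p β → p (α + β)) (hsmul : ∀ (c : ℝ) α, p α → p (c • α)) (η) : p η := by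
  rw [form_expand η]
  refine hsmul _ _ (Finset.sum_induction_nonempty _ p hadd ⟨fun _ => 0, Finset.mem_univ _⟩
    fun I _ => hsmul _ _ (h0 I))

/-! ### The wedge product and the interior product -/

section

variable {V : Type*} [AddCommGroup V] [Module ℝ V] [TopologicalSpace V]
  [IsTopologicalAddGroup V] [ContinuousSMul ℝ V] {k l : ℕ}

theorem wedge_add_left (α α' : V [⋀^Fin k]→L[ℝ] ℝ) (β : V [⋀^Fin l]→L[ℝ] ℝ) :
    wedge (α + α') β = wedge α β + wedge α' β := by
  ext v
  simp [wedge_apply, add_mul, mul_add, Finset.sum_add_distrib]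

theorem wedge_add_right (α : V [⋀^Fin k]→L[ℝ] ℝ) (β β' : V [⋀^Fin l]→L[ℝ] ℝ) :
    wedge α (β + β') = wedge α β + wedge α β' := by
  ext v
  simp [wedge_apply, mul_add, Finset.sum_add_distrib]

theorem wedge_smul_left (c : ℝ) (α : V [⋀^Fin k]→L[ℝ] ℝ) (β : V [⋀^Fin l]→L[ℝ] ℝ) :
    wedge (c • α) β = c • wedge α β := by
  ext v
  simp [wedge_apply, Finset.mul_sum, mul_assoc, mul_left_comm]

theorem wedge_smul_right (c : ℝ) (α : V [⋀^Fin k]→L[ℝ] ℝ) (β : V [⋀^Fin l]→L[ℝ] ℝ) :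
    wedge α (c • β) = c • wedge α β := by
  ext v
  simp [wedge_apply, Finset.mul_sum, mul_left_comm]

theorem wedge_zero_left (β : V [⋀^Fin l]→L[ℝ] ℝ) : wedge (0 : V [⋀^Fin k]→L[ℝ] ℝ) β = 0 := by
  ext v
  simp [wedge_apply]

theorem wedge_sum_left {ι : Type*} (s : Finset ι) (α : ι → V [⋀^Fin k]→L[ℝ] ℝ)
    (β : V [⋀^Fin l]→L[ℝ] ℝ) : wedge (∑ i ∈ s, α i) β = ∑ i ∈ s, wedge (α i) β :=
  map_sum (AddMonoidHom.mk' (fun α => wedge α β) fun _ _ => wedge_add_left _ _ _) α s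

theorem wedge_sum_right {ι : Type*} (s : Finset ι) (α : V [⋀^Fin k]→L[ℝ] ℝ)
    (β : ι → V [⋀^Fin l]→L[ℝ] ℝ) : wedge α (∑ i ∈ s, β i) = ∑ i ∈ s, wedge α (β i) :=
  map_sum (AddMonoidHom.mk' (fun β => wedge α β) fun _ _ => wedge_add_right _ _ _) β s

theorem interior_add (v : V) (α β : V [⋀^Fin (k + 1)]→L[ℝ] ℝ) :
    interior v (α + β) = interior v α + interior v β := rfl

theorem interior_smul (v : V) (c : ℝ) (α : V [⋀^Fin (k + 1)]→L[ℝ] ℝ) :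
    interior v (c • α) = c • interior v α := rfl

theorem interior_sum (v : V) {ι : Type*} (s : Finset ι) (α : ι → V [⋀^Fin (k + 1)]→L[ℝ] ℝ) :
    interior v (∑ i ∈ s, α i) = ∑ i ∈ s, interior v (α i) :=
  map_sum (AddMonoidHom.mk' (fun α => interior v α) fun _ _ => rfl) α s

theorem interior_add_vec (v w : V) (α : V [⋀^Fin (k + 1)]→L[ℝ] ℝ) :
    interior (v + w) α = interior v α + interior w α := by
  ext z
  exact α.map_vecCons_add z v w

theorem interior_smul_vec (c : ℝ) (v : V) (α : V [⋀^Fin (k + 1)]→L[ℝ] ℝ) :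
    interior (c • v) α = c • interior v α := by
  ext z
  exact α.map_vecCons_smul z c v

variable {W : Type*} [AddCommGroup W] [Module ℝ W] [TopologicalSpace W]
  [IsTopologicalAddGroup W] [ContinuousSMul ℝ W]

theorem wedge_comp (α : V [⋀^Fin k]→L[ℝ] ℝ) (β : V [⋀^Fin l]→L[ℝ] ℝ) (f : W →L[ℝ] V) :
    wedge (α.compContinuousLinearMap f) (β.compContinuousLinearMap f) =
      (wedge α β).compContinuousLinearMap f := by
  ext v
  simp only [wedge_apply, ContinuousAlternatingMap.compContinuousLinearMap_apply]
  rfl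

theorem interior_comp (α : V [⋀^Fin (k + 1)]→L[ℝ] ℝ) (f : W →L[ℝ] V) (w : W) :
    interior w (α.compContinuousLinearMap f) = (interior (f w) α).compContinuousLinearMap f := by
  ext v
  simp only [interior_apply, ContinuousAlternatingMap.compContinuousLinearMap_apply]
  congr 1
  ext a : 1
  refine Fin.cases rfl (fun _ => rfl) a

end

/-- Expand both determinants over permutations `p` and `q`. For fixed `p`, `q` the outer sum over
`s` is already the full determinant after the substitution `s ↦ s (p ⊕ q)`; the `k! l!` equal copies
cancel the normalisation of the wedge product. -/
theorem wedge_elemForm {k l : ℕ} (I : Fin k → Fin 7) (J : Fin l → Fin 7) :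
    wedge (elemForm I) (elemForm J) = elemForm (Fin.append I J) := by
  ext v
  rw [wedge_apply, elemForm_apply]
  set D := Matrix.det (Matrix.of fun a b => v a (Fin.append I J b)) with hD
  have key : ∀ (p : Equiv.Perm (Fin k)) (q : Equiv.Perm (Fin l)),
      ∑ s : Equiv.Perm (Fin (k + l)), ((Equiv.Perm.sign s : ℤ) : ℝ) *
        ((((Equiv.Perm.sign p : ℤ) : ℝ) * ∏ b, v (s (Fin.castAdd l (p b))) (I b)) *
          (((Equiv.Perm.sign q : ℤ) : ℝ) * ∏ b, v (s (Fin.natAdd k (q b))) (J b))) = D := by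
    intro p q
    let r : Equiv.Perm (Fin (k + l)) := finSumFinEquiv.permCongr (Equiv.sumCongr p q)
    have hr : Equiv.Perm.sign r = Equiv.Perm.sign p * Equiv.Perm.sign q := by
      simp [r, Equiv.Perm.sign_permCongr]
    symm
    rw [hD, Matrix.det_apply', ← Equiv.sum_comp (Equiv.mulRight r)]
    refine Finset.sum_congr rfl fun s _ => ?_
    have h1 : ∏ i, Matrix.of (fun a b => v a (Fin.append I J b)) ((Equiv.mulRight r s) i) i =
        (∏ b, v (s (Fin.castAdd l (p b))) (I b)) * ∏ b, v (s (Fin.natAdd k (q b))) (J b) := by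
      rw [Fin.prod_univ_add]
      simp [r, Equiv.permCongr_apply]
    rw [h1]
    simp only [Equiv.coe_mulRight, map_mul, hr, Units.val_mul, Int.cast_mul]
    ring
  have hk : ((k.factorial : ℝ) * (l.factorial : ℝ)) ≠ 0 := by positivity
  rw [inv_mul_eq_iff_eq_mul₀ hk]
  calc _ = ∑ s : Equiv.Perm (Fin (k + l)), ∑ p : Equiv.Perm (Fin k), ∑ q : Equiv.Perm (Fin l),
      ((Equiv.Perm.sign s : ℤ) : ℝ) *
        ((((Equiv.Perm.sign p : ℤ) : ℝ) * ∏ b, v (s (Fin.castAdd l (p b))) (I b)) *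
          (((Equiv.Perm.sign q : ℤ) : ℝ) * ∏ b, v (s (Fin.natAdd k (q b))) (J b))) := by
        refine Finset.sum_congr rfl fun s _ => ?_
        rw [elemForm_apply, elemForm_apply, Matrix.det_apply', Matrix.det_apply',
          Finset.sum_mul_sum, zsmul_eq_mul, Finset.mul_sum]
        refine Finset.sum_congr rfl fun p _ => ?_
        rw [Finset.mul_sum]
        rfl
    _ = ∑ p : Equiv.Perm (Fin k), ∑ q : Equiv.Perm (Fin l), D := by
        rw [Finset.sum_comm]
        refine Finset.sum_congr rfl fun p _ => ?_
        rw [Finset.sum_comm]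
        exact Finset.sum_congr rfl fun q _ => key p q
    _ = _ := by simp [Fintype.card_perm, mul_assoc]

theorem interior_elemForm {k : ℕ} (v : E7) (I : Fin (k + 1) → Fin 7) :
    interior v (elemForm I) =
      ∑ b : Fin (k + 1), ((-1) ^ (b : ℕ) * v (I b)) • elemForm (I ∘ b.succAbove) := by
  ext w
  rw [interior_apply, elemForm_apply, Matrix.det_succ_row_zero,
    ContinuousAlternatingMap.sum_apply]
  rfl

/-! ### Top forms on `ℝ⁷` -/

/-- The sign of `y - x`. -/
def orderSign (x y : ℕ) : ℤ := if x < y then 1 else if y < x then -1 else 0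

/-- The product of the signs of all `b - a`, where `a` precedes `b` in the list. -/
def listSign : List ℕ → ℤ
  | [] => 1
  | a :: l => l.foldr (fun b c => cond (Nat.blt a b) c (cond (Nat.blt b a) (-c) 0)) (listSign l)

/-- Function application, written as a recursion so that the argument is evaluated first. -/
def evalAt (n : ℕ) (k : ℕ → ℤ) : ℤ := Nat.rec (k 0) (fun m _ => k (m + 1)) n

theorem evalAt_eq (n : ℕ) (k : ℕ → ℤ) : evalAt n k = k n := by
  cases n <;> rfl

/-- The Levi-Civita symbol. -/
def eps (f : Fin 7 → Fin 7) : ℤ :=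
  evalAt (f 0) fun x₀ => evalAt (f 1) fun x₁ => evalAt (f 2) fun x₂ => evalAt (f 3) fun x₃ =>
    evalAt (f 4) fun x₄ => evalAt (f 5) fun x₅ => evalAt (f 6) fun x₆ =>
      listSign [x₀, x₁, x₂, x₃, x₄, x₅, x₆]

/-- The nested `evalAt` only force the seven values to be computed before they are compared, which
keeps the later kernel computations small; they do not change the result. -/
theorem eps_eq_listSign (f : Fin 7 → Fin 7) : eps f = listSign (List.ofFn fun a => (f a : ℕ)) := by
  simp only [eps, evalAt_eq]
  rfl

theorem listSign_cons (a : ℕ) (l : List ℕ) :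
    listSign (a :: l) = (l.map (orderSign a)).prod * listSign l := by
  rw [listSign]
  generalize listSign l = c
  induction l with
  | nil => simp
  | cons b l ih =>
    rw [List.foldr_cons, ih, List.map_cons, List.prod_cons, orderSign]
    rw [Bool.cond_eq_ite, Bool.cond_eq_ite]
    simp only [Nat.blt_eq]
    split_ifs <;> simp

theorem listSign_ofFn {n : ℕ} (f : Fin n → ℕ) :
    listSign (List.ofFn f) = ∏ i, ∏ j ∈ Finset.Ioi i, orderSign (f i) (f j) := by
  induction n with
  | zero => simp [listSign]
  | succ n ih =>
    rw [List.ofFn_succ, listSign_cons, ih, Fin.prod_univ_succ, Fin.prod_Ioi_zero, List.map_ofFn,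
      List.prod_ofFn]
    simp [Fin.prod_Ioi_succ]

/-- The sign of a permutation is the product, over pairs of positions, of the signs of the
differences of the values. -/
theorem eps_perm (s : Equiv.Perm (Fin 7)) : eps s = (Equiv.Perm.sign s : ℤ) := by
  rw [eps_eq_listSign, listSign_ofFn, Equiv.Perm.sign_eq_prod_prod_Ioi]
  push_cast
  refine Finset.prod_congr rfl fun i _ => Finset.prod_congr rfl fun j hj => ?_
  have hne : s i ≠ s j := fun h => (Finset.mem_Ioi.1 hj).ne (s.injective h)
  have hne' : (s i : ℕ) ≠ s j := fun h => hne (Fin.ext h)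
  simp only [orderSign, Fin.lt_def]
  split_ifs <;> first | rfl | omega

theorem eps_eq_zero (f : Fin 7 → Fin 7) {a b : Fin 7} (hne : a ≠ b) (hab : f a = f b) :
    eps f = 0 := by
  rw [eps_eq_listSign, listSign_ofFn]
  wlog h : a < b generalizing a b
  · exact this (Ne.symm hne) hab.symm (lt_of_le_of_ne (not_lt.1 h) (Ne.symm hne))
  refine Finset.prod_eq_zero (Finset.mem_univ a) (Finset.prod_eq_zero (Finset.mem_Ioi.2 h) ?_)
  simp [orderSign, hab]

theorem elemForm_id : elemForm (id : Fin 7 → Fin 7) stdVec = 1 := by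
  have h : elemForm (id : Fin 7 → Fin 7) stdVec =
      Matrix.det (Matrix.of fun a b : Fin 7 => if id b = id a then (1 : ℝ) else 0) := by
    have hv : (stdVec : Fin 7 → E7) = fun a => stdVec (id a) := funext fun _ => rfl
    rw [hv, elemForm_stdVec]
  have h1 : (Matrix.of fun a b : Fin 7 => if id b = id a then (1 : ℝ) else 0) = 1 := by
    ext a b
    simp [Matrix.one_apply, eq_comm]
  rw [h, h1, Matrix.det_one]

theorem elemForm_top_perm (s : Equiv.Perm (Fin 7)) :
    elemForm s stdVec = (Equiv.Perm.sign s : ℝ) := by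
  have h := DFunLike.congr_fun (elemForm_perm id s) stdVec
  rw [Function.id_comp, ContinuousAlternatingMap.smul_apply, elemForm_id, smul_eq_mul,
    mul_one] at h
  exact h

theorem elemForm_top (f : Fin 7 → Fin 7) : elemForm f stdVec = (eps f : ℝ) := by
  by_cases hf : Function.Injective f
  · have h : f = ⇑(Equiv.ofBijective f (Finite.injective_iff_bijective.1 hf)) := rfl
    rw [h, elemForm_top_perm, eps_perm]
  · simp only [Function.Injective, not_forall] at hf
    obtain ⟨a, b, hab, hne⟩ := hf
    rw [elemForm_eq_zero f hne hab, eps_eq_zero f hne hab, Int.cast_zero]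
    rfl

theorem eps_comp_perm (f : Fin 7 → Fin 7) (s : Equiv.Perm (Fin 7)) :
    eps (f ∘ s) = (Equiv.Perm.sign s : ℤ) * eps f := by
  have h := DFunLike.congr_fun (elemForm_perm f s) stdVec
  rw [ContinuousAlternatingMap.smul_apply, elemForm_top, elemForm_top, smul_eq_mul] at h
  exact_mod_cast h

theorem elemForm_top_cast {n : ℕ} (h : n = 7) (f : Fin n → Fin 7) :
    elemForm f (fun a => stdVec (Fin.cast h a)) = (eps (fun a => f (Fin.cast h.symm a)) : ℝ) := by
  -- Vectors and indices become variables tied to the casts by equations, so that `n` can be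
  -- substituted.
  suffices ∀ (v : Fin n → E7) (g : Fin 7 → Fin 7), (∀ a, v a = stdVec (Fin.cast h a)) →
      (∀ a, g a = f (Fin.cast h.symm a)) → elemForm f v = (eps g : ℝ) from
    this _ _ (fun _ => rfl) (fun _ => rfl)
  intro v g hv hg
  subst h
  obtain rfl : v = stdVec := funext hv
  obtain rfl : g = f := funext hg
  exact elemForm_top _

/-- The value of `α ∧ β` on the standard basis, for forms of complementary degrees. -/
def topWedge {k l : ℕ} (h : k + l = 7) (α : E7 [⋀^Fin k]→L[ℝ] ℝ) (β : E7 [⋀^Fin l]→L[ℝ] ℝ) : ℝ :=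
  wedge α β (fun a => stdVec (Fin.cast h a))

section

variable {k l : ℕ} (h : k + l = 7)

theorem topWedge_add_left (α α' : E7 [⋀^Fin k]→L[ℝ] ℝ) (β : E7 [⋀^Fin l]→L[ℝ] ℝ) :
    topWedge h (α + α') β = topWedge h α β + topWedge h α' β := by
  rw [topWedge, wedge_add_left]; rfl

theorem topWedge_add_right (α : E7 [⋀^Fin k]→L[ℝ] ℝ) (β β' : E7 [⋀^Fin l]→L[ℝ] ℝ) :
    topWedge h α (β + β') = topWedge h α β + topWedge h α β' := by
  rw [topWedge, wedge_add_right]; rfl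

theorem topWedge_smul_left (c : ℝ) (α : E7 [⋀^Fin k]→L[ℝ] ℝ) (β : E7 [⋀^Fin l]→L[ℝ] ℝ) :
    topWedge h (c • α) β = c * topWedge h α β := by
  rw [topWedge, wedge_smul_left]; rfl

theorem topWedge_smul_right (c : ℝ) (α : E7 [⋀^Fin k]→L[ℝ] ℝ) (β : E7 [⋀^Fin l]→L[ℝ] ℝ) :
    topWedge h α (c • β) = c * topWedge h α β := by
  rw [topWedge, wedge_smul_right]; rfl

theorem topWedge_zero_left (β : E7 [⋀^Fin l]→L[ℝ] ℝ) : topWedge h 0 β = 0 := by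
  rw [topWedge, wedge_zero_left]; rfl

theorem topWedge_sum_left {ι : Type*} (s : Finset ι) (α : ι → E7 [⋀^Fin k]→L[ℝ] ℝ)
    (β : E7 [⋀^Fin l]→L[ℝ] ℝ) : topWedge h (∑ i ∈ s, α i) β = ∑ i ∈ s, topWedge h (α i) β :=
  map_sum (AddMonoidHom.mk' (fun α => topWedge h α β) fun _ _ => topWedge_add_left h _ _ _) α s

theorem topWedge_elemForm (I : Fin k → Fin 7) (J : Fin l → Fin 7) :
    topWedge h (elemForm I) (elemForm J) =
      (eps (fun a => Fin.append I J (Fin.cast h.symm a)) : ℝ) := by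
  rw [topWedge, wedge_elemForm]
  exact elemForm_top_cast h _

end

/-- Exchanging two blocks of length three is the cube of the `6`-cycle, an odd permutation. -/
theorem elemForm_append_comm (I J : Fin 3 → Fin 7) :
    elemForm (Fin.append I J) = -elemForm (Fin.append J I) := by
  have h : Fin.append I J = Fin.append J I ∘ ((finRotate 6) ^ 3 : Equiv.Perm (Fin 6)) := by
    funext a
    fin_cases a <;> rfl
  have hs : Equiv.Perm.sign ((finRotate 6) ^ 3 : Equiv.Perm (Fin 6)) = -1 := by
    rw [map_pow, sign_finRotate]; rfl
  rw [h]
  have := elemForm_perm (Fin.append J I) ((finRotate 6) ^ 3 : Equiv.Perm (Fin 6))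
  rw [hs] at this
  rw [this]
  ext v
  simp

theorem wedge_anticomm (A B : E7 [⋀^Fin 3]→L[ℝ] ℝ) : wedge A B = -wedge B A := by
  induction A using form_induction with
  | h0 I =>
    induction B using form_induction with
    | h0 J => rw [wedge_elemForm, wedge_elemForm, elemForm_append_comm]
    | hadd B B' h h' => rw [wedge_add_left, wedge_add_right, h, h', neg_add]
    | hsmul c B h => rw [wedge_smul_left, wedge_smul_right, h, smul_neg]
  | hadd A A' h h' => rw [wedge_add_left, wedge_add_right, h, h', neg_add]
  | hsmul c A h => rw [wedge_smul_left, wedge_smul_right, h, smul_neg]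

theorem wedge_self_three (A : E7 [⋀^Fin 3]→L[ℝ] ℝ) : wedge A A = 0 := by
  ext v
  have h := DFunLike.congr_fun (wedge_anticomm A A) v
  rw [ContinuousAlternatingMap.neg_apply] at h
  exact self_eq_neg.1 h

/-- A `7`-cycle is even, so cyclic rotations of the factors of a top form cost no sign. -/
theorem topWedge_rotate (A C : E7 [⋀^Fin 3]→L[ℝ] ℝ) (B : E7 [⋀^Fin 1]→L[ℝ] ℝ) :
    topWedge rfl (wedge A B) C = topWedge rfl (wedge C A) B := by
  induction A using form_induction with
  | h0 I =>
    induction B using form_induction with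
    | h0 J =>
      induction C using form_induction with
      | h0 K =>
        rw [wedge_elemForm, wedge_elemForm, topWedge_elemForm, topWedge_elemForm, Int.cast_inj]
        have h : (fun a => Fin.append (Fin.append K I) J (Fin.cast rfl a)) =
            (fun a : Fin 7 => Fin.append (Fin.append I J) K (Fin.cast rfl a)) ∘
            ((finRotate 7) ^ 4 : Equiv.Perm (Fin 7)) := by
          funext a
          fin_cases a <;> rfl
        rw [h, eps_comp_perm, map_pow, sign_finRotate]
        simp
      | hadd C C' h h' => rw [topWedge_add_right, wedge_add_left, topWedge_add_left, h, h']
      | hsmul c C h => rw [topWedge_smul_right, wedge_smul_left, topWedge_smul_left, h]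
    | hadd B B' h h' => rw [wedge_add_right, topWedge_add_right, topWedge_add_left, h, h']
    | hsmul c B h => rw [wedge_smul_right, topWedge_smul_right, topWedge_smul_left, h]
  | hadd A A' h h' =>
    rw [wedge_add_right, wedge_add_left, topWedge_add_left, topWedge_add_left, h, h']
  | hsmul c A h =>
    rw [wedge_smul_right, wedge_smul_left, topWedge_smul_left, topWedge_smul_left, h]

/-- Eight indices among seven values repeat, so the concatenated elementary `8`-form is zero. Its
interior product with `v` has `3 + 2 + 3` terms, which are those of the three products here up to
the signs of the Leibniz rule. -/
theorem topWedge_interior_elemForm (v : E7) (I : Fin 3 → Fin 7) (J : Fin 2 → Fin 7)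
    (K : Fin 3 → Fin 7) :
    topWedge rfl (wedge (interior v (elemForm I)) (elemForm J)) (elemForm K) =
      topWedge rfl (wedge (elemForm I) (interior v (elemForm J))) (elemForm K) +
        topWedge rfl (wedge (elemForm I) (elemForm J)) (interior v (elemForm K)) := by
  let F : Fin 8 → Fin 7 := Fin.append (Fin.append I J) K
  have h0 : interior v (elemForm F) = 0 := by
    have hni : ¬ Function.Injective F := fun h => by simpa using Fintype.card_le_of_injective _ h
    simp only [Function.Injective, not_forall] at hni
    obtain ⟨a, b, hab, hne⟩ := hni
    rw [elemForm_eq_zero _ hne hab]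
    rfl
  rw [(interior_elemForm v F).trans (Fin.sum_univ_eight _)] at h0
  have h1 := DFunLike.congr_fun h0 stdVec
  simp only [ContinuousAlternatingMap.add_apply, ContinuousAlternatingMap.smul_apply, smul_eq_mul,
    elemForm_top] at h1
  rw [(interior_elemForm v I).trans (Fin.sum_univ_three _),
    (interior_elemForm v J).trans (Fin.sum_univ_two _),
    (interior_elemForm v K).trans (Fin.sum_univ_three _)]
  simp only [wedge_add_left, wedge_add_right, wedge_smul_left, wedge_smul_right, wedge_elemForm,
    topWedge_add_left, topWedge_add_right, topWedge_smul_left, topWedge_smul_right,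
    topWedge_elemForm]
  have e0 : (fun a : Fin 7 => Fin.append (Fin.append (I ∘ Fin.succAbove 0) J) K (Fin.cast rfl a)) =
      F ∘ Fin.succAbove 0 := by
    funext a; fin_cases a <;> rfl
  have e1 : (fun a : Fin 7 => Fin.append (Fin.append (I ∘ Fin.succAbove 1) J) K (Fin.cast rfl a)) =
      F ∘ Fin.succAbove 1 := by
    funext a; fin_cases a <;> rfl
  have e2 : (fun a : Fin 7 => Fin.append (Fin.append (I ∘ Fin.succAbove 2) J) K (Fin.cast rfl a)) =
      F ∘ Fin.succAbove 2 := by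
    funext a; fin_cases a <;> rfl
  have e3 : (fun a : Fin 7 => Fin.append (Fin.append I (J ∘ Fin.succAbove 0)) K (Fin.cast rfl a)) =
      F ∘ Fin.succAbove 3 := by
    funext a; fin_cases a <;> rfl
  have e4 : (fun a : Fin 7 => Fin.append (Fin.append I (J ∘ Fin.succAbove 1)) K (Fin.cast rfl a)) =
      F ∘ Fin.succAbove 4 := by
    funext a; fin_cases a <;> rfl
  have e5 : (fun a : Fin 7 => Fin.append (Fin.append I J) (K ∘ Fin.succAbove 0) (Fin.cast rfl a)) =
      F ∘ Fin.succAbove 5 := by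
    funext a; fin_cases a <;> rfl
  have e6 : (fun a : Fin 7 => Fin.append (Fin.append I J) (K ∘ Fin.succAbove 1) (Fin.cast rfl a)) =
      F ∘ Fin.succAbove 6 := by
    funext a; fin_cases a <;> rfl
  have e7 : (fun a : Fin 7 => Fin.append (Fin.append I J) (K ∘ Fin.succAbove 2) (Fin.cast rfl a)) =
      F ∘ Fin.succAbove 7 := by
    funext a; fin_cases a <;> rfl
  rw [e0, e1, e2, e3, e4, e5, e6, e7]
  have i0 : F 0 = I 0 := rfl
  have i1 : F 1 = I 1 := rfl
  have i2 : F 2 = I 2 := rfl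
  have i3 : F 3 = J 0 := rfl
  have i4 : F 4 = J 1 := rfl
  have i5 : F 5 = K 0 := rfl
  have i6 : F 6 = K 1 := rfl
  have i7 : F 7 = K 2 := rfl
  rw [i0, i1, i2, i3, i4, i5, i6, i7] at h1
  refine sub_eq_zero.1 (Eq.trans ?_ h1)
  simp only [Fin.val_zero, Fin.val_one, Fin.val_two,
    show ((3 : Fin 8) : ℕ) = 3 from rfl, show ((4 : Fin 8) : ℕ) = 4 from rfl,
    show ((5 : Fin 8) : ℕ) = 5 from rfl, show ((6 : Fin 8) : ℕ) = 6 from rfl,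
    show ((7 : Fin 8) : ℕ) = 7 from rfl]
  ring

/-- The interior product with `v` of an `8`-form `A ∧ B ∧ C` vanishes. -/
theorem topWedge_interior (v : E7) (A : E7 [⋀^Fin 3]→L[ℝ] ℝ) (B : E7 [⋀^Fin 2]→L[ℝ] ℝ)
    (C : E7 [⋀^Fin 3]→L[ℝ] ℝ) :
    topWedge rfl (wedge (interior v A) B) C =
      topWedge rfl (wedge A (interior v B)) C + topWedge rfl (wedge A B) (interior v C) := by
  induction A using form_induction with
  | h0 I =>
    induction B using form_induction with
    | h0 J =>
      induction C using form_induction with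
      | h0 K => exact topWedge_interior_elemForm v I J K
      | hadd C C' h h' =>
        rw [topWedge_add_right, topWedge_add_right, interior_add, topWedge_add_right, h, h']
        ring
      | hsmul c C h =>
        rw [topWedge_smul_right, topWedge_smul_right, interior_smul, topWedge_smul_right, h]
        ring
    | hadd B B' h h' =>
      rw [wedge_add_right, topWedge_add_left, interior_add, wedge_add_right, topWedge_add_left,
        wedge_add_right, topWedge_add_left, h, h']
      ring
    | hsmul c B h =>
      rw [wedge_smul_right, topWedge_smul_left, interior_smul, wedge_smul_right,
        topWedge_smul_left, wedge_smul_right, topWedge_smul_left, h]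
      ring
  | hadd A A' h h' =>
    rw [interior_add, wedge_add_left, topWedge_add_left, wedge_add_left, topWedge_add_left,
      wedge_add_left, topWedge_add_left, h, h']
    ring
  | hsmul c A h =>
    rw [interior_smul, wedge_smul_left, topWedge_smul_left, wedge_smul_left, topWedge_smul_left,
      wedge_smul_left, topWedge_smul_left, h]
    ring

/-! ### The model form -/

/-- The index triples of the terms of `φ`, completed to permutations of the indices. -/
def phiIndex : Fin 7 → Fin 7 → Fin 7 :=
  ![![0, 1, 2, 3, 4, 5, 6], ![0, 3, 4, 1, 2, 5, 6], ![0, 5, 6, 1, 2, 3, 4],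
    ![1, 3, 5, 0, 2, 4, 6], ![1, 4, 6, 0, 2, 3, 5], ![2, 3, 6, 0, 1, 4, 5], ![2, 4, 5, 0, 1, 3, 6]]

/-- The coefficients of the terms of `φ`. -/
def phiCoeff : Fin 7 → ℤ := ![1, 1, 1, 1, -1, -1, -1]

/-- The index triples of the terms of `φ`. -/
def phiTriple (m : Fin 7) (a : Fin 3) : Fin 7 := phiIndex m (Fin.castAdd 4 a)

/-- The complements of the index triples of the terms of `φ`. -/
def phiQuad (m : Fin 7) (a : Fin 4) : Fin 7 := phiIndex m (Fin.natAdd 3 a)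

/-- The Kronecker symbol. -/
def delta (i j : Fin 7) : ℤ := cond (Nat.beq i j) 1 0

theorem delta_eq (i j : Fin 7) : delta i j = if i = j then 1 else 0 := by
  rw [delta, Bool.cond_eq_ite]
  simp only [Nat.beq_eq, Fin.ext_iff]

/-- The values of `φ` on the standard basis. -/
def phiVal (i j k : Fin 7) : ℤ :=
  ∑ m, phiCoeff m * (delta (phiTriple m 0) i * (delta (phiTriple m 1) j * delta (phiTriple m 2) k
    - delta (phiTriple m 2) j * delta (phiTriple m 1) k)
    - delta (phiTriple m 1) i * (delta (phiTriple m 0) j * delta (phiTriple m 2) k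
    - delta (phiTriple m 2) j * delta (phiTriple m 0) k)
    + delta (phiTriple m 2) i * (delta (phiTriple m 0) j * delta (phiTriple m 1) k
    - delta (phiTriple m 1) j * delta (phiTriple m 0) k))

theorem phi_eq_sum : phi = ∑ m, (phiCoeff m : ℝ) • elemForm (phiTriple m) := by
  have h0 : phiTriple 0 = ![0, 1, 2] := by decide
  have h1 : phiTriple 1 = ![0, 3, 4] := by decide
  have h2 : phiTriple 2 = ![0, 5, 6] := by decide
  have h3 : phiTriple 3 = ![1, 3, 5] := by decide
  have h4 : phiTriple 4 = ![1, 4, 6] := by decide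
  have h5 : phiTriple 5 = ![2, 3, 6] := by decide
  have h6 : phiTriple 6 = ![2, 4, 5] := by decide
  have c0 : phiCoeff 0 = 1 := rfl
  have c1 : phiCoeff 1 = 1 := rfl
  have c2 : phiCoeff 2 = 1 := rfl
  have c3 : phiCoeff 3 = 1 := rfl
  have c4 : phiCoeff 4 = -1 := rfl
  have c5 : phiCoeff 5 = -1 := rfl
  have c6 : phiCoeff 6 = -1 := rfl
  rw [Fin.sum_univ_seven, h0, h1, h2, h3, h4, h5, h6, c0, c1, c2, c3, c4, c5, c6, phi]
  ext v
  simp only [ContinuousAlternatingMap.add_apply, ContinuousAlternatingMap.sub_apply,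
    ContinuousAlternatingMap.smul_apply, smul_eq_mul]
  push_cast
  ring

theorem phi_stdVec (J : Fin 3 → Fin 7) :
    phi (fun a => stdVec (J a)) = (phiVal (J 0) (J 1) (J 2) : ℝ) := by
  rw [phi_eq_sum, ContinuousAlternatingMap.sum_apply, phiVal]
  push_cast
  refine Finset.sum_congr rfl fun m _ => ?_
  rw [ContinuousAlternatingMap.smul_apply, elemForm_stdVec, Matrix.det_fin_three, smul_eq_mul]
  simp only [delta_eq, Matrix.of_apply, Int.cast_ite, Int.cast_one, Int.cast_zero]
  ring

/-- The coordinates of `φ ∧ (eᵢ ⌟ φ) = 2 * (eᵢ ⌟ φ)`. This eigenvalue identity and the next two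
identities are the only places where the actual coefficients of `φ` are used in an exhaustive check.
-/
theorem sum_eps_wedge_interior : ∀ i p q : Fin 7,
    ∑ m, ∑ n, ∑ b : Fin 3, (if phiTriple n b = i then
      phiCoeff m * (phiCoeff n * ((-1) ^ (b : ℕ) * eps (fun a => Fin.append (Fin.append (phiTriple m)
        (phiTriple n ∘ b.succAbove)) ![p, q] (Fin.cast rfl a)))) else 0) = 2 * phiVal i p q := by
  decide +kernel

/-- The coordinates of `*(eⁱ ∧ *φ) = eᵢ ⌟ φ`. -/
theorem sum_eps_wedge_star : ∀ i p q : Fin 7,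
    ∑ m, phiCoeff m * (eps (phiIndex m) * eps (fun a => Fin.append (Fin.append ![i]
        (phiQuad m)) ![p, q] (Fin.cast rfl a))) = phiVal i p q := by
  decide +kernel

/-- The contraction `φᵢₐᵦ φⱼₐᵦ = 6 δᵢⱼ`, which shows that `φ` determines the Euclidean metric. -/
theorem sum_phiVal_mul : ∀ i j : Fin 7,
    ∑ a, ∑ b, phiVal i a b * phiVal j a b = 6 * delta i j := by
  decide +kernel

theorem sum_smul_stdVec (w : E7) : ∑ i, w i • stdVec i = w := by
  ext j
  simp [stdVec, Pi.single_apply]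

theorem linear_ext_stdVec {W : Type*} [AddCommGroup W] [Module ℝ W] {f g : E7 →ₗ[ℝ] W}
    (h : ∀ i, f (stdVec i) = g (stdVec i)) : f = g := by
  ext w
  rw [← sum_smul_stdVec w, map_sum, map_sum]
  simp only [map_smul, h]

theorem sum_fin_one {W : Type*} [AddCommMonoid W] (f : (Fin 1 → Fin 7) → W) :
    ∑ I, f I = ∑ a, f ![a] := by
  rw [← Equiv.sum_comp (Equiv.funUnique (Fin 1) (Fin 7)).symm]
  refine Finset.sum_congr rfl fun a _ => congrArg f ?_
  funext i
  fin_cases i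
  rfl

theorem sum_fin_two {W : Type*} [AddCommMonoid W] (f : (Fin 2 → Fin 7) → W) :
    ∑ I, f I = ∑ a, ∑ b, f ![a, b] := by
  rw [← Equiv.sum_comp (finTwoArrowEquiv (Fin 7)).symm, Fintype.sum_prod_type]
  rfl

theorem sum_fin_three {W : Type*} [AddCommMonoid W] (f : (Fin 3 → Fin 7) → W) :
    ∑ I, f I = ∑ a, ∑ b, ∑ c, f ![a, b, c] := by
  rw [← Equiv.sum_comp (Fin.consEquiv fun _ : Fin 3 => Fin 7), Fintype.sum_prod_type]
  refine Finset.sum_congr rfl fun a _ => ?_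
  rw [sum_fin_two]
  rfl

theorem elemForm_two_stdVec (J : Fin 2 → Fin 7) (a b : Fin 7) :
    elemForm J ![stdVec a, stdVec b] =
      ((delta (J 0) a * delta (J 1) b - delta (J 0) b * delta (J 1) a : ℤ) : ℝ) := by
  have h : (![stdVec a, stdVec b] : Fin 2 → E7) = fun i => stdVec ((![a, b] : Fin 2 → Fin 7) i) := by
    funext i; fin_cases i <;> rfl
  rw [h, elemForm_stdVec, Matrix.det_fin_two]
  push_cast
  simp only [delta_eq, Matrix.of_apply, Int.cast_ite, Int.cast_one, Int.cast_zero,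
    Matrix.cons_val_zero, Matrix.cons_val_one]
  exact congrArg₂ (· - ·) rfl (mul_comm _ _)

theorem phi_three_stdVec (i j k : Fin 7) :
    phi ![stdVec i, stdVec j, stdVec k] = (phiVal i j k : ℝ) := by
  have h : (![stdVec i, stdVec j, stdVec k] : Fin 3 → E7) =
      fun a => stdVec ((![i, j, k] : Fin 3 → Fin 7) a) := by
    funext a; fin_cases a <;> rfl
  rw [h, phi_stdVec]
  rfl

theorem sum_mul_delta (f : Fin 7 → ℝ) (i : Fin 7) : ∑ a, f a * (delta i a : ℝ) = f i := by
  simp [delta_eq]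

theorem sum_comm_pairs (f : Fin 7 → Fin 7 → Fin 7 → Fin 7 → ℝ) :
    ∑ a, ∑ b, ∑ i, ∑ j, f a b i j = ∑ i, ∑ j, ∑ a, ∑ b, f a b i j := by
  calc _ = ∑ a, ∑ i, ∑ b, ∑ j, f a b i j :=
        Finset.sum_congr rfl fun a _ => Finset.sum_comm
    _ = ∑ i, ∑ a, ∑ b, ∑ j, f a b i j := Finset.sum_comm
    _ = ∑ i, ∑ a, ∑ j, ∑ b, f a b i j :=
        Finset.sum_congr rfl fun i _ => Finset.sum_congr rfl fun a _ => Finset.sum_comm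
    _ = _ := Finset.sum_congr rfl fun i _ => Finset.sum_comm

theorem form_comp_perm {k : ℕ} (η : E7 [⋀^Fin k]→L[ℝ] ℝ) (v : Fin k → E7)
    (s : Equiv.Perm (Fin k)) : η (fun a => v (s a)) = (Equiv.Perm.sign s : ℝ) * η v := by
  have := η.toAlternatingMap.map_perm v s
  simpa [Units.smul_def, Function.comp_def] using this

theorem interior_stdVec_phi (i : Fin 7) :
    interior (stdVec i) phi = ∑ n, ∑ b : Fin 3, (if phiTriple n b = i then
      (phiCoeff n : ℝ) * (-1) ^ (b : ℕ) else 0) • elemForm (phiTriple n ∘ b.succAbove) := by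
  rw [phi_eq_sum, interior_sum]
  refine Finset.sum_congr rfl fun n _ => ?_
  rw [interior_smul, interior_elemForm, Finset.smul_sum]
  refine Finset.sum_congr rfl fun b _ => ?_
  rw [smul_smul]
  congr 1
  by_cases h : phiTriple n b = i
  · simp [h, stdVec]
  · simp [h, stdVec]

theorem phiVal_antisymm : ∀ i p q : Fin 7, phiVal i q p = -phiVal i p q := by
  intro i p q
  rw [phiVal, phiVal, ← Finset.sum_neg_distrib]
  exact Finset.sum_congr rfl fun m _ => by ring

/-- `φ ∧ (w ⌟ φ) = 2 * (w ⌟ φ)`, in the form of a pairing with `2`-forms. -/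
theorem topWedge_phi_interior (w : E7) (η : E7 [⋀^Fin 2]→L[ℝ] ℝ) :
    topWedge rfl (wedge phi (interior w phi)) η =
      ∑ a, ∑ b, phi ![w, stdVec a, stdVec b] * η ![stdVec a, stdVec b] := by
  have hlin : ∀ w : E7, ∀ a b, phi ![w, stdVec a, stdVec b] =
      interior w phi ![stdVec a, stdVec b] := fun _ _ _ => rfl
  let F : E7 →ₗ[ℝ] ℝ :=
    { toFun := fun w => topWedge rfl (wedge phi (interior w phi)) η
      map_add' := fun v w => by rw [interior_add_vec, wedge_add_right, topWedge_add_left]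
      map_smul' := fun c w => by
        rw [interior_smul_vec, wedge_smul_right, topWedge_smul_left]; rfl }
  let G : E7 →ₗ[ℝ] ℝ :=
    { toFun := fun w => ∑ a, ∑ b, phi ![w, stdVec a, stdVec b] * η ![stdVec a, stdVec b]
      map_add' := fun v w => by
        simp only [hlin, interior_add_vec, ContinuousAlternatingMap.add_apply, add_mul,
          Finset.sum_add_distrib]
      map_smul' := fun c w => by
        simp only [hlin, interior_smul_vec, ContinuousAlternatingMap.smul_apply, smul_eq_mul,
          Finset.mul_sum, mul_assoc, RingHom.id_apply] }
  -- Both sides are linear in `w` and in `η`, which leaves basis vectors and elementary `2`-forms.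
  refine LinearMap.congr_fun (linear_ext_stdVec (f := F) (g := G) fun i => ?_) w
  change topWedge rfl (wedge phi (interior (stdVec i) phi)) η =
    ∑ a, ∑ b, phi ![stdVec i, stdVec a, stdVec b] * η ![stdVec a, stdVec b]
  induction η using form_induction with
  | h0 J =>
    -- The sum over ordered pairs `(a, b)` meets `(p, q)` and `(q, p)`; this is the factor `2` of
    -- the eigenvalue identity.
    obtain ⟨p, q, rfl⟩ : ∃ p q, J = ![p, q] := ⟨J 0, J 1, by funext a; fin_cases a <;> rfl⟩
    have hR : ∑ a, ∑ b, phi ![stdVec i, stdVec a, stdVec b] *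
        elemForm ![p, q] ![stdVec a, stdVec b] = ((2 * phiVal i p q : ℤ) : ℝ) := by
      have h1 : ∀ a b, phi ![stdVec i, stdVec a, stdVec b] *
          elemForm ![p, q] ![stdVec a, stdVec b] =
          (phiVal i a b : ℝ) * (delta q b : ℝ) * (delta p a : ℝ) -
            (phiVal i a b : ℝ) * (delta p b : ℝ) * (delta q a : ℝ) := by
        intro a b
        rw [phi_three_stdVec, elemForm_two_stdVec]
        push_cast
        change (phiVal i a b : ℝ) * ((delta p a : ℝ) * (delta q b : ℝ) -
          (delta p b : ℝ) * (delta q a : ℝ)) = _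
        ring
      simp only [h1, Finset.sum_sub_distrib, ← Finset.sum_mul, sum_mul_delta]
      rw [phiVal_antisymm i q p]
      push_cast
      ring
    rw [hR, ← sum_eps_wedge_interior i p q, interior_stdVec_phi, phi_eq_sum, wedge_sum_left,
      topWedge_sum_left]
    push_cast
    refine Finset.sum_congr rfl fun m _ => ?_
    rw [wedge_smul_left, wedge_sum_right, topWedge_smul_left, topWedge_sum_left, Finset.mul_sum]
    refine Finset.sum_congr rfl fun n _ => ?_
    rw [wedge_sum_right, topWedge_sum_left, Finset.mul_sum]
    refine Finset.sum_congr rfl fun b _ => ?_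
    rw [wedge_smul_right, topWedge_smul_left, wedge_elemForm, topWedge_elemForm]
    by_cases h : phiTriple n b = i
    · rw [if_pos h, if_pos h]
      push_cast
      ring
    · rw [if_neg h, if_neg h]
      simp
  | hadd α β h h' =>
    rw [topWedge_add_right, h, h']
    simp only [ContinuousAlternatingMap.add_apply, mul_add, Finset.sum_add_distrib]
  | hsmul c α h =>
    rw [topWedge_smul_right, h]
    simp only [ContinuousAlternatingMap.smul_apply, smul_eq_mul, Finset.mul_sum, mul_left_comm]

theorem hodge_refl_stdVec {k l : ℕ} (h : k + l = 7) (β : E7 [⋀^Fin k]→L[ℝ] ℝ)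
    (J : Fin l → Fin 7) :
    hodge h (ContinuousLinearEquiv.refl ℝ E7) β (fun a => stdVec (J a)) =
      topWedge h β (elemForm J) := by
  rw [← sum_mul_elemForm (fun I => topWedge h β (elemForm I)) (fun s I => ?_) J]
  · rw [hodge, ContinuousAlternatingMap.smul_apply, ContinuousAlternatingMap.sum_apply]
    rfl
  · rw [elemForm_perm, topWedge_smul_right]

/-- Evaluating the concatenated `7`-form on the standard basis permuted by `s` costs the sign of `s`
and makes the Kronecker matrix block triangular: an identity block for the first three indices, and
the determinant of the complementary `4`-form. -/
theorem hodge_elemForm (s : Equiv.Perm (Fin 7)) :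
    hodge (k := 3) (l := 4) rfl (ContinuousLinearEquiv.refl ℝ E7)
      (elemForm fun a => s (Fin.castAdd 4 a)) =
        (eps s : ℝ) • elemForm (fun a : Fin 4 => s (Fin.natAdd 3 a)) := by
  refine ext_stdVec fun J => ?_
  rw [hodge_refl_stdVec, topWedge_elemForm, ContinuousAlternatingMap.smul_apply, smul_eq_mul]
  set F : Fin 7 → Fin 7 :=
    fun a => Fin.append (fun a : Fin 3 => s (Fin.castAdd 4 a)) J (Fin.cast rfl a) with hF
  have h1 : ∀ c, elemForm F (fun a => stdVec (s a)) = c → (eps F : ℝ) = (eps s : ℝ) * c := by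
    rintro c rfl
    have h2 := form_comp_perm (elemForm F) stdVec s
    rw [h2, elemForm_top, eps_perm, ← mul_assoc]
    norm_cast
    simp
  refine h1 _ ?_
  rw [elemForm_stdVec, elemForm_stdVec]
  rw [← Matrix.det_submatrix_equiv_self (finSumFinEquiv (m := 3) (n := 4)), ← Matrix.det_transpose
    (Matrix.of fun a b => if s (Fin.natAdd 3 b) = J a then (1 : ℝ) else 0)]
  have hb : ((Matrix.of fun a b => if F b = s a then (1 : ℝ) else 0).submatrix
      (finSumFinEquiv (m := 3) (n := 4)) (finSumFinEquiv (m := 3) (n := 4))) =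
      Matrix.fromBlocks 1 (Matrix.of fun (a : Fin 3) (b : Fin 4) =>
        if J b = s (Fin.castAdd 4 a) then (1 : ℝ) else 0) 0
        (Matrix.of fun a b => if s (Fin.natAdd 3 b) = J a then (1 : ℝ) else 0).transpose := by
    have hl : ∀ b, F (finSumFinEquiv (m := 3) (n := 4) (Sum.inl b)) = s (Fin.castAdd 4 b) :=
      fun b => Fin.append_left (fun a : Fin 3 => s (Fin.castAdd 4 a)) J b
    have hr : ∀ b, F (finSumFinEquiv (m := 3) (n := 4) (Sum.inr b)) = J b :=
      fun b => Fin.append_right (fun a : Fin 3 => s (Fin.castAdd 4 a)) J b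
    ext (a | a) (b | b)
    · rw [Matrix.submatrix_apply, Matrix.of_apply, hl, Matrix.fromBlocks_apply₁₁,
        Matrix.one_apply, finSumFinEquiv_apply_left]
      simp [Fin.ext_iff, eq_comm]
    · rw [Matrix.submatrix_apply, Matrix.of_apply, hr, Matrix.fromBlocks_apply₁₂,
        Matrix.of_apply, finSumFinEquiv_apply_left]
    · have hne : Fin.castAdd 4 b ≠ Fin.natAdd 3 a := by
        intro h
        have := congrArg Fin.val h
        simp at this
        omega
      rw [Matrix.submatrix_apply, Matrix.of_apply, hl, Matrix.fromBlocks_apply₂₁,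
        finSumFinEquiv_apply_right]
      exact if_neg (fun h => hne (s.injective h))
    · rw [Matrix.submatrix_apply, Matrix.of_apply, hr, Matrix.fromBlocks_apply₂₂,
        Matrix.transpose_apply, Matrix.of_apply, finSumFinEquiv_apply_right]
      simp [eq_comm]
  rw [hb, Matrix.det_fromBlocks_zero₂₁, Matrix.det_one, one_mul]

theorem phiIndex_bijective (m : Fin 7) : Function.Bijective (phiIndex m) := by
  revert m
  decide

/-- The `4`-form `*φ`. -/
theorem hodge_phi : hodge (k := 3) (l := 4) rfl (ContinuousLinearEquiv.refl ℝ E7) phi =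
    ∑ m, ((phiCoeff m : ℝ) * (eps (phiIndex m) : ℝ)) • elemForm (phiQuad m) := by
  have h : ∀ m, hodge (k := 3) (l := 4) rfl (ContinuousLinearEquiv.refl ℝ E7)
      (elemForm (phiTriple m)) = (eps (phiIndex m) : ℝ) • elemForm (phiQuad m) := fun m =>
    hodge_elemForm (Equiv.ofBijective _ (phiIndex_bijective m))
  refine ext_stdVec fun J => ?_
  rw [hodge_refl_stdVec, phi_eq_sum, topWedge_sum_left, ContinuousAlternatingMap.sum_apply]
  refine Finset.sum_congr rfl fun m _ => ?_
  rw [topWedge_smul_left, ← hodge_refl_stdVec, h m, ContinuousAlternatingMap.smul_apply,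
    ContinuousAlternatingMap.smul_apply, smul_eq_mul, smul_eq_mul, mul_assoc]

/-- `*(α ∧ *φ) = α_# ⌟ φ`. -/
theorem hodge_wedge_hodge_phi (α : E7 [⋀^Fin 1]→L[ℝ] ℝ) (a b : Fin 7) :
    hodge (k := 1 + 4) (l := 2) rfl (ContinuousLinearEquiv.refl ℝ E7)
      (wedge α (hodge (k := 3) (l := 4) rfl (ContinuousLinearEquiv.refl ℝ E7) phi))
        ![stdVec a, stdVec b] =
      ∑ i, α ![stdVec i] * phi ![stdVec i, stdVec a, stdVec b] := by
  have hab : (![stdVec a, stdVec b] : Fin 2 → E7) =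
      fun i => stdVec ((![a, b] : Fin 2 → Fin 7) i) := by
    funext i; fin_cases i <;> rfl
  conv_lhs => rw [hab]
  rw [hodge_refl_stdVec, hodge_phi]
  induction α using form_induction with
  | h0 I =>
    obtain ⟨i, rfl⟩ : ∃ i, I = ![i] := ⟨I 0, by funext a; fin_cases a; rfl⟩
    have h1 : ∀ j, elemForm ![i] ![stdVec j] = (delta i j : ℝ) := by
      intro j
      rw [elemForm_apply, Matrix.det_fin_one, delta_eq]
      simp [stdVec]
    simp only [h1, mul_comm (delta _ _ : ℝ), sum_mul_delta]
    rw [phi_three_stdVec, ← sum_eps_wedge_star, wedge_sum_right, topWedge_sum_left]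
    push_cast
    refine Finset.sum_congr rfl fun m _ => ?_
    rw [wedge_smul_right, topWedge_smul_left, wedge_elemForm, topWedge_elemForm, mul_assoc]
  | hadd α β h h' =>
    rw [wedge_add_left, topWedge_add_left, h, h']
    simp only [ContinuousAlternatingMap.add_apply, add_mul, Finset.sum_add_distrib]
  | hsmul c α h =>
    rw [wedge_smul_left, topWedge_smul_left, h]
    simp only [ContinuousAlternatingMap.smul_apply, smul_eq_mul, Finset.mul_sum, mul_assoc]

theorem sum_phi_mul_phi (v w : E7) :
    ∑ a, ∑ b, phi ![v, stdVec a, stdVec b] * phi ![w, stdVec a, stdVec b] =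
      6 * inner ℝ v w := by
  have hlin : ∀ w : E7, ∀ a b, phi ![w, stdVec a, stdVec b] =
      ∑ i, w i * (phiVal i a b : ℝ) := by
    intro w a b
    conv_lhs => rw [← sum_smul_stdVec w]
    let L : E7 →ₗ[ℝ] ℝ :=
      { toFun := fun w => phi ![w, stdVec a, stdVec b]
        map_add' := fun v w => phi.map_vecCons_add _ v w
        map_smul' := fun c w => phi.map_vecCons_smul _ c w }
    change L _ = _
    rw [map_sum]
    refine Finset.sum_congr rfl fun i _ => ?_
    rw [map_smul, ← phi_three_stdVec]
    rfl
  have h := fun i j => congrArg (Int.cast (R := ℝ)) (sum_phiVal_mul i j)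
  push_cast at h
  calc _ = ∑ a, ∑ b, ∑ i, ∑ j, v i * w j * ((phiVal i a b : ℝ) * (phiVal j a b : ℝ)) := by
        refine Finset.sum_congr rfl fun a _ => Finset.sum_congr rfl fun b _ => ?_
        rw [hlin, hlin, Finset.sum_mul_sum]
        exact Finset.sum_congr rfl fun i _ => Finset.sum_congr rfl fun j _ => by ring
    _ = ∑ i, ∑ j, ∑ a, ∑ b, v i * w j * ((phiVal i a b : ℝ) * (phiVal j a b : ℝ)) := by
        exact sum_comm_pairs _
    _ = ∑ i, ∑ j, v i * w j * (6 * (delta i j : ℝ)) := by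
        refine Finset.sum_congr rfl fun i _ => Finset.sum_congr rfl fun j _ => ?_
        rw [← h]
        simp only [Finset.mul_sum]
    _ = _ := by
        simp only [← mul_assoc, sum_mul_delta, PiLp.inner_apply, Finset.mul_sum]
        refine Finset.sum_congr rfl fun i _ => ?_
        simp
        ring

/-! ### Algebra in a coframe -/

/-- In the Leibniz rule for `φ ∧ (w ⌟ φ) ∧ γ`, the term with both contractions on the middle factor
can be rotated so as to contain `γ ∧ φ = 0`; the other term pairs `2 * (w ⌟ φ)` with `v ⌟ γ`. -/
theorem topWedge_interior_interior (v w : E7) (γ : E7 [⋀^Fin 3]→L[ℝ] ℝ) (hγ : wedge γ phi = 0) :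
    topWedge rfl (wedge (interior v phi) (interior w phi)) γ =
      ∑ a, ∑ b, phi ![w, stdVec a, stdVec b] * γ ![v, stdVec a, stdVec b] := by
  rw [topWedge_interior, topWedge_rotate, hγ, topWedge_zero_left, zero_add,
    topWedge_phi_interior]
  rfl

theorem topWedge_elemForm_nil {k : ℕ} (h : k + 0 = 7) (η : E7 [⋀^Fin k]→L[ℝ] ℝ)
    (J : Fin 0 → Fin 7) :
    topWedge h η (elemForm J) = η fun a => stdVec (Fin.cast h a) := by
  induction η using form_induction with
  | h0 I =>
    rw [topWedge_elemForm, Fin.append_right_nil _ _ rfl]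
    exact (elemForm_top_cast h I).symm
  | hadd α β h1 h2 =>
    rw [topWedge_add_left, h1, h2]
    rfl
  | hsmul c α h1 =>
    rw [topWedge_smul_left, h1]
    rfl

section Coframe

variable {V : Type*} [AddCommGroup V] [Module ℝ V] [TopologicalSpace V]
  [IsTopologicalAddGroup V] [ContinuousSMul ℝ V] (u : V ≃L[ℝ] E7)

theorem coframe_frame (i : Fin 7) : u (frame u i) = stdVec i := u.apply_symm_apply _

/-- The pull-back of a form under a coframe. -/
abbrev pullForm {k : ℕ} (β : E7 [⋀^Fin k]→L[ℝ] ℝ) : V [⋀^Fin k]→L[ℝ] ℝ :=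
  β.compContinuousLinearMap (u : V →L[ℝ] E7)

theorem pullForm_apply {k : ℕ} (β : E7 [⋀^Fin k]→L[ℝ] ℝ) (v : Fin k → V) :
    pullForm u β v = β fun a => u (v a) := rfl

theorem exists_pullForm_eq {k : ℕ} (α : V [⋀^Fin k]→L[ℝ] ℝ) :
    ∃ β : E7 [⋀^Fin k]→L[ℝ] ℝ, α = pullForm u β := by
  refine ⟨α.compContinuousLinearMap (u.symm : E7 →L[ℝ] V), ?_⟩
  ext v
  simp [Function.comp_def]

theorem pullForm_injective {k : ℕ} :
    Function.Injective (pullForm u : (E7 [⋀^Fin k]→L[ℝ] ℝ) → V [⋀^Fin k]→L[ℝ] ℝ) := by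
  intro α β h
  ext v
  have := DFunLike.congr_fun h fun a => u.symm (v a)
  rw [pullForm_apply, pullForm_apply] at this
  simpa only [ContinuousLinearEquiv.apply_symm_apply] using this

theorem pullForm_zero {k : ℕ} : pullForm u (0 : E7 [⋀^Fin k]→L[ℝ] ℝ) = 0 := rfl

/-- A coframe is an oriented isometry to the model, so identities for `*` need only be proved on
`ℝ⁷`. -/
theorem hodge_pullForm {k l : ℕ} (h : k + l = 7) (β : E7 [⋀^Fin k]→L[ℝ] ℝ) :
    hodge h u (pullForm u β) = pullForm u (hodge h (ContinuousLinearEquiv.refl ℝ E7) β) := by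
  ext v
  rw [pullForm_apply, hodge, hodge, ContinuousAlternatingMap.smul_apply,
    ContinuousAlternatingMap.smul_apply, ContinuousAlternatingMap.sum_apply,
    ContinuousAlternatingMap.sum_apply]
  refine congrArg _ (Finset.sum_congr rfl fun I _ => ?_)
  rw [ContinuousAlternatingMap.smul_apply, ContinuousAlternatingMap.smul_apply, wedge_comp,
    ContinuousAlternatingMap.compContinuousLinearMap_apply]
  have h1 : (⇑(u : V →L[ℝ] E7) ∘ fun a => frame u (Fin.cast h a)) =
      fun a => stdVec (Fin.cast h a) := funext fun a => coframe_frame u _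
  rw [h1]
  rfl

/-- `*(α ∧ *σ) = α_# ⌟ σ`. -/
theorem hodge_wedge_hodge (α : V [⋀^Fin 1]→L[ℝ] ℝ) :
    hodge (k := 1 + 4) (l := 2) rfl u
      (wedge α (hodge (k := 3) (l := 4) rfl u (pullPhi u))) =
      interior (∑ i, α ![frame u i] • frame u i) (pullPhi u) := by
  obtain ⟨β, rfl⟩ := exists_pullForm_eq u α
  have h1 : hodge (k := 3) (l := 4) rfl u (pullPhi u) =
      pullForm u (hodge (k := 3) (l := 4) rfl (ContinuousLinearEquiv.refl ℝ E7) phi) :=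
    hodge_pullForm u rfl phi
  rw [h1, wedge_comp, hodge_pullForm, pullPhi, interior_comp]
  refine congrArg _ (ext_stdVec fun J => ?_)
  have hJ : (fun a => stdVec (J a)) = ![stdVec (J 0), stdVec (J 1)] := by
    funext a; fin_cases a <;> rfl
  rw [hJ, hodge_wedge_hodge_phi]
  have hu : (u : V →L[ℝ] E7) (∑ i, pullForm u β ![frame u i] • frame u i) =
      ∑ i, β ![stdVec i] • stdVec i := by
    rw [map_sum]
    refine Finset.sum_congr rfl fun i _ => ?_
    have h2 : pullForm u β ![frame u i] = β ![stdVec i] := by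
      rw [pullForm_apply]
      congr 1
      funext a
      fin_cases a
      exact coframe_frame u i
    rw [h2, map_smul]
    exact congrArg _ (coframe_frame u i)
  rw [hu]
  let L : E7 →ₗ[ℝ] ℝ :=
    { toFun := fun w => interior w phi ![stdVec (J 0), stdVec (J 1)]
      map_add' := fun v w => by rw [interior_add_vec]; rfl
      map_smul' := fun c w => by rw [interior_smul_vec]; rfl }
  change _ = L _
  rw [map_sum]
  refine Finset.sum_congr rfl fun i _ => ?_
  rw [map_smul]
  rfl

theorem pullForm_frame_two (β : E7 [⋀^Fin 3]→L[ℝ] ℝ) (v : V) (a b : Fin 7) :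
    pullForm u β ![v, frame u a, frame u b] = β ![u v, stdVec a, stdVec b] := by
  rw [pullForm_apply]
  congr 1
  funext i
  fin_cases i
  · rfl
  · exact coframe_frame u a
  · exact coframe_frame u b

theorem wedge_interior_pullForm (v w : V) (β : E7 [⋀^Fin 3]→L[ℝ] ℝ) :
    wedge (wedge (interior v (pullPhi u)) (interior w (pullPhi u))) (pullForm u β) =
      pullForm u (wedge (wedge (interior (u v) phi) (interior (u w) phi)) β) := by
  rw [pullPhi, interior_comp, interior_comp, wedge_comp, wedge_comp]
  rfl

/-- `*((v ⌟ σ) ∧ (w ⌟ σ) ∧ γ) = 2 ⟨w ⌟ σ, v ⌟ γ⟩` if `γ ∧ σ = 0`. -/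
theorem hodge_interior_interior (v w : V) (γ : V [⋀^Fin 3]→L[ℝ] ℝ)
    (hγ : wedge γ (pullPhi u) = 0) :
    hodge (k := 2 + 2 + 3) (l := 0) rfl u
      (wedge (wedge (interior v (pullPhi u)) (interior w (pullPhi u))) γ) ![] =
      ∑ a, ∑ b, pullPhi u ![w, frame u a, frame u b] * γ ![v, frame u a, frame u b] := by
  obtain ⟨γ, rfl⟩ := exists_pullForm_eq u γ
  have hγ' : wedge γ phi = 0 := by
    apply pullForm_injective u
    rw [pullForm_zero, ← hγ, pullPhi, wedge_comp]
  have h0 : (fun a => u ((![] : Fin 0 → V) a)) = fun a => stdVec ((![] : Fin 0 → Fin 7) a) :=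
    funext fun a => a.elim0
  rw [wedge_interior_pullForm, hodge_pullForm, pullForm_apply, h0, hodge_refl_stdVec,
    topWedge_elemForm_nil]
  have h := topWedge_interior_interior (u v) (u w) _ hγ'
  rw [topWedge] at h
  rw [h]
  simp only [pullPhi, pullForm_frame_two]

/-- The discarded component lies in the orthogonal complement of `Λ³₂₇`, so the projection need not
be computed. -/
theorem formInner_proj27 {γ : V [⋀^Fin 3]→L[ℝ] ℝ} (hγ : γ ∈ Lambda27 u)
    (η : V [⋀^Fin 3]→L[ℝ] ℝ) : formInner u γ (proj27 u η) = formInner u γ η := by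
  have h := Submodule.projection_add_projection_eq_self (isCompl_Lambda27 u) η
  have h2 := Submodule.projection_apply_mem (isCompl_Lambda27 u).symm η
  have h3 := h2 γ hγ
  conv_rhs => rw [← h]
  rw [map_add, proj27]
  exact (add_eq_left.2 h3).symm

/-- The pairing of `γ` with the alternation of `(v₀, v₁, v₂) ↦ σ(B v₀, v₁, v₂)`. -/
theorem formInner_alternation (γ σ η : V [⋀^Fin 3]→L[ℝ] ℝ) (B : V → V)
    (hη : ∀ x y z, η ![x, y, z] = σ ![B x, y, z] - σ ![B y, x, z] + σ ![B z, x, y]) :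
    formInner u γ η = (1 / 2 : ℝ) * ∑ i, ∑ a, ∑ b,
      σ ![B (frame u i), frame u a, frame u b] * γ ![frame u i, frame u a, frame u b] := by
  have hf : ∀ i j k : Fin 7, (fun a => frame u ((![i, j, k] : Fin 3 → Fin 7) a)) =
      ![frame u i, frame u j, frame u k] := by
    intro i j k
    funext a
    fin_cases a <;> rfl
  have h1 : ∀ x y z, γ ![y, x, z] = -γ ![x, y, z] := by
    intro x y z
    have := γ.toAlternatingMap.map_swap ![x, y, z] (show (0 : Fin 3) ≠ 1 by decide)
    refine Eq.trans (congrArg γ ?_) this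
    funext a
    fin_cases a <;> rfl
  have h2 : ∀ x y z, γ ![y, z, x] = γ ![x, y, z] := by
    intro x y z
    have := γ.toAlternatingMap.map_swap ![y, x, z] (show (1 : Fin 3) ≠ 2 by decide)
    have h3 : γ ![y, z, x] = -γ ![y, x, z] := by
      refine Eq.trans (congrArg γ ?_) this
      funext a
      fin_cases a <;> rfl
    rw [h3, h1, neg_neg]
  rw [formInner_apply, sum_fin_three]
  simp only [hf, hη, mul_add, mul_sub, Finset.sum_add_distrib, Finset.sum_sub_distrib]
  set S := ∑ i, ∑ a, ∑ b, σ ![B (frame u i), frame u a, frame u b] *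
    γ ![frame u i, frame u a, frame u b] with hS
  have e1 : ∑ i, ∑ a, ∑ b, γ ![frame u i, frame u a, frame u b] *
      σ ![B (frame u i), frame u a, frame u b] = S := by
    simp only [hS, mul_comm]
  have e2 : ∑ i, ∑ a, ∑ b, γ ![frame u i, frame u a, frame u b] *
      σ ![B (frame u a), frame u i, frame u b] = -S := by
    rw [Finset.sum_comm, hS]
    simp only [← Finset.sum_neg_distrib]
    refine Finset.sum_congr rfl fun i _ => Finset.sum_congr rfl fun a _ =>
      Finset.sum_congr rfl fun b _ => ?_
    rw [h1, mul_comm, mul_neg]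
  have e3 : ∑ i, ∑ a, ∑ b, γ ![frame u i, frame u a, frame u b] *
      σ ![B (frame u b), frame u i, frame u a] = S := by
    have : ∀ i, ∑ a, ∑ b, γ ![frame u i, frame u a, frame u b] *
      σ ![B (frame u b), frame u i, frame u a] = ∑ b, ∑ a, γ ![frame u i, frame u a, frame u b] *
      σ ![B (frame u b), frame u i, frame u a] := fun i => Finset.sum_comm
    simp only [this]
    rw [Finset.sum_comm, hS]
    refine Finset.sum_congr rfl fun i _ => Finset.sum_congr rfl fun a _ =>
      Finset.sum_congr rfl fun b _ => ?_
    rw [h2, mul_comm]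
  -- After relabelling, the three terms of the alternation contribute equally; against `1/3!` this
  -- gives the factor `½`.
  rw [e1, e2, e3]
  norm_num [Nat.factorial]
  ring

end Coframe

/-! ### Top forms under linear maps, and the cubic expression that determines the metric -/

theorem pullForm_stdVec (u : E7 ≃L[ℝ] E7) (η : E7 [⋀^Fin 7]→L[ℝ] ℝ) :
    η (fun a => u (stdVec a)) = LinearMap.det (u : E7 →ₗ[ℝ] E7) * η stdVec := by
  let b : Module.Basis (Fin 7) ℝ E7 := (EuclideanSpace.basisFun (Fin 7) ℝ).toBasis
  have hb : ∀ i, b i = stdVec i := fun i => by simp [b, stdVec]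
  have hb' : (⇑b : Fin 7 → E7) = stdVec := funext hb
  have h := η.toAlternatingMap.eq_smul_basis_det b
  have h1 := DFunLike.congr_fun h fun a => u (stdVec a)
  have h2 := b.det_comp (u : E7 →ₗ[ℝ] E7) b
  rw [Module.Basis.det_self, mul_one] at h2
  have h3 : b.det (fun a => u (stdVec a)) = LinearMap.det (u : E7 →ₗ[ℝ] E7) := by
    rw [← h2, hb']
    rfl
  refine h1.trans ?_
  rw [AlternatingMap.smul_apply, h3, hb', smul_eq_mul, mul_comm]
  rfl

theorem pullForm_stdVec_cast {n : ℕ} (h : n = 7) (u : E7 ≃L[ℝ] E7) (η : E7 [⋀^Fin n]→L[ℝ] ℝ) :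
    pullForm u η (fun a => stdVec (Fin.cast h a)) =
      LinearMap.det (u : E7 →ₗ[ℝ] E7) * η fun a => stdVec (Fin.cast h a) := by
  subst h
  exact pullForm_stdVec u η

theorem topWedge_pullForm {k l : ℕ} (h : k + l = 7) (u : E7 ≃L[ℝ] E7) (α : E7 [⋀^Fin k]→L[ℝ] ℝ)
    (β : E7 [⋀^Fin l]→L[ℝ] ℝ) :
    topWedge h (pullForm u α) (pullForm u β) =
      LinearMap.det (u : E7 →ₗ[ℝ] E7) * topWedge h α β := by
  rw [topWedge, topWedge, wedge_comp, pullForm_stdVec_cast]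

/-- The cubic expression in `σ` that determines the metric. -/
def metricDensity (σ : E7 [⋀^Fin 3]→L[ℝ] ℝ) (v w : E7) : ℝ :=
  topWedge rfl (wedge (interior v σ) (interior w σ)) σ

/-- The contraction formula applies with `γ = φ`, because `φ ∧ φ = 0` in odd degree; `φᵢₐᵦ φⱼₐᵦ = 6
δᵢⱼ` then produces the metric. -/
theorem metricDensity_pullPhi (u : E7 ≃L[ℝ] E7) (v w : E7) :
    metricDensity (pullPhi u) v w =
      LinearMap.det (u : E7 →ₗ[ℝ] E7) * (6 * inner ℝ (u v) (u w)) := by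
  rw [metricDensity, pullPhi, interior_comp, interior_comp, wedge_comp, topWedge_pullForm,
    topWedge_interior_interior _ _ _ (wedge_self_three phi), sum_phi_mul_phi, real_inner_comm]
  simp only [ContinuousLinearEquiv.coe_coe]

/-! ### Transition maps -/

section Charts

open Filter Topology

variable {M : Type*} [TopologicalSpace M] [ChartedSpace E7 M]

/-- The transition map from the chart at `p` to the chart at `q`. -/
def chartTrans (p q : M) (y : E7) : E7 := extChartAt (𝓡 7) q ((extChartAt (𝓡 7) p).symm y)

theorem symm_chartTrans {p q : M} {y : E7}
    (hq : (extChartAt (𝓡 7) p).symm y ∈ (extChartAt (𝓡 7) q).source) :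
    (extChartAt (𝓡 7) q).symm (chartTrans p q y) = (extChartAt (𝓡 7) p).symm y :=
  (extChartAt (𝓡 7) q).left_inv hq

theorem chartTrans_mem {p q : M} {y : E7}
    (hq : (extChartAt (𝓡 7) p).symm y ∈ (extChartAt (𝓡 7) q).source) :
    chartTrans p q y ∈ (extChartAt (𝓡 7) q).target :=
  (extChartAt (𝓡 7) q).map_source hq

theorem chartTrans_chartTrans {p q r : M} {y : E7}
    (hq : (extChartAt (𝓡 7) p).symm y ∈ (extChartAt (𝓡 7) q).source) :
    chartTrans q r (chartTrans p q y) = chartTrans p r y := by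
  rw [chartTrans, symm_chartTrans hq, chartTrans]

theorem chartTrans_self {p : M} {y : E7} (hy : y ∈ (extChartAt (𝓡 7) p).target) :
    chartTrans p p y = y :=
  (extChartAt (𝓡 7) p).right_inv hy

/-- The domain of a transition map is open. -/
theorem eventually_symm_mem_source {p q : M} {y : E7} (hy : y ∈ (extChartAt (𝓡 7) p).target)
    (hq : (extChartAt (𝓡 7) p).symm y ∈ (extChartAt (𝓡 7) q).source) :
    ∀ᶠ z in 𝓝 y, z ∈ (extChartAt (𝓡 7) p).target ∧
      (extChartAt (𝓡 7) p).symm z ∈ (extChartAt (𝓡 7) q).source := by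
  refine Filter.Eventually.and ((isOpen_extChartAt_target p).mem_nhds hy) ?_
  exact (continuousAt_extChartAt_symm'' hy).preimage_mem_nhds
    ((isOpen_extChartAt_source q).mem_nhds hq)

variable [IsManifold (𝓡 7) ∞ M]

theorem contDiffAt_chartTrans {p q : M} {y : E7} (hy : y ∈ (extChartAt (𝓡 7) p).target)
    (hq : (extChartAt (𝓡 7) p).symm y ∈ (extChartAt (𝓡 7) q).source) :
    ContDiffAt ℝ ∞ (chartTrans p q) y := by
  have h := contDiffWithinAt_ext_coord_change (I := 𝓡 7) (n := ∞) q p (y := y) (by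
    rw [PartialEquiv.trans_source]
    exact ⟨hy, hq⟩)
  rw [modelWithCornersSelf_coe, Set.range_id, contDiffWithinAt_univ] at h
  exact h

theorem differentiableAt_chartTrans {p q : M} {y : E7} (hy : y ∈ (extChartAt (𝓡 7) p).target)
    (hq : (extChartAt (𝓡 7) p).symm y ∈ (extChartAt (𝓡 7) q).source) :
    DifferentiableAt ℝ (chartTrans p q) y :=
  (contDiffAt_chartTrans hy hq).differentiableAt (by simp)

theorem fderiv_chartTrans_comp {p q r : M} {y : E7} (hy : y ∈ (extChartAt (𝓡 7) p).target)
    (hq : (extChartAt (𝓡 7) p).symm y ∈ (extChartAt (𝓡 7) q).source)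
    (hr : (extChartAt (𝓡 7) p).symm y ∈ (extChartAt (𝓡 7) r).source) :
    fderiv ℝ (chartTrans p r) y =
      (fderiv ℝ (chartTrans q r) (chartTrans p q y)).comp (fderiv ℝ (chartTrans p q) y) := by
  have h : chartTrans p r =ᶠ[𝓝 y] chartTrans q r ∘ chartTrans p q := by
    filter_upwards [eventually_symm_mem_source hy hq] with z hz
    exact (chartTrans_chartTrans hz.2).symm
  rw [h.fderiv_eq]
  refine fderiv_comp y (differentiableAt_chartTrans (chartTrans_mem hq) ?_)
    (differentiableAt_chartTrans hy hq)
  rwa [symm_chartTrans hq]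

theorem fderiv_chartTrans_self {p : M} {y : E7} (hy : y ∈ (extChartAt (𝓡 7) p).target) :
    fderiv ℝ (chartTrans p p) y = ContinuousLinearMap.id ℝ E7 := by
  have h : chartTrans p p =ᶠ[𝓝 y] id := by
    filter_upwards [(isOpen_extChartAt_target p).mem_nhds hy] with z hz
    exact chartTrans_self hz
  rw [h.fderiv_eq, fderiv_id]

/-- The derivative of a transition map, as an isomorphism. -/
def transEquiv {p q : M} {y : E7} (hy : y ∈ (extChartAt (𝓡 7) p).target)
    (hq : (extChartAt (𝓡 7) p).symm y ∈ (extChartAt (𝓡 7) q).source) : E7 ≃L[ℝ] E7 :=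
  ContinuousLinearEquiv.equivOfInverse (fderiv ℝ (chartTrans p q) y)
    (fderiv ℝ (chartTrans q p) (chartTrans p q y))
    (fun v => by
      have h := fderiv_chartTrans_comp hy hq ((extChartAt (𝓡 7) p).map_target hy)
      rw [fderiv_chartTrans_self hy] at h
      exact (DFunLike.congr_fun h v).symm)
    (fun v => by
      have hp : (extChartAt (𝓡 7) q).symm (chartTrans p q y) ∈ (extChartAt (𝓡 7) p).source := by
        rw [symm_chartTrans hq]
        exact (extChartAt (𝓡 7) p).map_target hy
      have h := fderiv_chartTrans_comp (chartTrans_mem hq) hp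
        ((extChartAt (𝓡 7) q).map_target (chartTrans_mem hq))
      rw [fderiv_chartTrans_self (chartTrans_mem hq), chartTrans_chartTrans hq,
        chartTrans_self hy] at h
      exact (DFunLike.congr_fun h v).symm)

theorem transEquiv_apply {p q : M} {y : E7} (hy : y ∈ (extChartAt (𝓡 7) p).target)
    (hq : (extChartAt (𝓡 7) p).symm y ∈ (extChartAt (𝓡 7) q).source) (v : E7) :
    transEquiv hy hq v = fderiv ℝ (chartTrans p q) y v := rfl

/-- The tangent space at a point is identified with `ℝ⁷` through the preferred chart there. The
manifold derivative of the inverse chart at `p` is thus the derivative of the transition to the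
chart at the image point, which varies with `y`. -/
theorem chartInvDeriv_eq {p : M} {y : E7} (hy : y ∈ (extChartAt (𝓡 7) p).target) (v : E7) :
    chartInvDeriv p y v = fderiv ℝ (chartTrans p ((extChartAt (𝓡 7) p).symm y)) y v := by
  have hm : MDifferentiableAt 𝓘(ℝ, E7) (𝓡 7) (extChartAt (𝓡 7) p).symm y := by
    have := mdifferentiableWithinAt_extChartAt_symm (I := 𝓡 7) hy
    rw [modelWithCornersSelf_coe, Set.range_id, mdifferentiableWithinAt_univ] at this
    exact this
  have h : chartInvDeriv p y v = fderivWithin ℝ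
      (writtenInExtChartAt 𝓘(ℝ, E7) (𝓡 7) y (extChartAt (𝓡 7) p).symm)
      (Set.range 𝓘(ℝ, E7)) (extChartAt 𝓘(ℝ, E7) y y) v := DFunLike.congr_fun hm.mfderiv v
  rw [h, modelWithCornersSelf_coe, Set.range_id, fderivWithin_univ]
  rfl

theorem chartDeriv_eq (x : M) (v : TangentSpace (𝓡 7) x) : chartDeriv x v = v := by
  rw [chartDeriv, mfderiv_extChartAt_self]
  rfl

theorem TensorField.inChart_eq {k : ℕ} (T : TensorField M k) {p : M} {y : E7}
    (hy : y ∈ (extChartAt (𝓡 7) p).target) (w : Fin k → E7) :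
    TensorField.inChart T p y w = T ((extChartAt (𝓡 7) p).symm y)
      (fun i => fderiv ℝ (chartTrans p ((extChartAt (𝓡 7) p).symm y)) y (w i)) := by
  rw [TensorField.inChart]
  exact congrArg _ (funext fun i => chartInvDeriv_eq hy (w i))

theorem TensorField.inChart_center {k : ℕ} (T : TensorField M k) (x : M) (w : Fin k → E7) :
    TensorField.inChart T x (extChartAt (𝓡 7) x x) w = T x w := by
  rw [TensorField.inChart_eq T (mem_extChartAt_target x), extChartAt_to_inv x]
  refine congrArg _ (funext fun i => ?_)
  exact DFunLike.congr_fun (fderiv_chartTrans_self (mem_extChartAt_target x)) (w i)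

theorem TensorField.inChart_trans {k : ℕ} (T : TensorField M k) {p q : M} {y : E7}
    (hy : y ∈ (extChartAt (𝓡 7) p).target)
    (hq : (extChartAt (𝓡 7) p).symm y ∈ (extChartAt (𝓡 7) q).source) (w : Fin k → E7) :
    TensorField.inChart T p y w = TensorField.inChart T q (chartTrans p q y)
      (fun i => fderiv ℝ (chartTrans p q) y (w i)) := by
  rw [TensorField.inChart_eq T hy, TensorField.inChart_eq T (chartTrans_mem hq),
    symm_chartTrans hq]
  refine congrArg _ (funext fun i => ?_)
  rw [fderiv_chartTrans_comp hy hq (mem_extChartAt_source _)]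
  rfl

/-- A form, as a tensor field. -/
def Form.toTensor {k : ℕ} (η : Form M k) : TensorField M k := fun x v => η x v

theorem Form.inChart_apply {k : ℕ} (η : Form M k) (p : M) (y : E7) (w : Fin k → E7) :
    Form.inChart η p y w = TensorField.inChart (Form.toTensor η) p y w := rfl

theorem Form.inChart_center {k : ℕ} (η : Form M k) (x : M) (w : Fin k → E7) :
    Form.inChart η x (extChartAt (𝓡 7) x x) w = η x w :=
  TensorField.inChart_center (Form.toTensor η) x w

/-- The derivative of the inverse chart, as an isomorphism. -/
def chartInvEquiv {p : M} {y : E7} (hy : y ∈ (extChartAt (𝓡 7) p).target) :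
    E7 ≃L[ℝ] TangentSpace (𝓡 7) ((extChartAt (𝓡 7) p).symm y) :=
  transEquiv hy (mem_extChartAt_source ((extChartAt (𝓡 7) p).symm y))

theorem chartInvEquiv_apply {p : M} {y : E7} (hy : y ∈ (extChartAt (𝓡 7) p).target) (v : E7) :
    chartInvEquiv hy v = chartInvDeriv p y v :=
  (chartInvDeriv_eq hy v).symm

end Charts

/-! ### Smoothness of algebraic operations on forms -/

section Smooth

variable {s : Set E7} {n : ℕ∞ω}

theorem contDiffOn_wedge_apply {k l : ℕ} {α : E7 → E7 [⋀^Fin k]→L[ℝ] ℝ}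
    {β : E7 → E7 [⋀^Fin l]→L[ℝ] ℝ} (hα : ∀ v, ContDiffOn ℝ n (fun y => α y v) s)
    (hβ : ∀ v, ContDiffOn ℝ n (fun y => β y v) s) (v : Fin (k + l) → E7) :
    ContDiffOn ℝ n (fun y => wedge (α y) (β y) v) s := by
  simp only [wedge_apply]
  refine contDiffOn_const.mul (ContDiffOn.sum fun σ _ => ?_)
  exact ((hα _).mul (hβ _)).const_smul _

theorem contDiffOn_topWedge {k l : ℕ} (h : k + l = 7) {α : E7 → E7 [⋀^Fin k]→L[ℝ] ℝ}
    {β : E7 → E7 [⋀^Fin l]→L[ℝ] ℝ} (hα : ∀ v, ContDiffOn ℝ n (fun y => α y v) s)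
    (hβ : ∀ v, ContDiffOn ℝ n (fun y => β y v) s) :
    ContDiffOn ℝ n (fun y => topWedge h (α y) (β y)) s := by
  simp only [topWedge]
  exact contDiffOn_wedge_apply hα hβ _

theorem contDiffOn_metricDensity {σ : E7 → E7 [⋀^Fin 3]→L[ℝ] ℝ}
    (hσ : ∀ v, ContDiffOn ℝ n (fun y => σ y v) s) (v w : E7) :
    ContDiffOn ℝ n (fun y => metricDensity (σ y) v w) s := by
  have h : ∀ v, ∀ w, ContDiffOn ℝ n (fun y => interior v (σ y) w) s := fun v w => hσ _
  have h2 := contDiffOn_wedge_apply (h v) (h w)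
  simp only [metricDensity]
  exact contDiffOn_topWedge rfl h2 hσ

theorem contDiffOn_det {A : E7 → Matrix (Fin 7) (Fin 7) ℝ}
    (hA : ∀ i j, ContDiffOn ℝ n (fun y => A y i j) s) :
    ContDiffOn ℝ n (fun y => (A y).det) s := by
  simp only [Matrix.det_apply]
  refine ContDiffOn.sum fun σ _ => ContDiffOn.const_smul _ ?_
  exact contDiffOn_prod fun i _ => hA _ _

theorem contDiffOn_inv {A : E7 → Matrix (Fin 7) (Fin 7) ℝ}
    (hA : ∀ i j, ContDiffOn ℝ n (fun y => A y i j) s) (h0 : ∀ y ∈ s, (A y).det ≠ 0)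
    (i j : Fin 7) : ContDiffOn ℝ n (fun y => (A y)⁻¹ i j) s := by
  simp only [Matrix.inv_def, Matrix.smul_apply, Ring.inverse_eq_inv', Matrix.adjugate_apply]
  refine ((contDiffOn_det hA).inv h0).smul (contDiffOn_det fun a b => ?_)
  by_cases ha : a = j
  · subst ha
    simp only [Matrix.updateRow_self]
    exact contDiffOn_const
  · simp only [Matrix.updateRow_ne ha]
    exact hA a b

end Smooth

/-! ### Gram matrices -/

/-- The Gram matrix of a bilinear form on `ℝ⁷`. -/
def gramOf (g : E7 →L[ℝ] E7 →L[ℝ] ℝ) : Matrix (Fin 7) (Fin 7) ℝ :=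
  Matrix.of fun i j => g (stdVec i) (stdVec j)

/-- The pull-back of the Euclidean inner product. -/
def pullInner (U : E7 →L[ℝ] E7) : E7 →L[ℝ] E7 →L[ℝ] ℝ := (innerSL ℝ).bilinearComp U U

theorem pullInner_apply (U : E7 →L[ℝ] E7) (v w : E7) : pullInner U v w = inner ℝ (U v) (U w) := rfl

/-- The matrix of a linear map. -/
def matOf (U : E7 →L[ℝ] E7) : Matrix (Fin 7) (Fin 7) ℝ := Matrix.of fun k i => U (stdVec i) k

theorem det_matOf (U : E7 →L[ℝ] E7) : (matOf U).det = LinearMap.det (U : E7 →ₗ[ℝ] E7) := by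
  rw [← LinearMap.det_toMatrix (EuclideanSpace.basisFun (Fin 7) ℝ).toBasis]
  congr 1

theorem gramOf_pullInner (U : E7 →L[ℝ] E7) :
    gramOf (pullInner U) = (matOf U).transpose * matOf U := by
  ext i j
  simp [gramOf, pullInner_apply, matOf, Matrix.mul_apply, PiLp.inner_apply, mul_comm]

theorem det_gramOf_pullInner (U : E7 →L[ℝ] E7) :
    (gramOf (pullInner U)).det = LinearMap.det (U : E7 →ₗ[ℝ] E7) ^ 2 := by
  rw [gramOf_pullInner, Matrix.det_mul, Matrix.det_transpose, det_matOf, sq]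

theorem det_ne_zero_of_equiv (u : E7 ≃L[ℝ] E7) : LinearMap.det (u : E7 →ₗ[ℝ] E7) ≠ 0 :=
  (LinearEquiv.isUnit_det' u.toLinearEquiv).ne_zero

/-- The `g`-trace of a bilinear form, in an orthonormal frame and in the standard basis. -/
theorem sum_frame_eq (u : E7 ≃L[ℝ] E7) (B : E7 → E7 → ℝ)
    (ha : ∀ v v' w, B (v + v') w = B v w + B v' w) (hs : ∀ (c : ℝ) v w, B (c • v) w = c * B v w)
    (ha' : ∀ v w w', B v (w + w') = B v w + B v w') (hs' : ∀ (c : ℝ) v w, B v (c • w) = c * B v w) :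
    ∑ i, B (frame u i) (frame u i) =
      ∑ b, ∑ c, (gramOf (pullInner (u : E7 →L[ℝ] E7)))⁻¹ b c * B (stdVec b) (stdVec c) := by
  let B' : E7 →ₗ[ℝ] E7 →ₗ[ℝ] ℝ := LinearMap.mk₂ ℝ B ha hs ha' hs'
  have hB : ∀ v w, B v w = ∑ b, ∑ c, v b * w c * B (stdVec b) (stdVec c) := by
    intro v w
    change B' v w = ∑ b, ∑ c, v b * w c * B' (stdVec b) (stdVec c)
    conv_lhs => rw [← sum_smul_stdVec v, ← sum_smul_stdVec w]
    simp only [map_sum, LinearMap.sum_apply, map_smul, LinearMap.smul_apply, smul_eq_mul,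
      Finset.mul_sum]
    rw [Finset.sum_comm]
    refine Finset.sum_congr rfl fun b _ => Finset.sum_congr rfl fun c _ => by ring
  have hinv : matOf (u : E7 →L[ℝ] E7) * matOf (u.symm : E7 →L[ℝ] E7) = 1 := by
    ext i j
    have h := congrArg (fun v : E7 => v i) (u.apply_symm_apply (stdVec j))
    have h2 : u (u.symm (stdVec j)) = ∑ a, (u.symm (stdVec j)) a • u (stdVec a) := by
      conv_lhs => rw [← sum_smul_stdVec (u.symm (stdVec j))]
      simp only [map_sum, map_smul]
    have h3 : (stdVec j : E7) i = (1 : Matrix (Fin 7) (Fin 7) ℝ) i j := by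
      simp [stdVec, Matrix.one_apply]
    rw [← h3, ← h, h2]
    simp [Matrix.mul_apply, matOf, mul_comm]
  -- The Gram matrix is `UᵀU`, so its inverse is `U⁻¹ U⁻ᵀ`, and the columns of `U⁻¹` are the frame
  -- vectors.
  have hP : (gramOf (pullInner (u : E7 →L[ℝ] E7)))⁻¹ =
      matOf (u.symm : E7 →L[ℝ] E7) * (matOf (u.symm : E7 →L[ℝ] E7)).transpose := by
    rw [gramOf_pullInner]
    refine Matrix.inv_eq_right_inv ?_
    calc _ = (matOf (u : E7 →L[ℝ] E7)).transpose *
          (matOf (u : E7 →L[ℝ] E7) * matOf (u.symm : E7 →L[ℝ] E7)) *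
          (matOf (u.symm : E7 →L[ℝ] E7)).transpose := by simp only [Matrix.mul_assoc]
      _ = 1 := by
        rw [hinv, Matrix.mul_one, ← Matrix.transpose_mul, mul_eq_one_comm.1 hinv,
          Matrix.transpose_one]
  rw [hP]
  simp only [hB (frame u _)]
  rw [Finset.sum_comm]
  refine Finset.sum_congr rfl fun b _ => ?_
  rw [Finset.sum_comm]
  refine Finset.sum_congr rfl fun c _ => ?_
  rw [Matrix.mul_apply, Finset.sum_mul]
  rfl

/-! ### The metric in a chart -/

section Metric

variable {M : Type*} [TopologicalSpace M] [ChartedSpace E7 M]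

namespace G2Structure

variable (S : G2Structure M)

/-- The coframe in the chart at `p`. -/
def chartCoframe (p : M) (y : E7) : E7 →L[ℝ] E7 :=
  (S.coframe ((extChartAt (𝓡 7) p).symm y) : _ →L[ℝ] E7).comp (chartInvDeriv p y)

/-- The metric in the chart at `p`. -/
def chartMetric (p : M) (y : E7) : E7 →L[ℝ] E7 →L[ℝ] ℝ := pullInner (S.chartCoframe p y)

theorem metric_inChart (p : M) (y v w : E7) :
    TensorField.inChart S.metric p y ![v, w] = S.chartMetric p y v w := rfl

theorem gram_eq (p : M) (y : E7) : S.gram p y = gramOf (S.chartMetric p y) := by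
  ext i j
  rw [gram, gramOf, Matrix.of_apply, Matrix.of_apply, metric_inChart]

theorem det_gram (p : M) (y : E7) :
    (S.gram p y).det = LinearMap.det (S.chartCoframe p y : E7 →ₗ[ℝ] E7) ^ 2 := by
  rw [gram_eq, chartMetric, det_gramOf_pullInner]

theorem form_inChart (p : M) (y : E7) :
    Form.inChart S.form p y = phi.compContinuousLinearMap (S.chartCoframe p y) := by
  rw [Form.inChart, S.form_eq]
  rfl

theorem chartMetric_symm (p : M) (y v w : E7) : S.chartMetric p y v w = S.chartMetric p y w v := by
  rw [chartMetric, pullInner_apply, pullInner_apply, real_inner_comm]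

variable [IsManifold (𝓡 7) ∞ M]

/-- The coframe in the chart at `p`, as an isomorphism. -/
def chartCoframeEquiv {p : M} {y : E7} (hy : y ∈ (extChartAt (𝓡 7) p).target) : E7 ≃L[ℝ] E7 :=
  (chartInvEquiv hy).trans (S.coframe ((extChartAt (𝓡 7) p).symm y))

theorem chartCoframeEquiv_apply {p : M} {y : E7} (hy : y ∈ (extChartAt (𝓡 7) p).target) (v : E7) :
    S.chartCoframeEquiv hy v = S.chartCoframe p y v :=
  congrArg (S.coframe ((extChartAt (𝓡 7) p).symm y)) (chartInvEquiv_apply hy v)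

theorem coe_chartCoframeEquiv {p : M} {y : E7} (hy : y ∈ (extChartAt (𝓡 7) p).target) :
    (S.chartCoframeEquiv hy : E7 →L[ℝ] E7) = S.chartCoframe p y :=
  ContinuousLinearMap.ext (S.chartCoframeEquiv_apply hy)

theorem det_chartCoframeEquiv {p : M} {y : E7} (hy : y ∈ (extChartAt (𝓡 7) p).target) :
    LinearMap.det (S.chartCoframeEquiv hy : E7 →ₗ[ℝ] E7) =
      LinearMap.det (S.chartCoframe p y : E7 →ₗ[ℝ] E7) := by
  rw [← coe_chartCoframeEquiv S hy]
  rfl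

theorem form_inChart_eq_pullPhi {p : M} {y : E7} (hy : y ∈ (extChartAt (𝓡 7) p).target) :
    Form.inChart S.form p y = pullPhi (S.chartCoframeEquiv hy) := by
  rw [form_inChart, pullPhi, coe_chartCoframeEquiv]

theorem det_chartCoframe_ne_zero {p : M} {y : E7} (hy : y ∈ (extChartAt (𝓡 7) p).target) :
    LinearMap.det (S.chartCoframe p y : E7 →ₗ[ℝ] E7) ≠ 0 := by
  rw [← det_chartCoframeEquiv S hy]
  exact det_ne_zero_of_equiv _

theorem det_gram_pos {p : M} {y : E7} (hy : y ∈ (extChartAt (𝓡 7) p).target) :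
    0 < (S.gram p y).det := by
  rw [det_gram]
  exact sq_pos_of_ne_zero (S.det_chartCoframe_ne_zero hy)

theorem metricDensity_form {p : M} {y : E7} (hy : y ∈ (extChartAt (𝓡 7) p).target) (v w : E7) :
    metricDensity (Form.inChart S.form p y) v w =
      6 * LinearMap.det (S.chartCoframe p y : E7 →ₗ[ℝ] E7) * S.chartMetric p y v w := by
  rw [form_inChart_eq_pullPhi S hy, metricDensity_pullPhi, chartMetric, pullInner_apply,
    chartCoframeEquiv_apply, chartCoframeEquiv_apply, det_chartCoframeEquiv]
  ring

theorem contDiffOn_form_apply {k : ℕ} {η : Form M k} (hη : Form.IsSmooth η) (p : M)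
    (v : Fin k → E7) :
    ContDiffOn ℝ ∞ (fun y => Form.inChart η p y v) (extChartAt (𝓡 7) p).target :=
  (ContinuousAlternatingMap.apply ℝ E7 ℝ v).contDiff.comp_contDiffOn (hη p)

/-- The matrix of the cubic expression is `6 δ G` with `det G = δ²`, so its determinant is `6⁷ δ⁹`,
a polynomial in the coefficients of `σ`. A nonvanishing ninth root is smooth. -/
theorem contDiffOn_det_chartCoframe (p : M) :
    ContDiffOn ℝ ∞ (fun y => LinearMap.det (S.chartCoframe p y : E7 →ₗ[ℝ] E7))
      (extChartAt (𝓡 7) p).target := by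
  set δ : E7 → ℝ := fun y => LinearMap.det (S.chartCoframe p y : E7 →ₗ[ℝ] E7) with hδ
  set D : E7 → ℝ := fun y => (Matrix.of fun i j : Fin 7 =>
    metricDensity (Form.inChart S.form p y) (stdVec i) (stdVec j)).det / 6 ^ 7 with hD
  have hsm : ContDiffOn ℝ ∞ D (extChartAt (𝓡 7) p).target :=
    (contDiffOn_det fun i j => contDiffOn_metricDensity
      (contDiffOn_form_apply S.smooth p) _ _).div_const _
  have hDδ : ∀ y ∈ (extChartAt (𝓡 7) p).target, D y = δ y ^ 9 := by
    intro y hy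
    have h : (Matrix.of fun i j : Fin 7 =>
        metricDensity (Form.inChart S.form p y) (stdVec i) (stdVec j)) =
        (6 * δ y) • S.gram p y := by
      ext i j
      rw [Matrix.of_apply, metricDensity_form S hy]
      rfl
    rw [hD]
    dsimp only
    rw [h, Matrix.det_smul, det_gram, Fintype.card_fin]
    simp only [hδ]
    ring
  have hδ0 : ∀ y ∈ (extChartAt (𝓡 7) p).target, δ y ≠ 0 := fun y hy =>
    S.det_chartCoframe_ne_zero hy
  -- A ninth root valid for both signs of `δ`: the real power is taken of `D² = (δ²)⁹ > 0`, giving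
  -- `δ⁻⁸`, and `D = δ⁹` restores the sign.
  have h1 : ∀ y ∈ (extChartAt (𝓡 7) p).target, δ y = D y * ((D y ^ 2) ^ (-(4 / 9) : ℝ)) := by
    intro y hy
    rw [hDδ y hy]
    have h2 : (δ y ^ 9) ^ 2 = (δ y ^ 2) ^ (9 : ℝ) := by
      have h5 : (9 : ℝ) = ((9 : ℕ) : ℝ) := by norm_num
      rw [h5, Real.rpow_natCast]
      ring
    have h3 : 0 < δ y ^ 2 := sq_pos_of_ne_zero (hδ0 y hy)
    rw [h2, ← Real.rpow_mul h3.le]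
    have h4 : (9 : ℝ) * (-(4 / 9)) = -(4 : ℕ) := by norm_num
    rw [h4, Real.rpow_neg h3.le, Real.rpow_natCast]
    have := hδ0 y hy
    field_simp
  refine ContDiffOn.congr (hsm.mul ((hsm.pow 2).rpow_const_of_ne fun y hy => ?_)) h1
  rw [hDδ y hy]
  exact pow_ne_zero _ (pow_ne_zero _ (hδ0 y hy))

theorem contDiffOn_chartMetric (p : M) :
    ContDiffOn ℝ ∞ (S.chartMetric p) (extChartAt (𝓡 7) p).target := by
  rw [contDiffOn_clm_apply]
  intro v
  rw [contDiffOn_clm_apply]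
  intro w
  have h : ∀ y ∈ (extChartAt (𝓡 7) p).target, S.chartMetric p y v w =
      metricDensity (Form.inChart S.form p y) v w /
        (6 * LinearMap.det (S.chartCoframe p y : E7 →ₗ[ℝ] E7)) := by
    intro y hy
    have := S.det_chartCoframe_ne_zero hy
    rw [metricDensity_form S hy]
    field_simp
  refine ContDiffOn.congr (ContDiffOn.div (contDiffOn_metricDensity
    (contDiffOn_form_apply S.smooth p) _ _)
    (contDiffOn_const.mul (S.contDiffOn_det_chartCoframe p)) fun y hy => ?_) h
  exact mul_ne_zero (by norm_num) (S.det_chartCoframe_ne_zero hy)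

theorem contDiffOn_gram_inv (p : M) (i j : Fin 7) :
    ContDiffOn ℝ ∞ (fun y => (S.gram p y)⁻¹ i j) (extChartAt (𝓡 7) p).target :=
  contDiffOn_inv (fun _ _ => ((S.contDiffOn_chartMetric p).clm_apply contDiffOn_const).clm_apply
    contDiffOn_const) (fun _ hy => (S.det_gram_pos hy).ne') i j

end G2Structure

end Metric

/-! ### Riemannian geometry of an open subset of `ℝ⁷` -/

section LocalGeometry

open Filter Topology

/-- The determinant, as a function of the rows. -/
def detRows (n : ℕ) : ContinuousMultilinearMap ℝ (fun _ : Fin n => Fin n → ℝ) ℝ where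
  toMultilinearMap := (Matrix.detRowAlternating : (Fin n → ℝ) [⋀^Fin n]→ₗ[ℝ] ℝ).toMultilinearMap
  cont := by
    change Continuous fun v : Fin n → Fin n → ℝ => Matrix.det (Matrix.of fun a b => v a b)
    exact Continuous.matrix_det (by fun_prop)

/-- Jacobi's formula. -/
theorem hasFDerivAt_det {n : ℕ} {A : E7 → Matrix (Fin n) (Fin n) ℝ}
    {A' : Fin n → Fin n → E7 →L[ℝ] ℝ}
    {y : E7} (hA : ∀ i j, HasFDerivAt (fun y => A y i j) (A' i j) y) (h0 : (A y).det ≠ 0) :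
    HasFDerivAt (fun y => (A y).det)
      ((A y).det • ∑ i, ∑ j, (A y)⁻¹ j i • A' i j) y := by
  have h1 : HasFDerivAt (fun y => fun i j => A y i j)
      (ContinuousLinearMap.pi fun i => ContinuousLinearMap.pi fun j => A' i j) y :=
    hasFDerivAt_pi.2 fun i => hasFDerivAt_pi.2 fun j => hA i j
  have h2 := ((detRows n).hasFDerivAt (fun i j => A y i j)).comp y h1
  refine HasFDerivAt.congr_fderiv h2 ?_
  ext w
  rw [ContinuousLinearMap.comp_apply, ContinuousMultilinearMap.linearDeriv_apply,
    smul_apply, sum_apply, smul_eq_mul, Finset.mul_sum]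
  refine Finset.sum_congr rfl fun i _ => ?_
  have h3 : detRows n (Function.update (fun i j => A y i j) i
      ((ContinuousLinearMap.pi fun i => ContinuousLinearMap.pi fun j => A' i j) w i)) =
      ((A y).updateRow i fun j => A' i j w).det := rfl
  -- Differentiating along row `i` replaces that row, and Cramer's rule expresses the result by the
  -- adjugate.
  rw [h3, ← Matrix.cramer_transpose_apply, Matrix.cramer_eq_adjugate_mulVec,
    ← Matrix.adjugate_transpose, Matrix.mulVec_eq_sum, Finset.sum_apply,
    sum_apply, Finset.mul_sum]
  refine Finset.sum_congr rfl fun j _ => ?_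
  rw [Matrix.inv_def, Ring.inverse_eq_inv']
  simp only [Matrix.smul_apply, Matrix.transpose_apply, Pi.smul_apply, smul_eq_mul,
    smul_apply, MulOpposite.smul_eq_mul_unop, MulOpposite.unop_op]
  field_simp

variable {g : E7 → E7 →L[ℝ] E7 →L[ℝ] ℝ} {y : E7}

theorem fderiv_apply_apply (hg : DifferentiableAt ℝ g y) (v w z : E7) :
    fderiv ℝ (fun y' => g y' w z) y v = fderiv ℝ g y v w z := by
  have h := (hg.hasFDerivAt.clm_apply (hasFDerivAt_const w y)).clm_apply (hasFDerivAt_const z y)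
  rw [h.fderiv]
  simp

variable (g y) in
/-- The Levi-Civita connection with lowered index. -/
def koszul (v w z : E7) : ℝ :=
  (1 / 2 : ℝ) * (fderiv ℝ g y v w z + fderiv ℝ g y w v z - fderiv ℝ g y z v w)

theorem fderiv_symm (hg : DifferentiableAt ℝ g y) (hs : ∀ᶠ y' in 𝓝 y, ∀ v w, g y' v w = g y' w v)
    (v w z : E7) : fderiv ℝ g y v w z = fderiv ℝ g y v z w := by
  rw [← fderiv_apply_apply hg, ← fderiv_apply_apply hg]
  have h : (fun y' => g y' w z) =ᶠ[𝓝 y] fun y' => g y' z w := hs.mono fun y' h => h w z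
  rw [h.fderiv_eq]

theorem koszul_add_koszul (hg : DifferentiableAt ℝ g y)
    (hs : ∀ᶠ y' in 𝓝 y, ∀ v w, g y' v w = g y' w v) (v w z : E7) :
    koszul g y v w z + koszul g y v z w = fderiv ℝ g y v w z := by
  rw [koszul, koszul, fderiv_symm hg hs v z w]
  ring

theorem koszul_symm (hg : DifferentiableAt ℝ g y)
    (hs : ∀ᶠ y' in 𝓝 y, ∀ v w, g y' v w = g y' w v) (v w z : E7) :
    koszul g y v w z = koszul g y w v z := by
  rw [koszul, koszul, fderiv_symm hg hs z v w]
  ring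

/-- A symmetric metric connection is the Levi-Civita connection. -/
theorem eq_koszul {Γ : E7 → E7 → E7}
    (hs : ∀ᶠ y' in 𝓝 y, ∀ v w, g y' v w = g y' w v) (hsymm : ∀ v w, Γ v w = Γ w v)
    (hcompat : ∀ v w z, fderiv ℝ g y v w z = g y (Γ v w) z + g y w (Γ v z)) (v w z : E7) :
    g y (Γ v w) z = koszul g y v w z := by
  have h0 := hs.self_of_nhds
  rw [koszul, hcompat, hcompat, hcompat, hsymm w v, hsymm z v, hsymm z w, h0 v (Γ w z),
    h0 w (Γ v z)]
  ring

/-- The trace of an endomorphism, through the metric. -/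
theorem sum_inv_mul_left {G : E7 →L[ℝ] E7 →L[ℝ] ℝ} (h0 : (gramOf G).det ≠ 0) (L : Fin 7 → E7) :
    ∑ b, ∑ c, (gramOf G)⁻¹ c b * G (L b) (stdVec c) = ∑ b, L b b := by
  have h1 : ∀ b c, G (L b) (stdVec c) = ∑ a, L b a * gramOf G a c := by
    intro b c
    conv_lhs => rw [← sum_smul_stdVec (L b)]
    simp [gramOf]
  refine Finset.sum_congr rfl fun b _ => ?_
  simp only [h1, Finset.mul_sum]
  rw [Finset.sum_comm]
  have h2 : ∀ a, ∑ c, (gramOf G)⁻¹ c b * (L b a * gramOf G a c) =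
      L b a * (gramOf G * (gramOf G)⁻¹) a b := by
    intro a
    rw [Matrix.mul_apply, Finset.mul_sum]
    exact Finset.sum_congr rfl fun c _ => by ring
  simp only [h2, Matrix.mul_nonsing_inv _ (isUnit_iff_ne_zero.2 h0), Matrix.one_apply]
  simp

/-- The derivative of the Riemannian volume density. -/
theorem hasFDerivAt_sqrt_det (hg : DifferentiableAt ℝ g y) (h0 : 0 < (gramOf (g y)).det) :
    HasFDerivAt (fun y' => Real.sqrt (gramOf (g y')).det)
      (Real.sqrt (gramOf (g y)).det • ∑ i, ∑ j, ((1 / 2 : ℝ) * (gramOf (g y))⁻¹ j i) •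
        fderiv ℝ (fun y' => g y' (stdVec i) (stdVec j)) y) y := by
  have h1 : ∀ i j, HasFDerivAt (fun y' => gramOf (g y') i j)
      (fderiv ℝ (fun y' => g y' (stdVec i) (stdVec j)) y) y := fun i j =>
    ((hg.clm_apply (differentiableAt_const _)).clm_apply (differentiableAt_const _)).hasFDerivAt
  refine ((hasFDerivAt_det h1 h0.ne').sqrt h0.ne').congr_fderiv ?_
  have h2 : (1 / (2 * Real.sqrt (gramOf (g y)).det)) * (gramOf (g y)).det =
      Real.sqrt (gramOf (g y)).det * (1 / 2) := by
    have h3 : 0 < Real.sqrt (gramOf (g y)).det := Real.sqrt_pos.2 h0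
    have h4 := Real.mul_self_sqrt h0.le
    field_simp
    rw [sq, h4]
  rw [smul_smul, h2]
  simp only [mul_smul, Finset.smul_sum]

/-- The divergence of a vector field, in coordinates and in an orthonormal frame. -/
theorem sum_fderiv_sqrt_det_mul (hg : DifferentiableAt ℝ g y)
    (hs : ∀ᶠ y' in 𝓝 y, ∀ v w, g y' v w = g y' w v) {u : E7 ≃L[ℝ] E7}
    (hu : g y = pullInner (u : E7 →L[ℝ] E7)) {Γ : E7 → E7 → E7}
    (hΓ : ∀ v w z, g y (Γ v w) z = koszul g y v w z) {W : E7 → E7}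
    (hW : DifferentiableAt ℝ W y) :
    ∑ a, fderiv ℝ (fun y' => Real.sqrt (gramOf (g y')).det * W y' a) y (stdVec a) =
      Real.sqrt (gramOf (g y)).det *
        ∑ i, g y (fderiv ℝ W y (frame u i) + Γ (frame u i) (W y)) (frame u i) := by
  have h0 : 0 < (gramOf (g y)).det := by
    rw [hu, det_gramOf_pullInner]
    exact sq_pos_of_ne_zero (det_ne_zero_of_equiv u)
  have hWa : ∀ a v, fderiv ℝ (fun y' => W y' a) y v = fderiv ℝ W y v a := by
    intro a v
    have := ((EuclideanSpace.proj (𝕜 := ℝ) a).hasFDerivAt (x := W y)).comp y hW.hasFDerivAt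
    exact DFunLike.congr_fun this.fderiv v
  have h1 := hasFDerivAt_sqrt_det hg h0
  have h2 : ∀ a, fderiv ℝ (fun y' => Real.sqrt (gramOf (g y')).det * W y' a) y (stdVec a) =
      Real.sqrt (gramOf (g y)).det * fderiv ℝ W y (stdVec a) a +
      W y a * fderiv ℝ (fun y' => Real.sqrt (gramOf (g y')).det) y (stdVec a) := by
    intro a
    have hWd : DifferentiableAt ℝ (fun y' => W y' a) y :=
      (EuclideanSpace.proj (𝕜 := ℝ) a).differentiableAt.comp y hW
    rw [fderiv_fun_mul h1.differentiableAt hWd]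
    simp only [add_apply, smul_apply, smul_eq_mul, hWa]
  have h3 : ∑ a, W y a * fderiv ℝ (fun y' => Real.sqrt (gramOf (g y')).det) y (stdVec a) =
      fderiv ℝ (fun y' => Real.sqrt (gramOf (g y')).det) y (W y) := by
    conv_rhs => rw [← sum_smul_stdVec (W y)]
    simp only [map_sum, map_smul, smul_eq_mul]
  -- The trace of the connection is `Γᵃₐ(W) = ½ gᵇᶜ D_W gᵦ꜀`: the other two terms of the Koszul
  -- formula are antisymmetric in `b`, `c` and vanish against the symmetric inverse metric.
  have h4 : ∑ a, Γ (stdVec a) (W y) a = ∑ b, ∑ c, (1 / 2 : ℝ) * (gramOf (g y))⁻¹ c b *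
      fderiv ℝ (fun y' => g y' (stdVec b) (stdVec c)) y (W y) := by
    rw [← sum_inv_mul_left h0.ne' fun a => Γ (stdVec a) (W y)]
    have hP : ∀ b c, (gramOf (g y))⁻¹ c b = (gramOf (g y))⁻¹ b c := by
      intro b c
      have h5 : (gramOf (g y)).transpose = gramOf (g y) := by
        ext i j
        exact hs.self_of_nhds _ _
      conv_rhs => rw [← h5, ← Matrix.transpose_nonsing_inv]
      rfl
    have h6 : ∀ F : Fin 7 → Fin 7 → ℝ, (∀ b c, F c b = -F b c) → ∑ b, ∑ c, F b c = 0 := by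
      intro F hF
      have h7 : ∑ b, ∑ c, F b c = ∑ b, ∑ c, -F b c := by
        rw [Finset.sum_comm]
        exact Finset.sum_congr rfl fun c _ => Finset.sum_congr rfl fun b _ => hF c b
      simp only [Finset.sum_neg_distrib] at h7
      linarith
    rw [← sub_eq_zero, ← Finset.sum_sub_distrib]
    simp only [← Finset.sum_sub_distrib]
    refine h6 _ fun b c => ?_
    rw [hΓ, hΓ, koszul, koszul, fderiv_apply_apply hg, fderiv_apply_apply hg, hP b c,
      fderiv_symm hg hs (stdVec c) (W y) (stdVec b), fderiv_symm hg hs (stdVec b) (W y) (stdVec c),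
      fderiv_symm hg hs (W y) (stdVec c) (stdVec b)]
    ring
  -- Both sides are the trace of the endomorphism `∇W`, in the orthonormal frame and in the standard
  -- basis.
  have h8 : ∑ i, g y (fderiv ℝ W y (frame u i) + Γ (frame u i) (W y)) (frame u i) =
      ∑ a, (fderiv ℝ W y (stdVec a) + Γ (stdVec a) (W y)) a := by
    rw [← sum_inv_mul_left h0.ne' fun a => fderiv ℝ W y (stdVec a) + Γ (stdVec a) (W y),
      Finset.sum_comm, hu, ← sum_frame_eq u fun v w => pullInner (u : E7 →L[ℝ] E7)
        (fderiv ℝ W y w + Γ w (W y)) v]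
    · intro v v' w
      rw [map_add]
    · intro c v w
      rw [map_smul, smul_eq_mul]
    all_goals
      rw [← hu]
      intros
      simp only [map_add, map_smul, add_apply, smul_apply,
        hΓ, koszul, smul_eq_mul]
      ring
  rw [Finset.sum_congr rfl fun a _ => h2 a, Finset.sum_add_distrib, h3, h1.fderiv, h8]
  simp only [PiLp.add_apply, Finset.sum_add_distrib]
  rw [h4, smul_apply, sum_apply, mul_add,
    Finset.mul_sum]
  congr 2

end LocalGeometry

/-! ### Change of coordinates -/

section ChangeOfCoordinates

open Filter Topology

variable {ψ : E7 → E7} {y : E7}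

theorem fderiv_pull_linear {A : E7 → E7 →L[ℝ] ℝ} (hA : DifferentiableAt ℝ A (ψ y))
    (hψ : DifferentiableAt ℝ ψ y) (hψ' : DifferentiableAt ℝ (fderiv ℝ ψ) y) (v w : E7) :
    fderiv ℝ (fun y' => A (ψ y') (fderiv ℝ ψ y' w)) y v =
      fderiv ℝ A (ψ y) (fderiv ℝ ψ y v) (fderiv ℝ ψ y w) +
        A (ψ y) (fderiv ℝ (fderiv ℝ ψ) y v w) := by
  have h1 : HasFDerivAt (fun y' => A (ψ y')) _ y := hA.hasFDerivAt.comp y hψ.hasFDerivAt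
  have h2 := hψ'.hasFDerivAt.clm_apply (hasFDerivAt_const w y)
  rw [(h1.clm_apply h2).fderiv]
  simp [add_comm]

theorem fderiv_pull_bilinear {C : E7 → E7 →L[ℝ] E7 →L[ℝ] ℝ} (hC : DifferentiableAt ℝ C (ψ y))
    (hψ : DifferentiableAt ℝ ψ y) (hψ' : DifferentiableAt ℝ (fderiv ℝ ψ) y) (v w z : E7) :
    fderiv ℝ (fun y' => C (ψ y') (fderiv ℝ ψ y' w) (fderiv ℝ ψ y' z)) y v =
      fderiv ℝ C (ψ y) (fderiv ℝ ψ y v) (fderiv ℝ ψ y w) (fderiv ℝ ψ y z) +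
        C (ψ y) (fderiv ℝ (fderiv ℝ ψ) y v w) (fderiv ℝ ψ y z) +
        C (ψ y) (fderiv ℝ ψ y w) (fderiv ℝ (fderiv ℝ ψ) y v z) := by
  have h1 : HasFDerivAt (fun y' => C (ψ y')) ((fderiv ℝ C (ψ y)).comp (fderiv ℝ ψ y)) y :=
    HasFDerivAt.comp (g := C) y hC.hasFDerivAt hψ.hasFDerivAt
  have h2 := hψ'.hasFDerivAt.clm_apply (hasFDerivAt_const w y)
  have h3 := hψ'.hasFDerivAt.clm_apply (hasFDerivAt_const z y)
  rw [((h1.clm_apply h2).clm_apply h3).fderiv]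
  simp
  ring

end ChangeOfCoordinates

/-! ### Bilinear fields and `1`-forms in a chart -/

section Fields

open Filter Topology

variable {M : Type*} [TopologicalSpace M] [ChartedSpace E7 M]

/-- A `1`-form in the chart at `p`. -/
def Form.chartLinear (α : Form M 1) (p : M) (y : E7) : E7 →L[ℝ] ℝ :=
  (ContinuousAlternatingMap.ofSubsingleton ℝ E7 ℝ (0 : Fin 1)).symm (Form.inChart α p y)

theorem Form.chartLinear_apply (α : Form M 1) (p : M) (y v : E7) :
    α.chartLinear p y v = Form.inChart α p y ![v] := by
  have h : (![v] : Fin 1 → E7) = fun _ => v := funext fun i => by fin_cases i; rfl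
  rw [h]
  rfl

theorem Form.IsSmooth.contDiffOn_chartLinear {α : Form M 1} (hα : α.IsSmooth) (p : M) :
    ContDiffOn ℝ ∞ (α.chartLinear p) (extChartAt (𝓡 7) p).target := by
  rw [contDiffOn_clm_apply]
  intro v
  simp only [Form.chartLinear_apply]
  exact (ContinuousAlternatingMap.apply ℝ E7 ℝ ![v]).contDiff.comp_contDiffOn (hα p)

/-- A field of bilinear forms in the chart at `p`. -/
def bilinChart (B : M → E7 →L[ℝ] E7 →L[ℝ] ℝ) (p : M) (y : E7) : E7 →L[ℝ] E7 →L[ℝ] ℝ :=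
  (B ((extChartAt (𝓡 7) p).symm y)).bilinearComp (chartInvDeriv p y) (chartInvDeriv p y)

/-- A field of bilinear forms, as a tensor field. -/
def bilinTensor (B : M → E7 →L[ℝ] E7 →L[ℝ] ℝ) : TensorField M 2 := fun x v => B x (v 0) (v 1)

theorem bilinTensor_inChart (B : M → E7 →L[ℝ] E7 →L[ℝ] ℝ) (p : M) (y : E7) (w : Fin 2 → E7) :
    TensorField.inChart (bilinTensor B) p y w = bilinChart B p y (w 0) (w 1) := rfl

variable [IsManifold (𝓡 7) ∞ M]

theorem bilinChart_trans (B : M → E7 →L[ℝ] E7 →L[ℝ] ℝ) {p q : M} {y : E7}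
    (hy : y ∈ (extChartAt (𝓡 7) p).target)
    (hq : (extChartAt (𝓡 7) p).symm y ∈ (extChartAt (𝓡 7) q).source) (v w : E7) :
    bilinChart B p y v w = bilinChart B q (chartTrans p q y)
      (fderiv ℝ (chartTrans p q) y v) (fderiv ℝ (chartTrans p q) y w) :=
  TensorField.inChart_trans (bilinTensor B) hy hq ![v, w]

theorem bilinChart_center (B : M → E7 →L[ℝ] E7 →L[ℝ] ℝ) (x : M) (v w : E7) :
    bilinChart B x (extChartAt (𝓡 7) x x) v w = B x v w :=
  TensorField.inChart_center (bilinTensor B) x ![v, w]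

theorem Form.chartLinear_trans (α : Form M 1) {p q : M} {y : E7}
    (hy : y ∈ (extChartAt (𝓡 7) p).target)
    (hq : (extChartAt (𝓡 7) p).symm y ∈ (extChartAt (𝓡 7) q).source) (v : E7) :
    α.chartLinear p y v = α.chartLinear q (chartTrans p q y) (fderiv ℝ (chartTrans p q) y v) := by
  rw [Form.chartLinear_apply, Form.chartLinear_apply, Form.inChart_apply, Form.inChart_apply,
    TensorField.inChart_trans _ hy hq]
  exact congrArg _ (funext fun i => by fin_cases i; rfl)

theorem Form.chartLinear_center (α : Form M 1) (x : M) (v : E7) :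
    α.chartLinear x (extChartAt (𝓡 7) x x) v = α x ![v] := by
  rw [Form.chartLinear_apply, Form.inChart_center]
  rfl

theorem differentiableAt_of_target {F : Type*} [NormedAddCommGroup F] [NormedSpace ℝ F] {p : M}
    {f : E7 → F} (hf : ContDiffOn ℝ ∞ f (extChartAt (𝓡 7) p).target) {y : E7}
    (hy : y ∈ (extChartAt (𝓡 7) p).target) : DifferentiableAt ℝ f y :=
  (hf.contDiffAt ((isOpen_extChartAt_target p).mem_nhds hy)).differentiableAt (by simp)

theorem differentiableAt_fderiv_chartTrans {p q : M} {y : E7}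
    (hy : y ∈ (extChartAt (𝓡 7) p).target)
    (hq : (extChartAt (𝓡 7) p).symm y ∈ (extChartAt (𝓡 7) q).source) :
    DifferentiableAt ℝ (fderiv ℝ (chartTrans p q)) y :=
  ((contDiffAt_chartTrans hy hq).fderiv_right (m := 1) (by norm_cast)).differentiableAt (by simp)

/-- The partial derivatives of a tensor are not tensorial: second derivatives of the transition map
appear. They are cancelled in `covBilin_trans` by the inhomogeneous term of `christoffel_trans`. -/
theorem fderiv_bilinChart_trans {B : M → E7 →L[ℝ] E7 →L[ℝ] ℝ}
    (hB : ∀ p, ContDiffOn ℝ ∞ (bilinChart B p) (extChartAt (𝓡 7) p).target) {p q : M} {y : E7}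
    (hy : y ∈ (extChartAt (𝓡 7) p).target)
    (hq : (extChartAt (𝓡 7) p).symm y ∈ (extChartAt (𝓡 7) q).source) (v w z : E7) :
    fderiv ℝ (bilinChart B p) y v w z =
      fderiv ℝ (bilinChart B q) (chartTrans p q y) (fderiv ℝ (chartTrans p q) y v)
        (fderiv ℝ (chartTrans p q) y w) (fderiv ℝ (chartTrans p q) y z) +
      bilinChart B q (chartTrans p q y) (fderiv ℝ (fderiv ℝ (chartTrans p q)) y v w)
        (fderiv ℝ (chartTrans p q) y z) +
      bilinChart B q (chartTrans p q y) (fderiv ℝ (chartTrans p q) y w)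
        (fderiv ℝ (fderiv ℝ (chartTrans p q)) y v z) := by
  rw [← fderiv_pull_bilinear (differentiableAt_of_target (hB q) (chartTrans_mem hq))
    (differentiableAt_chartTrans hy hq) (differentiableAt_fderiv_chartTrans hy hq),
    ← fderiv_apply_apply (differentiableAt_of_target (hB p) hy)]
  refine DFunLike.congr_fun (Filter.EventuallyEq.fderiv_eq ?_) v
  filter_upwards [eventually_symm_mem_source hy hq] with y' hy'
  exact bilinChart_trans B hy'.1 hy'.2 w z

theorem fderiv_chartLinear_trans {α : Form M 1} (hα : α.IsSmooth) {p q : M} {y : E7}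
    (hy : y ∈ (extChartAt (𝓡 7) p).target)
    (hq : (extChartAt (𝓡 7) p).symm y ∈ (extChartAt (𝓡 7) q).source) (v w : E7) :
    fderiv ℝ (α.chartLinear p) y v w =
      fderiv ℝ (α.chartLinear q) (chartTrans p q y) (fderiv ℝ (chartTrans p q) y v)
        (fderiv ℝ (chartTrans p q) y w) +
      α.chartLinear q (chartTrans p q y) (fderiv ℝ (fderiv ℝ (chartTrans p q)) y v w) := by
  rw [← fderiv_pull_linear (differentiableAt_of_target (hα.contDiffOn_chartLinear q)
    (chartTrans_mem hq)) (differentiableAt_chartTrans hy hq)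
    (differentiableAt_fderiv_chartTrans hy hq)]
  have h := (differentiableAt_of_target (hα.contDiffOn_chartLinear p) hy).hasFDerivAt.clm_apply
    (hasFDerivAt_const w y)
  have h2 : fderiv ℝ (α.chartLinear p) y v w =
      fderiv ℝ (fun y' => α.chartLinear p y' w) y v := by
    rw [h.fderiv]
    simp
  rw [h2]
  refine DFunLike.congr_fun (Filter.EventuallyEq.fderiv_eq ?_) v
  filter_upwards [eventually_symm_mem_source hy hq] with y' hy'
  exact α.chartLinear_trans hy'.1 hy'.2 w

/-! ### The Levi-Civita connection in charts -/

namespace G2Structure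

variable (S : G2Structure M)

/-- The metric, as a field of bilinear forms. -/
def metricBilin (x : M) : E7 →L[ℝ] E7 →L[ℝ] ℝ := pullInner (S.coframe x).toContinuousLinearMap

theorem bilinChart_metricBilin : bilinChart S.metricBilin = S.chartMetric := rfl

theorem differentiableAt_chartMetric {p : M} {y : E7} (hy : y ∈ (extChartAt (𝓡 7) p).target) :
    DifferentiableAt ℝ (S.chartMetric p) y :=
  differentiableAt_of_target (S.contDiffOn_chartMetric p) hy

theorem chartMetric_ext {p : M} {y : E7} (hy : y ∈ (extChartAt (𝓡 7) p).target) {v w : E7}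
    (h : ∀ z, S.chartMetric p y v z = S.chartMetric p y w z) : v = w := by
  rw [chartMetric, ← S.coe_chartCoframeEquiv hy] at h
  have h2 := fun z => h ((S.chartCoframeEquiv hy).symm z)
  simp only [pullInner_apply, ContinuousLinearEquiv.coe_coe,
    ContinuousLinearEquiv.apply_symm_apply] at h2
  exact (S.chartCoframeEquiv hy).injective (ext_inner_right ℝ h2)

theorem chartMetric_christoffel {p : M} {y : E7} (hy : y ∈ (extChartAt (𝓡 7) p).target)
    (v w z : E7) :
    S.chartMetric p y (S.christoffel p y v w) z = koszul (S.chartMetric p) y v w z := by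
  have hg := S.differentiableAt_chartMetric hy
  have hK : ∀ l, (1 / 2 : ℝ) * (S.metricDeriv p y v w (stdVec l) + S.metricDeriv p y w v (stdVec l)
      - S.metricDeriv p y (stdVec l) v w) = koszul (S.chartMetric p) y v w (stdVec l) := by
    intro l
    simp only [metricDeriv, metric_inChart, fderiv_apply_apply hg, koszul]
  have hz : ∀ z, koszul (S.chartMetric p) y v w z =
      ∑ m, z m * koszul (S.chartMetric p) y v w (stdVec m) := by
    intro z
    conv_lhs => rw [← sum_smul_stdVec z]
    simp only [koszul, map_sum, map_smul, sum_apply, smul_apply, smul_eq_mul,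
      ← Finset.sum_add_distrib, ← Finset.sum_sub_distrib, Finset.mul_sum]
    exact Finset.sum_congr rfl fun m _ => by ring
  have hdet := (S.det_gram_pos hy).ne'
  have hm : ∀ m, S.chartMetric p y (S.christoffel p y v w) (stdVec m) =
      koszul (S.chartMetric p) y v w (stdVec m) := by
    intro m
    simp only [christoffel, hK, map_sum, map_smul, sum_apply, smul_apply, smul_eq_mul,
      Finset.sum_mul]
    rw [Finset.sum_comm]
    have h1 : ∀ l, ∑ k, (S.gram p y)⁻¹ k l * koszul (S.chartMetric p) y v w (stdVec l) *
        S.chartMetric p y (stdVec k) (stdVec m) =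
        (S.gram p y * (S.gram p y)⁻¹) m l * koszul (S.chartMetric p) y v w (stdVec l) := by
      intro l
      rw [Matrix.mul_apply, Finset.sum_mul]
      refine Finset.sum_congr rfl fun k _ => ?_
      rw [S.chartMetric_symm, ← S.metric_inChart]
      simp only [gram, Matrix.of_apply]
      ring
    simp only [h1, Matrix.mul_nonsing_inv _ (isUnit_iff_ne_zero.2 hdet), Matrix.one_apply]
    simp
  rw [hz z]
  conv_lhs => rw [← sum_smul_stdVec z]
  simp only [map_sum, map_smul, smul_eq_mul, hm]

theorem chartMetric_eventually_symm (p : M) (y : E7) :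
    ∀ᶠ y' in 𝓝 y, ∀ v w, S.chartMetric p y' v w = S.chartMetric p y' w v :=
  Filter.Eventually.of_forall fun _ => S.chartMetric_symm p _

theorem christoffel_symm {p : M} {y : E7} (hy : y ∈ (extChartAt (𝓡 7) p).target) (v w : E7) :
    S.christoffel p y v w = S.christoffel p y w v := by
  refine S.chartMetric_ext hy fun z => ?_
  rw [S.chartMetric_christoffel hy, S.chartMetric_christoffel hy,
    koszul_symm (S.differentiableAt_chartMetric hy) (S.chartMetric_eventually_symm p y)]

theorem fderiv_chartMetric {p : M} {y : E7} (hy : y ∈ (extChartAt (𝓡 7) p).target) (v w z : E7) :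
    fderiv ℝ (S.chartMetric p) y v w z = S.chartMetric p y (S.christoffel p y v w) z +
      S.chartMetric p y w (S.christoffel p y v z) := by
  rw [S.chartMetric_symm p y w, S.chartMetric_christoffel hy, S.chartMetric_christoffel hy,
    koszul_add_koszul (S.differentiableAt_chartMetric hy) (S.chartMetric_eventually_symm p y)]

/-- The transformation law of the Christoffel symbols. -/
theorem christoffel_trans {p q : M} {y : E7} (hy : y ∈ (extChartAt (𝓡 7) p).target)
    (hq : (extChartAt (𝓡 7) p).symm y ∈ (extChartAt (𝓡 7) q).source) (v w : E7) :
    fderiv ℝ (chartTrans p q) y (S.christoffel p y v w) =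
      S.christoffel q (chartTrans p q y) (fderiv ℝ (chartTrans p q) y v)
        (fderiv ℝ (chartTrans p q) y w) + fderiv ℝ (fderiv ℝ (chartTrans p q)) y v w := by
  obtain ⟨L, hL⟩ : ∃ L : E7 ≃L[ℝ] E7, ∀ v, fderiv ℝ (chartTrans p q) y v = L v :=
    ⟨transEquiv hy hq, fun v => (transEquiv_apply hy hq v).symm⟩
  have hsymm2 : ∀ v w, fderiv ℝ (fderiv ℝ (chartTrans p q)) y v w =
      fderiv ℝ (fderiv ℝ (chartTrans p q)) y w v := fun v w =>
    ((contDiffAt_chartTrans hy hq).isSymmSndFDerivAt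
      (by simpa using WithTop.coe_le_coe.2 (le_top : (2 : ℕ∞) ≤ ⊤))).eq v w
  have hq' := chartTrans_mem hq
  have hcomp := bilinChart_trans S.metricBilin hy hq
  have hder := fderiv_bilinChart_trans (B := S.metricBilin)
    (by rw [bilinChart_metricBilin]; exact S.contDiffOn_chartMetric) hy hq
  rw [bilinChart_metricBilin] at hcomp hder
  simp only [hL] at hcomp hder ⊢
  generalize fderiv ℝ (fderiv ℝ (chartTrans p q)) y = D2 at *
  -- The connection of the chart at `q`, carried back by the transition map with its second
  -- derivative added, is compatible with the metric in the chart at `p`. It is also symmetric,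
  -- second derivatives being symmetric, so `eq_koszul` identifies it.
  have hcompat : ∀ v w z, fderiv ℝ (S.chartMetric p) y v w z =
      S.chartMetric p y (L.symm (S.christoffel q (chartTrans p q y) (L v) (L w) + D2 v w)) z +
      S.chartMetric p y w (L.symm (S.christoffel q (chartTrans p q y) (L v) (L z) + D2 v z)) := by
    intro v w z
    rw [hder, hcomp, hcomp, L.apply_symm_apply, L.apply_symm_apply,
      S.fderiv_chartMetric hq' (L v) (L w) (L z)]
    simp only [map_add, add_apply]
    ring
  have hΓ := eq_koszul (S.chartMetric_eventually_symm p y)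
    (fun v w => by rw [S.christoffel_symm hq', hsymm2]) hcompat
  have hfin : S.christoffel p y v w =
      L.symm (S.christoffel q (chartTrans p q y) (L v) (L w) + D2 v w) :=
    S.chartMetric_ext hy fun z => by rw [S.chartMetric_christoffel hy, ← hΓ]
  rw [hfin, L.apply_symm_apply]

/-- The covariant derivative of a bilinear field, in the chart at `p`. -/
def covBilin (B : M → E7 →L[ℝ] E7 →L[ℝ] ℝ) (p : M) (y v w z : E7) : ℝ :=
  fderiv ℝ (bilinChart B p) y v w z - bilinChart B p y (S.christoffel p y v w) z
    - bilinChart B p y w (S.christoffel p y v z)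

/-- The covariant derivative of a `1`-form, in the chart at `p`. -/
def covLinear (α : Form M 1) (p : M) (y v w : E7) : ℝ :=
  fderiv ℝ (α.chartLinear p) y v w - α.chartLinear p y (S.christoffel p y v w)

theorem covBilin_trans {B : M → E7 →L[ℝ] E7 →L[ℝ] ℝ}
    (hB : ∀ p, ContDiffOn ℝ ∞ (bilinChart B p) (extChartAt (𝓡 7) p).target) {p q : M} {y : E7}
    (hy : y ∈ (extChartAt (𝓡 7) p).target)
    (hq : (extChartAt (𝓡 7) p).symm y ∈ (extChartAt (𝓡 7) q).source) (v w z : E7) :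
    S.covBilin B p y v w z = S.covBilin B q (chartTrans p q y) (fderiv ℝ (chartTrans p q) y v)
      (fderiv ℝ (chartTrans p q) y w) (fderiv ℝ (chartTrans p q) y z) := by
  rw [covBilin, covBilin, fderiv_bilinChart_trans hB hy hq, bilinChart_trans B hy hq,
    bilinChart_trans B hy hq w, S.christoffel_trans hy hq, S.christoffel_trans hy hq]
  simp only [map_add, add_apply]
  ring

theorem covLinear_trans {α : Form M 1} (hα : α.IsSmooth) {p q : M} {y : E7}
    (hy : y ∈ (extChartAt (𝓡 7) p).target)
    (hq : (extChartAt (𝓡 7) p).symm y ∈ (extChartAt (𝓡 7) q).source) (v w : E7) :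
    S.covLinear α p y v w = S.covLinear α q (chartTrans p q y) (fderiv ℝ (chartTrans p q) y v)
      (fderiv ℝ (chartTrans p q) y w) := by
  rw [covLinear, covLinear, fderiv_chartLinear_trans hα hy hq, α.chartLinear_trans hy hq,
    S.christoffel_trans hy hq]
  simp only [map_add]
  ring

theorem covDeriv_eq {k : ℕ} (T : TensorField M k) (x : M) (v : E7) (w : Fin k → E7) :
    S.covDeriv T x v w =
      fderiv ℝ (fun y' => TensorField.inChart T x y' w) (extChartAt (𝓡 7) x x) v -
        ∑ i, TensorField.inChart T x (extChartAt (𝓡 7) x x)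
          (Function.update w i (S.christoffel x (extChartAt (𝓡 7) x x) v (w i))) := by
  have h : ∀ (v' : E7) (w' : Fin k → E7), v' = v → w' = w →
      fderiv ℝ (fun y' => TensorField.inChart T x y' w') (extChartAt (𝓡 7) x x) v' -
        ∑ i, TensorField.inChart T x (extChartAt (𝓡 7) x x)
          (Function.update w' i (S.christoffel x (extChartAt (𝓡 7) x x) v' (w' i))) =
      fderiv ℝ (fun y' => TensorField.inChart T x y' w) (extChartAt (𝓡 7) x x) v -
        ∑ i, TensorField.inChart T x (extChartAt (𝓡 7) x x)
          (Function.update w i (S.christoffel x (extChartAt (𝓡 7) x x) v (w i))) := by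
    rintro _ _ rfl rfl
    rfl
  exact h (chartDeriv x v) (fun i => chartDeriv x (w i)) (chartDeriv_eq x v)
    (funext fun i => chartDeriv_eq x (w i))

theorem covDeriv_bilinTensor {B : M → E7 →L[ℝ] E7 →L[ℝ] ℝ}
    (hB : ∀ p, ContDiffOn ℝ ∞ (bilinChart B p) (extChartAt (𝓡 7) p).target) (x : M)
    (v w z : E7) :
    S.covDeriv (bilinTensor B) x v (![w, z] : Fin 2 → E7) =
      S.covBilin B x (extChartAt (𝓡 7) x x) v w z := by
  rw [covDeriv_eq, Fin.sum_univ_two, covBilin,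
    ← fderiv_apply_apply (differentiableAt_of_target (hB x) (mem_extChartAt_target x)) v w z]
  simp only [bilinTensor_inChart]
  exact (sub_sub _ _ _).symm

end G2Structure

end Fields

/-! ### Linearity of a `3`-form in its arguments -/

section ThreeForm

variable {V : Type*} [AddCommGroup V] [Module ℝ V] [TopologicalSpace V] (η : V [⋀^Fin 3]→L[ℝ] ℝ)

theorem update_three_zero (a b c x : V) : Function.update ![a, b, c] 0 x = ![x, b, c] := by
  funext i
  fin_cases i <;> rfl

theorem update_three_one (a b c x : V) : Function.update ![a, b, c] 1 x = ![a, x, c] := by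
  funext i
  fin_cases i <;> rfl

theorem update_three_two (a b c x : V) : Function.update ![a, b, c] 2 x = ![a, b, x] := by
  funext i
  fin_cases i <;> rfl

theorem form_three_add_zero (a a' b c : V) : η ![a + a', b, c] = η ![a, b, c] + η ![a', b, c] := by
  have h := η.map_update_add ![a, b, c] 0 a a'
  rwa [update_three_zero, update_three_zero, update_three_zero] at h

theorem form_three_smul_zero (r : ℝ) (a b c : V) : η ![r • a, b, c] = r * η ![a, b, c] := by
  have h := η.map_update_smul ![a, b, c] 0 r a
  rwa [update_three_zero, update_three_zero] at h

theorem form_three_add_one (a b b' c : V) : η ![a, b + b', c] = η ![a, b, c] + η ![a, b', c] := by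
  have h := η.map_update_add ![a, b, c] 1 b b'
  rwa [update_three_one, update_three_one, update_three_one] at h

theorem form_three_smul_one (r : ℝ) (a b c : V) : η ![a, r • b, c] = r * η ![a, b, c] := by
  have h := η.map_update_smul ![a, b, c] 1 r b
  rwa [update_three_one, update_three_one] at h

theorem form_three_add_two (a b c c' : V) : η ![a, b, c + c'] = η ![a, b, c] + η ![a, b, c'] := by
  have h := η.map_update_add ![a, b, c] 2 c c'
  rwa [update_three_two, update_three_two, update_three_two] at h

theorem form_three_smul_two (r : ℝ) (a b c : V) : η ![a, b, r • c] = r * η ![a, b, c] := by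
  have h := η.map_update_smul ![a, b, c] 2 r c
  rwa [update_three_two, update_three_two] at h

theorem form_three_swap (a b c : V) : η ![a, c, b] = -η ![a, b, c] := by
  have h := η.map_swap ![a, b, c] (i := 1) (j := 2) (by decide)
  have h2 : (![a, b, c] ∘ ⇑(Equiv.swap (1 : Fin 3) 2)) = ![a, c, b] := by
    funext i
    fin_cases i <;> rfl
  rwa [h2] at h

/-- A `3`-form as a function of its first argument. -/
def formFirst (b c : V) : V →L[ℝ] ℝ where
  toFun v := η ![v, b, c]
  map_add' v w := form_three_add_zero η v w b c
  map_smul' r v := form_three_smul_zero η r v b c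
  cont := η.cont.comp (continuous_pi fun i => by
    fin_cases i
    · exact continuous_id
    · exact continuous_const
    · exact continuous_const)

end ThreeForm

/-! ### Contraction of two `3`-forms and the smoothness of `j_σ(γ)` -/

theorem sum_frame_form_mul (u : E7 ≃L[ℝ] E7) (σ γ : E7 [⋀^Fin 3]→L[ℝ] ℝ) (v w : E7) :
    ∑ a, ∑ b, σ ![w, frame u a, frame u b] * γ ![v, frame u a, frame u b] =
      ∑ a, ∑ a', (gramOf (pullInner (u : E7 →L[ℝ] E7)))⁻¹ a a' *
        ∑ b, ∑ b', (gramOf (pullInner (u : E7 →L[ℝ] E7)))⁻¹ b b' *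
          (σ ![w, stdVec a, stdVec b] * γ ![v, stdVec a', stdVec b']) := by
  rw [sum_frame_eq u fun s t => ∑ b, σ ![w, s, frame u b] * γ ![v, t, frame u b]]
  · refine Finset.sum_congr rfl fun a _ => Finset.sum_congr rfl fun a' _ => congrArg _ ?_
    rw [sum_frame_eq u fun s t => σ ![w, stdVec a, s] * γ ![v, stdVec a', t]]
    all_goals
      intros
      simp only [form_three_add_two, form_three_smul_two]
      ring
  all_goals
    intros
    simp only [form_three_add_one, form_three_smul_one, Finset.mul_sum,
      ← Finset.sum_add_distrib]
    refine Finset.sum_congr rfl fun b _ => ?_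
    ring

/-- Here `σ` is a variable with an equation, so that the formula applies to `S.form x` without
rewriting it inside dependent types. -/
theorem hodge_interior_interior_of_eq {V : Type*} [AddCommGroup V] [Module ℝ V]
    [TopologicalSpace V] [IsTopologicalAddGroup V] [ContinuousSMul ℝ V] (h : 2 + 2 + 3 + 0 = 7)
    (u : V ≃L[ℝ] E7) (v w : V) {σ : V [⋀^Fin 3]→L[ℝ] ℝ} (hσ : σ = pullPhi u)
    (γ : V [⋀^Fin 3]→L[ℝ] ℝ) (hγ : wedge γ σ = 0) :
    hodge (k := 2 + 2 + 3) (l := 0) h u (wedge (wedge (interior v σ) (interior w σ)) γ) ![] =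
      ∑ a, ∑ b, σ ![w, frame u a, frame u b] * γ ![v, frame u a, frame u b] := by
  subst hσ
  have h2 : ∀ β : V [⋀^Fin (2 + 2 + 3)]→L[ℝ] ℝ, hodge (k := 2 + 2 + 3) (l := 0) h u β =
    hodge (k := 2 + 2 + 3) (l := 0) rfl u β := fun _ => rfl
  rw [h2]
  exact hodge_interior_interior u v w γ hγ

/-- The contraction of two `3`-forms over two arguments. -/
def contractForms (σ γ : E7 [⋀^Fin 3]→L[ℝ] ℝ) (f : Fin 7 → E7) : E7 →L[ℝ] E7 →L[ℝ] ℝ :=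
  ∑ a, ∑ b, (formFirst γ (f a) (f b)).smulRight (formFirst σ (f a) (f b))

theorem contractForms_apply (σ γ : E7 [⋀^Fin 3]→L[ℝ] ℝ) (f : Fin 7 → E7) (v w : E7) :
    contractForms σ γ f v w = ∑ a, ∑ b, σ ![w, f a, f b] * γ ![v, f a, f b] := by
  rw [contractForms, sum_apply, sum_apply]
  refine Finset.sum_congr rfl fun a _ => ?_
  rw [sum_apply, sum_apply]
  exact Finset.sum_congr rfl fun b _ => mul_comm _ _

section Divergence

open Filter Topology

variable {M : Type*} [TopologicalSpace M] [ChartedSpace E7 M]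

namespace G2Structure

variable (S : G2Structure M)

/-- The bilinear form `j_σ(γ)`, in an orthonormal frame. -/
def jBilin (γ : Form M 3) (x : M) : E7 →L[ℝ] E7 →L[ℝ] ℝ :=
  contractForms (S.form x) (γ x) (frame (S.coframe x))

theorem jBilin_apply (γ : Form M 3) (x : M) (v w : E7) :
    S.jBilin γ x v w = ∑ a, ∑ b, S.form x ![w, frame (S.coframe x) a, frame (S.coframe x) b] *
      γ x ![v, frame (S.coframe x) a, frame (S.coframe x) b] :=
  contractForms_apply _ _ _ _ _

theorem j_eq {γ : Form M 3} (hγ : ∀ x, wedge (γ x) (S.form x) = 0) :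
    S.j γ = bilinTensor (S.jBilin γ) := by
  funext x v
  rw [j, star, hodge_interior_interior_of_eq _ _ _ _ (S.form_eq x) _ (hγ x)]
  exact (S.jBilin_apply γ x (v 0) (v 1)).symm

variable [IsManifold (𝓡 7) ∞ M]

theorem chartInvDeriv_frame {p : M} {y : E7} (hy : y ∈ (extChartAt (𝓡 7) p).target) (i : Fin 7) :
    chartInvDeriv p y (frame (S.chartCoframeEquiv hy) i) =
      frame (S.coframe ((extChartAt (𝓡 7) p).symm y)) i := by
  rw [← chartInvEquiv_apply hy]
  exact (chartInvEquiv hy).apply_symm_apply _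

theorem form_three_inChart (η : Form M 3) (p : M) (y a b c : E7) :
    Form.inChart η p y ![a, b, c] = η ((extChartAt (𝓡 7) p).symm y)
      ![chartInvDeriv p y a, chartInvDeriv p y b, chartInvDeriv p y c] :=
  congrArg (η _) (funext fun i => by fin_cases i <;> rfl)

theorem chartMetric_eq {p : M} {y : E7} (hy : y ∈ (extChartAt (𝓡 7) p).target) :
    S.chartMetric p y = pullInner (S.chartCoframeEquiv hy : E7 →L[ℝ] E7) := by
  rw [chartMetric, coe_chartCoframeEquiv]

/-- The frame in `jBilin` comes from a coframe with no continuity. Two traces against the inverse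
Gram matrix replace it by smooth functions of the point. -/
theorem jBilin_inChart (γ : Form M 3) {p : M} {y : E7} (hy : y ∈ (extChartAt (𝓡 7) p).target)
    (v w : E7) :
    bilinChart (S.jBilin γ) p y v w = ∑ a, ∑ a', (S.gram p y)⁻¹ a a' *
        ∑ b, ∑ b', (S.gram p y)⁻¹ b b' *
          (Form.inChart S.form p y ![w, stdVec a, stdVec b] *
            Form.inChart γ p y ![v, stdVec a', stdVec b']) := by
  have h : ∀ (η : Form M 3) (v : E7) (a b : Fin 7), Form.inChart η p y
      ![v, frame (S.chartCoframeEquiv hy) a, frame (S.chartCoframeEquiv hy) b] =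
      η ((extChartAt (𝓡 7) p).symm y) ![chartInvDeriv p y v,
        frame (S.coframe ((extChartAt (𝓡 7) p).symm y)) a,
        frame (S.coframe ((extChartAt (𝓡 7) p).symm y)) b] := by
    intro η v a b
    rw [form_three_inChart η, S.chartInvDeriv_frame hy, S.chartInvDeriv_frame hy]
  have h2 := S.jBilin_apply γ ((extChartAt (𝓡 7) p).symm y) (chartInvDeriv p y v)
    (chartInvDeriv p y w)
  have h3 := sum_frame_form_mul (S.chartCoframeEquiv hy) (Form.inChart S.form p y)
    (Form.inChart γ p y) v w
  simp only [h] at h3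
  rw [gram_eq, S.chartMetric_eq hy, ← h3]
  exact h2

theorem contDiffOn_jBilin {γ : Form M 3} (hγ : γ.IsSmooth) (p : M) :
    ContDiffOn ℝ ∞ (bilinChart (S.jBilin γ) p) (extChartAt (𝓡 7) p).target := by
  rw [contDiffOn_clm_apply]
  intro v
  rw [contDiffOn_clm_apply]
  intro w
  refine ContDiffOn.congr ?_ fun y hy => S.jBilin_inChart γ hy v w
  refine ContDiffOn.sum fun a _ => ContDiffOn.sum fun a' _ =>
    (S.contDiffOn_gram_inv p a a').mul ?_
  refine ContDiffOn.sum fun b _ => ContDiffOn.sum fun b' _ =>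
    (S.contDiffOn_gram_inv p b b').mul ?_
  exact (contDiffOn_form_apply S.smooth p _).mul (contDiffOn_form_apply hγ p _)

/-! ### Linearity of the covariant derivative -/

/-- Linearity is read off the Koszul expression by nondegeneracy of the metric. -/
theorem christoffel_add {p : M} {y : E7} (hy : y ∈ (extChartAt (𝓡 7) p).target) (v w w' : E7) :
    S.christoffel p y v (w + w') = S.christoffel p y v w + S.christoffel p y v w' := by
  refine S.chartMetric_ext hy fun z => ?_
  simp only [map_add, add_apply, S.chartMetric_christoffel hy, koszul]
  ring

theorem christoffel_smul {p : M} {y : E7} (hy : y ∈ (extChartAt (𝓡 7) p).target) (c : ℝ)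
    (v w : E7) : S.christoffel p y v (c • w) = c • S.christoffel p y v w := by
  refine S.chartMetric_ext hy fun z => ?_
  simp only [map_smul, smul_apply, smul_eq_mul, S.chartMetric_christoffel hy, koszul]
  ring

theorem christoffel_add_left {p : M} {y : E7} (hy : y ∈ (extChartAt (𝓡 7) p).target)
    (v v' w : E7) :
    S.christoffel p y (v + v') w = S.christoffel p y v w + S.christoffel p y v' w := by
  rw [S.christoffel_symm hy, S.christoffel_add hy, S.christoffel_symm hy w,
    S.christoffel_symm hy w]

theorem christoffel_smul_left {p : M} {y : E7} (hy : y ∈ (extChartAt (𝓡 7) p).target) (c : ℝ)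
    (v w : E7) : S.christoffel p y (c • v) w = c • S.christoffel p y v w := by
  rw [S.christoffel_symm hy, S.christoffel_smul hy, S.christoffel_symm hy w]

theorem contDiffOn_christoffel (p : M) (v w : E7) :
    ContDiffOn ℝ ∞ (fun y => S.christoffel p y v w) (extChartAt (𝓡 7) p).target := by
  have hK : ∀ v w z, ContDiffOn ℝ ∞ (fun y => S.metricDeriv p y v w z)
      (extChartAt (𝓡 7) p).target := by
    intro v w z
    have h := (S.contDiffOn_chartMetric p).fderiv_of_isOpen (m := ∞)
      (isOpen_extChartAt_target p) (by simp)
    refine ContDiffOn.congr (((h.clm_apply (contDiffOn_const (c := v))).clm_apply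
      (contDiffOn_const (c := w))).clm_apply (contDiffOn_const (c := z))) fun y hy => ?_
    exact fderiv_apply_apply (S.differentiableAt_chartMetric hy) v w z
  unfold christoffel
  refine ContDiffOn.sum fun k _ => ContDiffOn.fun_smul (ContDiffOn.sum fun l _ => ?_) contDiffOn_const
  exact (S.contDiffOn_gram_inv p k l).mul
    (contDiffOn_const.mul (((hK _ _ _).add (hK _ _ _)).sub (hK _ _ _)))

section CovBilin

variable {B : M → E7 →L[ℝ] E7 →L[ℝ] ℝ} {p : M} {y : E7}

theorem covBilin_add_one (hy : y ∈ (extChartAt (𝓡 7) p).target) (v v' w z : E7) :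
    S.covBilin B p y (v + v') w z = S.covBilin B p y v w z + S.covBilin B p y v' w z := by
  simp only [covBilin, S.christoffel_add_left hy, map_add, add_apply]
  ring

theorem covBilin_smul_one (hy : y ∈ (extChartAt (𝓡 7) p).target) (c : ℝ) (v w z : E7) :
    S.covBilin B p y (c • v) w z = c * S.covBilin B p y v w z := by
  simp only [covBilin, S.christoffel_smul_left hy, map_smul, smul_apply, smul_eq_mul]
  ring

theorem covBilin_add_two (hy : y ∈ (extChartAt (𝓡 7) p).target) (v w w' z : E7) :
    S.covBilin B p y v (w + w') z = S.covBilin B p y v w z + S.covBilin B p y v w' z := by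
  simp only [covBilin, S.christoffel_add hy, map_add, add_apply]
  ring

theorem covBilin_smul_two (hy : y ∈ (extChartAt (𝓡 7) p).target) (c : ℝ) (v w z : E7) :
    S.covBilin B p y v (c • w) z = c * S.covBilin B p y v w z := by
  simp only [covBilin, S.christoffel_smul hy, map_smul, smul_apply, smul_eq_mul]
  ring

theorem covBilin_add_three (hy : y ∈ (extChartAt (𝓡 7) p).target) (v w z z' : E7) :
    S.covBilin B p y v w (z + z') = S.covBilin B p y v w z + S.covBilin B p y v w z' := by
  simp only [covBilin, S.christoffel_add hy, map_add]
  ring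

theorem covBilin_smul_three (hy : y ∈ (extChartAt (𝓡 7) p).target) (c : ℝ) (v w z : E7) :
    S.covBilin B p y v w (c • z) = c * S.covBilin B p y v w z := by
  simp only [covBilin, S.christoffel_smul hy, map_smul, smul_eq_mul]
  ring

end CovBilin

end G2Structure

end Divergence

/-! ### Raising indices, the divergence identity and the candidate adjoint -/

theorem sum_inner_smul_frame (u : E7 ≃L[ℝ] E7) (v : E7) :
    ∑ j, pullInner (u : E7 →L[ℝ] E7) v (frame u j) • frame u j = v := by
  apply u.injective
  rw [map_sum]
  conv_rhs => rw [← sum_smul_stdVec (u v)]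
  refine Finset.sum_congr rfl fun j _ => ?_
  rw [map_smul, coframe_frame, pullInner_apply, ContinuousLinearEquiv.coe_coe, coframe_frame]
  congr 1
  simp [stdVec, EuclideanSpace.inner_single_right]

theorem contDiffOn_flip {s : Set E7} {f : E7 → E7 →L[ℝ] E7 →L[ℝ] ℝ} (hf : ContDiffOn ℝ ∞ f s) :
    ContDiffOn ℝ ∞ (fun y => (f y).flip) s := by
  rw [contDiffOn_clm_apply]
  intro v
  rw [contDiffOn_clm_apply]
  intro w
  exact (hf.clm_apply contDiffOn_const).clm_apply contDiffOn_const

section Adjoint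

open Filter Topology

variable {M : Type*} [TopologicalSpace M] [ChartedSpace E7 M]

namespace G2Structure

variable (S : G2Structure M)

/-- The vector dual to a covector, in the chart at `p`. -/
def raise (p : M) (y : E7) (a : E7 →L[ℝ] ℝ) : E7 :=
  ∑ b, (∑ c, (S.gram p y)⁻¹ b c * a (stdVec c)) • stdVec b

variable [IsManifold (𝓡 7) ∞ M]

theorem chartMetric_raise {p : M} {y : E7} (hy : y ∈ (extChartAt (𝓡 7) p).target)
    (a : E7 →L[ℝ] ℝ) (z : E7) : S.chartMetric p y (S.raise p y a) z = a z := by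
  have hdet := (S.det_gram_pos hy).ne'
  have hm : ∀ m, S.chartMetric p y (S.raise p y a) (stdVec m) = a (stdVec m) := by
    intro m
    simp only [raise, map_sum, map_smul, sum_apply, smul_apply, smul_eq_mul, Finset.sum_mul]
    rw [Finset.sum_comm]
    have h1 : ∀ c, ∑ b, (S.gram p y)⁻¹ b c * a (stdVec c) *
        S.chartMetric p y (stdVec b) (stdVec m) =
        (S.gram p y * (S.gram p y)⁻¹) m c * a (stdVec c) := by
      intro c
      rw [Matrix.mul_apply, Finset.sum_mul]
      refine Finset.sum_congr rfl fun b _ => ?_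
      rw [S.chartMetric_symm, gram_eq, gramOf, Matrix.of_apply]
      ring
    simp only [h1, Matrix.mul_nonsing_inv _ (isUnit_iff_ne_zero.2 hdet), Matrix.one_apply]
    simp
  conv_lhs => rw [← sum_smul_stdVec z]
  conv_rhs => rw [← sum_smul_stdVec z]
  simp only [map_sum, map_smul, smul_eq_mul, hm]

theorem contDiffOn_raise {p : M} {a : E7 → E7 →L[ℝ] ℝ}
    (ha : ContDiffOn ℝ ∞ a (extChartAt (𝓡 7) p).target) :
    ContDiffOn ℝ ∞ (fun y => S.raise p y (a y)) (extChartAt (𝓡 7) p).target := by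
  unfold raise
  exact ContDiffOn.sum fun b _ => ContDiffOn.fun_smul (ContDiffOn.sum fun c _ =>
    (S.contDiffOn_gram_inv p b c).mul (ha.clm_apply contDiffOn_const)) contDiffOn_const

/-- The covariant derivative of a vector field, with lowered index. -/
theorem chartMetric_cov {p : M} {y : E7} (hy : y ∈ (extChartAt (𝓡 7) p).target)
    {a : E7 → E7 →L[ℝ] ℝ} (ha : ContDiffOn ℝ ∞ a (extChartAt (𝓡 7) p).target) (v z : E7) :
    S.chartMetric p y (fderiv ℝ (fun y => S.raise p y (a y)) y v +
      S.christoffel p y v (S.raise p y (a y))) z =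
      fderiv ℝ a y v z - a y (S.christoffel p y v z) := by
  have hA := (differentiableAt_of_target (S.contDiffOn_raise ha) hy).hasFDerivAt
  have hg := (S.differentiableAt_chartMetric hy).hasFDerivAt
  have h1 := ((hg.clm_apply hA).clm_apply (hasFDerivAt_const z y)).fderiv
  have h2 := ((differentiableAt_of_target ha hy).hasFDerivAt.clm_apply
    (hasFDerivAt_const z y)).fderiv
  -- Differentiate `g(a_#, z) = a(z)`, which holds near `y`, and use that the connection is metric.
  have h3 : (fun y' => S.chartMetric p y' (S.raise p y' (a y')) z) =ᶠ[𝓝 y] fun y' => a y' z := by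
    filter_upwards [(isOpen_extChartAt_target p).mem_nhds hy] with y' hy'
    exact S.chartMetric_raise hy' _ _
  have h4 := DFunLike.congr_fun ((h1.symm.trans h3.fderiv_eq).trans h2) v
  simp only [add_apply, ContinuousLinearMap.comp_apply, ContinuousLinearMap.flip_apply,
    zero_apply, map_zero, zero_add] at h4
  rw [S.fderiv_chartMetric hy] at h4
  rw [map_add, add_apply, ← h4, ← S.chartMetric_raise hy (a y) (S.christoffel p y v z)]
  ring

/-- The integrand whose integral vanishes by the divergence theorem, in a frame. -/
def divSum (B : M → E7 →L[ℝ] E7 →L[ℝ] ℝ) (α : Form M 1) (p : M) (y : E7) (f : Fin 7 → E7) : ℝ :=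
  ∑ i, ∑ j, (bilinChart B p y (f i) (f j) * S.covLinear α p y (f i) (f j) +
    S.covBilin B p y (f i) (f i) (f j) * α.chartLinear p y (f j))

/-- The vector field `W` with `g(W, z) = B(z, α_#)`. -/
def fluxField (B : M → E7 →L[ℝ] E7 →L[ℝ] ℝ) (α : Form M 1) (p : M) (y : E7) : E7 :=
  S.raise p y ((bilinChart B p y).flip (S.raise p y (α.chartLinear p y)))

theorem contDiffOn_fluxField {B : M → E7 →L[ℝ] E7 →L[ℝ] ℝ} {α : Form M 1} {p : M}
    (hB : ContDiffOn ℝ ∞ (bilinChart B p) (extChartAt (𝓡 7) p).target) (hα : α.IsSmooth) :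
    ContDiffOn ℝ ∞ (S.fluxField B α p) (extChartAt (𝓡 7) p).target := by
  refine S.contDiffOn_raise ?_
  exact (contDiffOn_flip hB).clm_apply (S.contDiffOn_raise (hα.contDiffOn_chartLinear p))

theorem raise_eq_sum {p : M} {y : E7} (hy : y ∈ (extChartAt (𝓡 7) p).target) (a : E7 →L[ℝ] ℝ) :
    S.raise p y a = ∑ j, a (frame (S.chartCoframeEquiv hy) j) • frame (S.chartCoframeEquiv hy) j := by
  rw [← sum_inner_smul_frame (S.chartCoframeEquiv hy) (S.raise p y a), ← S.chartMetric_eq hy]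
  simp only [S.chartMetric_raise hy]

/-- The Leibniz rule for `div(B(·, α_#))`: the flux field with lowered index is `z ↦ B(z, α_#)`, and
its covariant derivative splits into `(∇B)(·, α_#)` and `B(·, ∇α_#)`. -/
theorem sum_frame_fluxField {B : M → E7 →L[ℝ] E7 →L[ℝ] ℝ} {α : Form M 1} {p : M}
    (hB : ContDiffOn ℝ ∞ (bilinChart B p) (extChartAt (𝓡 7) p).target) (hα : α.IsSmooth)
    {y : E7} (hy : y ∈ (extChartAt (𝓡 7) p).target) :
    ∑ a, fderiv ℝ (fun y' => Real.sqrt (S.gram p y').det * S.fluxField B α p y' a) y (stdVec a) =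
      Real.sqrt (S.gram p y).det * S.divSum B α p y (frame (S.chartCoframeEquiv hy)) := by
  have hα' := hα.contDiffOn_chartLinear p
  have hA := S.contDiffOn_raise hα'
  have hb : ContDiffOn ℝ ∞ (fun y => (bilinChart B p y).flip (S.raise p y (α.chartLinear p y)))
      (extChartAt (𝓡 7) p).target := (contDiffOn_flip hB).clm_apply hA
  have h := sum_fderiv_sqrt_det_mul (S.differentiableAt_chartMetric hy)
    (S.chartMetric_eventually_symm p y) (S.chartMetric_eq hy) (S.chartMetric_christoffel hy)
    (differentiableAt_of_target (S.contDiffOn_fluxField hB hα) hy)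
  simp only [← gram_eq] at h
  rw [h, divSum]
  refine congrArg _ (Finset.sum_congr rfl fun i _ => ?_)
  generalize hf : frame (S.chartCoframeEquiv hy) i = f
  refine (S.chartMetric_cov hy hb f f).trans ?_
  have h1 : fderiv ℝ (fun y => (bilinChart B p y).flip (S.raise p y (α.chartLinear p y))) y f f =
      fderiv ℝ (bilinChart B p) y f f (S.raise p y (α.chartLinear p y)) +
        bilinChart B p y f (fderiv ℝ (fun y => S.raise p y (α.chartLinear p y)) y f) := by
    have h2 := ((differentiableAt_of_target hb hy).hasFDerivAt.clm_apply
      (hasFDerivAt_const f y)).fderiv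
    have h3 := (((differentiableAt_of_target hB hy).hasFDerivAt.clm_apply
      (hasFDerivAt_const f y)).clm_apply (differentiableAt_of_target hA hy).hasFDerivAt).fderiv
    have h4 := DFunLike.congr_fun (h2.symm.trans h3) f
    simp only [add_apply, ContinuousLinearMap.comp_apply, ContinuousLinearMap.flip_apply,
      zero_apply, map_zero, zero_add] at h4
    rw [h4]
    ring
  -- Adding and removing a Christoffel term turns the partial derivative into `∇α_#`; the removed
  -- term is the one that `∇B` requires in its last argument.
  have h5 : bilinChart B p y f (fderiv ℝ (fun y => S.raise p y (α.chartLinear p y)) y f) =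
      bilinChart B p y f (fderiv ℝ (fun y => S.raise p y (α.chartLinear p y)) y f +
        S.christoffel p y f (S.raise p y (α.chartLinear p y))) -
      bilinChart B p y f (S.christoffel p y f (S.raise p y (α.chartLinear p y))) := by
    rw [map_add]
    ring
  have h6 : ∀ V, bilinChart B p y f V = ∑ j, bilinChart B p y f (frame (S.chartCoframeEquiv hy) j) *
      S.chartMetric p y V (frame (S.chartCoframeEquiv hy) j) := by
    intro V
    conv_lhs => rw [← sum_inner_smul_frame (S.chartCoframeEquiv hy) V, ← S.chartMetric_eq hy]
    simp only [map_sum, map_smul, smul_eq_mul, mul_comm]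
  have h7 : S.covBilin B p y f f (S.raise p y (α.chartLinear p y)) =
      ∑ j, S.covBilin B p y f f (frame (S.chartCoframeEquiv hy) j) *
        α.chartLinear p y (frame (S.chartCoframeEquiv hy) j) := by
    let T : E7 →ₗ[ℝ] ℝ :=
      { toFun := fun z => S.covBilin B p y f f z
        map_add' := S.covBilin_add_three hy f f
        map_smul' := fun c z => S.covBilin_smul_three hy c f f z }
    have h8 : ∀ z, S.covBilin B p y f f z = T z := fun _ => rfl
    simp only [h8]
    rw [S.raise_eq_sum hy]
    simp only [map_sum, map_smul, smul_eq_mul, mul_comm]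
  rw [Finset.sum_add_distrib, ← h7, h1, h5, h6 (_ + _)]
  simp only [S.chartMetric_cov hy hα', ContinuousLinearMap.flip_apply, covBilin, covLinear]
  ring

theorem divSum_trans {B : M → E7 →L[ℝ] E7 →L[ℝ] ℝ}
    (hB : ∀ p, ContDiffOn ℝ ∞ (bilinChart B p) (extChartAt (𝓡 7) p).target) {α : Form M 1}
    (hα : α.IsSmooth) {p q : M} {y : E7} (hy : y ∈ (extChartAt (𝓡 7) p).target)
    (hq : (extChartAt (𝓡 7) p).symm y ∈ (extChartAt (𝓡 7) q).source) (f : Fin 7 → E7) :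
    S.divSum B α p y f = S.divSum B α q (chartTrans p q y)
      fun i => fderiv ℝ (chartTrans p q) y (f i) := by
  refine Finset.sum_congr rfl fun i _ => Finset.sum_congr rfl fun j _ => ?_
  rw [bilinChart_trans B hy hq, S.covLinear_trans hα hy hq, S.covBilin_trans hB hy hq,
    α.chartLinear_trans hy hq]

theorem fderiv_chartTrans_frame {p : M} {y : E7} (hy : y ∈ (extChartAt (𝓡 7) p).target)
    (i : Fin 7) :
    fderiv ℝ (chartTrans p ((extChartAt (𝓡 7) p).symm y)) y (frame (S.chartCoframeEquiv hy) i) =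
      frame (S.coframe ((extChartAt (𝓡 7) p).symm y)) i :=
  (chartInvDeriv_eq hy _).symm.trans (S.chartInvDeriv_frame hy i)

/-- The sum does not depend on the chart, so the quantity defined at each point in that point's own
chart can be computed in one fixed chart. -/
theorem divSum_frame {B : M → E7 →L[ℝ] E7 →L[ℝ] ℝ}
    (hB : ∀ p, ContDiffOn ℝ ∞ (bilinChart B p) (extChartAt (𝓡 7) p).target) {α : Form M 1}
    (hα : α.IsSmooth) {p : M} {y : E7} (hy : y ∈ (extChartAt (𝓡 7) p).target) :
    S.divSum B α p y (frame (S.chartCoframeEquiv hy)) =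
      S.divSum B α ((extChartAt (𝓡 7) p).symm y)
        (extChartAt (𝓡 7) ((extChartAt (𝓡 7) p).symm y) ((extChartAt (𝓡 7) p).symm y))
        (frame (S.coframe ((extChartAt (𝓡 7) p).symm y))) := by
  rw [S.divSum_trans hB hα hy (mem_extChartAt_source _)]
  exact congrArg _ (funext fun i => S.fderiv_chartTrans_frame hy i)

/-- The covector `v ↦ -½ ∑ᵢ (∇_{fᵢ} B)(fᵢ, v)`. -/
def adjointCovector (B : M → E7 →L[ℝ] E7 →L[ℝ] ℝ) (x : M) : E7 →L[ℝ] ℝ :=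
  ∑ a, ((-(1 / 2) : ℝ) * ∑ i, S.covBilin B x (extChartAt (𝓡 7) x x) (frame (S.coframe x) i)
    (frame (S.coframe x) i) (stdVec a)) • EuclideanSpace.proj (𝕜 := ℝ) a

theorem adjointCovector_apply (B : M → E7 →L[ℝ] E7 →L[ℝ] ℝ) (x : M) (v : E7) :
    S.adjointCovector B x v = (-(1 / 2) : ℝ) * ∑ i, S.covBilin B x (extChartAt (𝓡 7) x x)
      (frame (S.coframe x) i) (frame (S.coframe x) i) v := by
  have hx := mem_extChartAt_target (I := 𝓡 7) x
  have h : ∀ f : E7, S.covBilin B x (extChartAt (𝓡 7) x x) f f v =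
      ∑ a, v a * S.covBilin B x (extChartAt (𝓡 7) x x) f f (stdVec a) := by
    intro f
    let T : E7 →ₗ[ℝ] ℝ :=
      { toFun := fun z => S.covBilin B x (extChartAt (𝓡 7) x x) f f z
        map_add' := S.covBilin_add_three hx f f
        map_smul' := fun c z => S.covBilin_smul_three hx c f f z }
    have h8 : ∀ z, S.covBilin B x (extChartAt (𝓡 7) x x) f f z = T z := fun _ => rfl
    simp only [h8]
    conv_lhs => rw [← sum_smul_stdVec v]
    simp only [map_sum, map_smul, smul_eq_mul]
  rw [Finset.sum_congr rfl fun i _ => h (frame (S.coframe x) i), adjointCovector, sum_apply,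
    Finset.sum_comm, Finset.mul_sum]
  refine Finset.sum_congr rfl fun a _ => ?_
  rw [← Finset.mul_sum, smul_apply, smul_eq_mul]
  change _ * v a = _
  ring

/-- The `1`-form `-½ (div B)`. -/
def adjointForm (B : M → E7 →L[ℝ] E7 →L[ℝ] ℝ) : Form M 1 := fun x =>
  ContinuousAlternatingMap.ofSubsingleton ℝ E7 ℝ (0 : Fin 1) (S.adjointCovector B x)

/-- This is the step behind smoothness: in a fixed chart the pointwise frames give way to the
inverse Gram matrix, and the varying charts to the chart at `p`. -/
theorem adjointForm_chartLinear {B : M → E7 →L[ℝ] E7 →L[ℝ] ℝ}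
    (hB : ∀ p, ContDiffOn ℝ ∞ (bilinChart B p) (extChartAt (𝓡 7) p).target) {p : M} {y : E7}
    (hy : y ∈ (extChartAt (𝓡 7) p).target) (v : E7) :
    (S.adjointForm B).chartLinear p y v = (-(1 / 2) : ℝ) * ∑ b, ∑ c, (S.gram p y)⁻¹ b c *
      S.covBilin B p y (stdVec b) (stdVec c) v := by
  rw [gram_eq, S.chartMetric_eq hy, ← sum_frame_eq (S.chartCoframeEquiv hy)
    fun s t => S.covBilin B p y s t v]
  · refine (S.adjointCovector_apply B _ (chartInvDeriv p y v)).trans (congrArg _ ?_)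
    refine Finset.sum_congr rfl fun i _ => ?_
    rw [S.covBilin_trans hB hy (mem_extChartAt_source _), S.fderiv_chartTrans_frame hy,
      chartInvDeriv_eq hy]
    rfl
  all_goals
    intros
    simp only [S.covBilin_add_one hy, S.covBilin_add_two hy, S.covBilin_smul_one hy,
      S.covBilin_smul_two hy]

theorem contDiffOn_covBilin {B : M → E7 →L[ℝ] E7 →L[ℝ] ℝ} {p : M}
    (hB : ContDiffOn ℝ ∞ (bilinChart B p) (extChartAt (𝓡 7) p).target) (v w z : E7) :
    ContDiffOn ℝ ∞ (fun y => S.covBilin B p y v w z) (extChartAt (𝓡 7) p).target := by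
  have h := hB.fderiv_of_isOpen (m := ∞) (isOpen_extChartAt_target p) (by simp)
  unfold covBilin
  exact ((((h.clm_apply contDiffOn_const).clm_apply contDiffOn_const).clm_apply
    contDiffOn_const).sub ((hB.clm_apply (S.contDiffOn_christoffel p v w)).clm_apply
      contDiffOn_const)).sub ((hB.clm_apply contDiffOn_const).clm_apply
        (S.contDiffOn_christoffel p v z))

theorem isSmooth_adjointForm {B : M → E7 →L[ℝ] E7 →L[ℝ] ℝ}
    (hB : ∀ p, ContDiffOn ℝ ∞ (bilinChart B p) (extChartAt (𝓡 7) p).target) :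
    (S.adjointForm B).IsSmooth := by
  intro p
  have h : ContDiffOn ℝ ∞ ((S.adjointForm B).chartLinear p) (extChartAt (𝓡 7) p).target := by
    rw [contDiffOn_clm_apply]
    intro v
    refine ContDiffOn.congr ?_ fun y hy => S.adjointForm_chartLinear hB hy v
    exact contDiffOn_const.mul (ContDiffOn.sum fun b _ => ContDiffOn.sum fun c _ =>
      (S.contDiffOn_gram_inv p b c).mul (S.contDiffOn_covBilin (hB p) _ _ _))
  let L : (E7 →L[ℝ] ℝ) →ₗ[ℝ] (E7 [⋀^Fin 1]→L[ℝ] ℝ) :=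
    { toFun := fun a => ContinuousAlternatingMap.ofSubsingleton ℝ E7 ℝ (0 : Fin 1) a
      map_add' := fun _ _ => rfl
      map_smul' := fun _ _ => rfl }
  refine ContDiffOn.congr (L.toContinuousLinearMap.contDiff.comp_contDiffOn h) fun y _ => ?_
  exact ((ContinuousAlternatingMap.ofSubsingleton ℝ E7 ℝ (0 : Fin 1)).apply_symm_apply _).symm

end G2Structure

end Adjoint

/-! ### The pointwise formula for `⟨γ, d⁷₂₇ α⟩` -/

theorem hodge_wedge_hodge_of_eq {V : Type*} [AddCommGroup V] [Module ℝ V] [TopologicalSpace V]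
    [IsTopologicalAddGroup V] [ContinuousSMul ℝ V] (h : 1 + 4 + 2 = 7) (h' : 3 + 4 = 7)
    (u : V ≃L[ℝ] E7) {σ : V [⋀^Fin 3]→L[ℝ] ℝ} (hσ : σ = pullPhi u) (α : V [⋀^Fin 1]→L[ℝ] ℝ) :
    hodge (k := 1 + 4) (l := 2) h u (wedge α (hodge (k := 3) (l := 4) h' u σ)) =
      interior (∑ i, α ![frame u i] • frame u i) σ := by
  subst hσ
  exact hodge_wedge_hodge u α

theorem hasFDerivAt_clm_apply_apply {F G : Type*} [NormedAddCommGroup F] [NormedSpace ℝ F]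
    [NormedAddCommGroup G] [NormedSpace ℝ G] (L : F →L[ℝ] E7 →L[ℝ] G) {f : E7 → F} {A : E7 → E7}
    {f' : E7 →L[ℝ] F} {A' : E7 →L[ℝ] E7} {y : E7} (hf : HasFDerivAt f f' y)
    (hA : HasFDerivAt A A' y) :
    HasFDerivAt (fun y => L (f y) (A y)) ((L (f y)).comp A' + (L.comp f').flip (A y)) y :=
  (L.hasFDerivAt.comp y hf).clm_apply hA

section Pointwise

open Filter Topology

variable {M : Type*} [TopologicalSpace M] [ChartedSpace E7 M]

namespace G2Structure

variable (S : G2Structure M)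

/-- The `2`-form `*(α ∧ *σ)`. -/
def starWedge (α : Form M 1) : Form M 2 := fun x => interior (S.sharp x (α x)) (S.form x)

theorem d7_27_eq (α : Form M 1) (x : M) :
    S.d7_27 α x = proj27 (S.coframe x) (Form.d (S.starWedge α) x) := by
  have h : (fun x' => S.star (k := 1 + 4) (l := 2) rfl x' (wedge (α x') (S.starForm x'))) =
      S.starWedge α := by
    funext x'
    rw [star, starForm, star, hodge_wedge_hodge_of_eq _ _ _ (S.form_eq x')]
    rfl
  rw [d7_27, h]

theorem innerAt_one (x : M) (β α : TangentSpace (𝓡 7) x [⋀^Fin 1]→L[ℝ] ℝ) :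
    S.innerAt x β α = ∑ j, β ![frame (S.coframe x) j] * α ![frame (S.coframe x) j] := by
  rw [innerAt, formInner_apply]
  have : ∀ F : (Fin 1 → Fin 7) → ℝ, ∑ i, F i = ∑ j, F ![j] := fun F => sum_fin_one F
  rw [this]
  simp only [Nat.factorial, Nat.cast_one, inv_one, one_mul, mul_one]
  refine Finset.sum_congr rfl fun j _ => ?_
  exact congrArg₂ (· * ·) (congrArg β (funext fun i => by fin_cases i; rfl))
    (congrArg α (funext fun i => by fin_cases i; rfl))

variable [IsManifold (𝓡 7) ∞ M]

theorem form_one_inChart (α : Form M 1) (p : M) (y v : E7) :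
    Form.inChart α p y ![v] = α ((extChartAt (𝓡 7) p).symm y) ![chartInvDeriv p y v] :=
  congrArg (α _) (funext fun i => by fin_cases i; rfl)

theorem sharp_eq {p : M} {y : E7} (hy : y ∈ (extChartAt (𝓡 7) p).target) (α : Form M 1) :
    chartInvDeriv p y (S.raise p y (α.chartLinear p y)) =
      S.sharp ((extChartAt (𝓡 7) p).symm y) (α ((extChartAt (𝓡 7) p).symm y)) := by
  rw [S.raise_eq_sum hy, map_sum, sharp]
  refine Finset.sum_congr rfl fun i _ => ?_
  rw [map_smul, Form.chartLinear_apply, form_one_inChart, S.chartInvDeriv_frame hy]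

theorem starWedge_inChart {p : M} {y : E7} (hy : y ∈ (extChartAt (𝓡 7) p).target) (α : Form M 1) :
    Form.inChart (S.starWedge α) p y =
      (Form.inChart S.form p y).curryLeft (S.raise p y (α.chartLinear p y)) := by
  ext v
  rw [ContinuousAlternatingMap.curryLeft_apply_apply]
  have h : Form.inChart (S.starWedge α) p y v = S.form ((extChartAt (𝓡 7) p).symm y)
      (Matrix.vecCons (S.sharp ((extChartAt (𝓡 7) p).symm y) (α ((extChartAt (𝓡 7) p).symm y)))
        fun i => chartInvDeriv p y (v i)) := rfl
  rw [h, ← S.sharp_eq hy]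
  exact congrArg _ (funext fun i => by refine Fin.cases rfl (fun _ => rfl) i)

theorem hasFDerivAt_starWedge {α : Form M 1} (hα : α.IsSmooth) {p : M} {y : E7}
    (hy : y ∈ (extChartAt (𝓡 7) p).target) :
    DifferentiableAt ℝ (Form.inChart (S.starWedge α) p) y ∧
    ∀ v a b, fderiv ℝ (Form.inChart (S.starWedge α) p) y v ![a, b] =
      Form.inChart S.form p y
        ![fderiv ℝ (fun y => S.raise p y (α.chartLinear p y)) y v, a, b] +
      fderiv ℝ (Form.inChart S.form p) y v ![S.raise p y (α.chartLinear p y), a, b] := by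
  have hA := (differentiableAt_of_target
    (S.contDiffOn_raise (hα.contDiffOn_chartLinear p)) hy).hasFDerivAt
  have hσ := (differentiableAt_of_target (S.smooth p) hy).hasFDerivAt
  have h1 := hasFDerivAt_clm_apply_apply (F := E7 [⋀^Fin 3]→L[ℝ] ℝ) (G := E7 [⋀^Fin 2]→L[ℝ] ℝ)
    ContinuousAlternatingMap.curryLeftLI.toContinuousLinearMap hσ hA
  have h2 : Form.inChart (S.starWedge α) p =ᶠ[𝓝 y] fun y =>
      (Form.inChart S.form p y).curryLeft (S.raise p y (α.chartLinear p y)) := by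
    filter_upwards [(isOpen_extChartAt_target p).mem_nhds hy] with y' hy'
    exact S.starWedge_inChart hy' α
  have h3 := h1.congr_of_eventuallyEq h2
  refine ⟨h3.differentiableAt, fun v a b => ?_⟩
  rw [h3.fderiv]
  rfl

/-- Torsion-freeness in coordinates: the derivative of `σ` consists only of connection terms, one
for each argument. -/
theorem fderiv_form_apply (hS : S.TorsionFree) (x : M) (v a b c : E7) :
    fderiv ℝ (Form.inChart S.form x) (extChartAt (𝓡 7) x x) v ![a, b, c] =
      Form.inChart S.form x (extChartAt (𝓡 7) x x)
        ![S.christoffel x (extChartAt (𝓡 7) x x) v a, b, c] +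
      Form.inChart S.form x (extChartAt (𝓡 7) x x)
        ![a, S.christoffel x (extChartAt (𝓡 7) x x) v b, c] +
      Form.inChart S.form x (extChartAt (𝓡 7) x x)
        ![a, b, S.christoffel x (extChartAt (𝓡 7) x x) v c] := by
  have h := hS x v (![a, b, c] : Fin 3 → E7)
  have h0 := S.covDeriv_eq (Form.toTensor S.form) x v ![a, b, c]
  have h1 : fderiv ℝ (fun y' => Form.inChart S.form x y' ![a, b, c]) (extChartAt (𝓡 7) x x) v =
      fderiv ℝ (Form.inChart S.form x) (extChartAt (𝓡 7) x x) v ![a, b, c] := by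
    have h2 := (ContinuousAlternatingMap.apply ℝ E7 ℝ ![a, b, c]).hasFDerivAt.comp
      (extChartAt (𝓡 7) x x)
      (differentiableAt_of_target (S.smooth x) (mem_extChartAt_target x)).hasFDerivAt
    exact DFunLike.congr_fun h2.fderiv v
  have h3 := sub_eq_zero.1 (h0.symm.trans h)
  rw [Fin.sum_univ_three] at h3
  rw [← h1]
  refine h3.trans ?_
  rw [update_three_zero, update_three_one, update_three_two]
  rfl

/-- The vector field `∇_v α_#` at `x`, in the chart at `x`. -/
def covSharp (α : Form M 1) (x : M) (v : E7) : E7 :=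
  fderiv ℝ (fun y => S.raise x y (α.chartLinear x y)) (extChartAt (𝓡 7) x x) v +
    S.christoffel x (extChartAt (𝓡 7) x x) v
      (S.raise x (extChartAt (𝓡 7) x x) (α.chartLinear x (extChartAt (𝓡 7) x x)))

theorem extDeriv_starWedge (hS : S.TorsionFree) {α : Form M 1} (hα : α.IsSmooth) (x : M)
    (a b c : E7) :
    extDeriv (Form.inChart (S.starWedge α) x) (extChartAt (𝓡 7) x x) ![a, b, c] =
      Form.inChart S.form x (extChartAt (𝓡 7) x x) ![S.covSharp α x a, b, c] -
      Form.inChart S.form x (extChartAt (𝓡 7) x x) ![S.covSharp α x b, a, c] +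
      Form.inChart S.form x (extChartAt (𝓡 7) x x) ![S.covSharp α x c, a, b] := by
  have hx := mem_extChartAt_target (I := 𝓡 7) x
  obtain ⟨hd, hD⟩ := S.hasFDerivAt_starWedge hα hx
  have happ : ∀ v w, fderiv ℝ (fun y => Form.inChart (S.starWedge α) x y w)
      (extChartAt (𝓡 7) x x) v =
      fderiv ℝ (Form.inChart (S.starWedge α) x) (extChartAt (𝓡 7) x x) v w := by
    intro v w
    have h2 := (ContinuousAlternatingMap.apply ℝ E7 ℝ w).hasFDerivAt.comp
      (extChartAt (𝓡 7) x x) hd.hasFDerivAt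
    exact DFunLike.congr_fun h2.fderiv v
  have hr0 : Fin.removeNth (α := fun _ => E7) (0 : Fin 3) ![a, b, c] = ![b, c] := by
    funext i
    fin_cases i <;> rfl
  have hr1 : Fin.removeNth (α := fun _ => E7) (1 : Fin 3) ![a, b, c] = ![a, c] := by
    funext i
    fin_cases i <;> rfl
  have hr2 : Fin.removeNth (α := fun _ => E7) (2 : Fin 3) ![a, b, c] = ![a, b] := by
    funext i
    fin_cases i <;> rfl
  rw [extDeriv_apply hd, Fin.sum_univ_three, hr0, hr1, hr2, happ, happ, happ]
  have e0 : (![a, b, c] : Fin 3 → E7) 0 = a := rfl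
  have e1 : (![a, b, c] : Fin 3 → E7) 1 = b := rfl
  have e2 : (![a, b, c] : Fin 3 → E7) 2 = c := rfl
  rw [e0, e1, e2, hD, hD, hD, S.fderiv_form_apply hS, S.fderiv_form_apply hS,
    S.fderiv_form_apply hS]
  simp only [covSharp, form_three_add_zero]
  -- The connection terms in the first argument of `σ` complete `∇α_#`. The others cancel in pairs
  -- in the alternating sum, since `Γ` is symmetric and `σ` alternating.
  rw [S.christoffel_symm hx b a, S.christoffel_symm hx c a, S.christoffel_symm hx c b]
  generalize Form.inChart S.form x (extChartAt (𝓡 7) x x) = σ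
  rw [form_three_swap σ _ b (S.christoffel x (extChartAt (𝓡 7) x x) a c)]
  norm_num
  ring

theorem innerAt_d7_27 (hS : S.TorsionFree) {γ : Form M 3} (hγ : S.IsOmega27 γ) {α : Form M 1}
    (hα : α.IsSmooth) (x : M) :
    S.innerAt x (γ x) (S.d7_27 α x) = (1 / 2 : ℝ) * ∑ i, S.jBilin γ x (frame (S.coframe x) i)
      (S.covSharp α x (frame (S.coframe x) i)) := by
  have hmem : γ x ∈ Lambda27 (S.coframe x) := by
    have h := hγ.2 x
    rw [starForm, star, S.form_eq] at h
    exact h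
  rw [d7_27_eq, innerAt, formInner_proj27 _ hmem,
    formInner_alternation (S.coframe x) (γ x) (S.form x) _ (S.covSharp α x)]
  · refine congrArg _ (Finset.sum_congr rfl fun i _ => ?_)
    exact (S.jBilin_apply γ x (frame (S.coframe x) i)
      (S.covSharp α x (frame (S.coframe x) i))).symm
  · intro a b c
    have h := S.extDeriv_starWedge hS hα x a b c
    have h1 : ∀ a b c : E7, Form.inChart S.form x (extChartAt (𝓡 7) x x) ![a, b, c] =
        S.form x (![a, b, c] : Fin 3 → E7) := fun a b c => Form.inChart_center S.form x _
    refine Eq.trans ?_ (h.trans (congrArg₂ (· + ·) (congrArg₂ (· - ·) (h1 _ _ _) (h1 _ _ _))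
      (h1 _ _ _)))
    refine congrArg (extDeriv (Form.inChart (S.starWedge α) x) (extChartAt (𝓡 7) x x)) ?_
    funext i
    fin_cases i <;> exact chartDeriv_eq x _

/-- The integrands of the adjointness relation differ by a divergence. -/
theorem innerAt_d7_27_sub (hS : S.TorsionFree) {γ : Form M 3} (hγ : S.IsOmega27 γ) {α : Form M 1}
    (hα : α.IsSmooth) (x : M) :
    S.innerAt x (γ x) (S.d7_27 α x) - S.innerAt x (S.adjointForm (S.jBilin γ) x) (α x) =
      (1 / 2 : ℝ) * S.divSum (S.jBilin γ) α x (extChartAt (𝓡 7) x x) (frame (S.coframe x)) := by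
  have hx := mem_extChartAt_target (I := 𝓡 7) x
  have h1 : ∀ f V : E7, S.jBilin γ x f V = ∑ j, S.jBilin γ x f (frame (S.coframe x) j) *
      S.metricBilin x V (frame (S.coframe x) j) := by
    intro f V
    have h := sum_inner_smul_frame (S.coframe x) V
    conv_lhs => rw [← h]
    simp only [map_sum, map_smul, smul_eq_mul, mul_comm]
    rfl
  have h2 : ∀ v z : E7, S.metricBilin x (S.covSharp α x v) z =
      S.covLinear α x (extChartAt (𝓡 7) x x) v z := by
    intro v z
    rw [← bilinChart_center S.metricBilin, bilinChart_metricBilin, covSharp,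
      S.chartMetric_cov hx (hα.contDiffOn_chartLinear x), covLinear]
  have h3 : S.innerAt x (S.adjointForm (S.jBilin γ) x) (α x) = ∑ j,
      S.adjointCovector (S.jBilin γ) x (frame (S.coframe x) j) * α x ![frame (S.coframe x) j] := by
    rw [innerAt_one]
    rfl
  rw [S.innerAt_d7_27 hS hγ hα, h3, divSum]
  simp only [Finset.sum_add_distrib]
  rw [mul_add, sub_eq_add_neg]
  congr 1
  · refine congrArg _ (Finset.sum_congr rfl fun i _ => ?_)
    rw [h1]
    refine Finset.sum_congr rfl fun j _ => ?_
    rw [h2, bilinChart_center]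
  · rw [Finset.sum_comm, ← Finset.sum_neg_distrib, Finset.mul_sum]
    refine Finset.sum_congr rfl fun j _ => ?_
    rw [← Finset.sum_mul]
    have h4 : ∀ s c t : ℝ, c = -(1 / 2) * s → 1 / 2 * (s * t) = -(c * t) := by
      intro s c t hc
      rw [hc]
      ring
    exact Eq.symm <| (congrArg (fun t => 1 / 2 * (_ * t))
      (α.chartLinear_center x (frame (S.coframe x) j))).trans
      (h4 _ _ _ (S.adjointCovector_apply (S.jBilin γ) x (frame (S.coframe x) j)))

end G2Structure

end Pointwise

/-! ### The Riemannian measure -/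

section Measure

open Filter Topology MeasureTheory

variable {M : Type*} [TopologicalSpace M] [ChartedSpace E7 M]

namespace G2Structure

variable (S : G2Structure M)

/-- The Riemannian volume density in the chart at `p`. -/
def density (p : M) (y : E7) : ℝ := Real.sqrt (S.gram p y).det

/-- `√det(gᵢⱼ)` is the absolute determinant of the coframe in the chart, which is multiplied by that
of the transition map: exactly the Jacobian in the change of variables. -/
theorem density_trans [IsManifold (𝓡 7) ∞ M] {p q : M} {y : E7}
    (hy : y ∈ (extChartAt (𝓡 7) p).target)
    (hq : (extChartAt (𝓡 7) p).symm y ∈ (extChartAt (𝓡 7) q).source) :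
    S.density p y = |(fderiv ℝ (chartTrans p q) y).det| * S.density q (chartTrans p q y) := by
  have h : S.chartMetric p y =
      pullInner ((S.chartCoframe q (chartTrans p q y)).comp (fderiv ℝ (chartTrans p q) y)) := by
    ext v w
    exact bilinChart_trans S.metricBilin hy hq v w
  have h2 : LinearMap.det (((S.chartCoframe q (chartTrans p q y)).comp
      (fderiv ℝ (chartTrans p q) y) : E7 →L[ℝ] E7) : E7 →ₗ[ℝ] E7) =
      LinearMap.det (S.chartCoframe q (chartTrans p q y) : E7 →ₗ[ℝ] E7) *
        (fderiv ℝ (chartTrans p q) y).det := LinearMap.det_comp _ _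
  rw [density, density, gram_eq, h, det_gramOf_pullInner, h2, det_gram, Real.sqrt_sq_eq_abs,
    Real.sqrt_sq_eq_abs, abs_mul, mul_comm]

theorem contDiffOn_density [IsManifold (𝓡 7) ∞ M] (p : M) :
    ContDiffOn ℝ ∞ (S.density p) (extChartAt (𝓡 7) p).target := by
  have h : ContDiffOn ℝ ∞ (fun y => (S.gram p y).det) (extChartAt (𝓡 7) p).target :=
    contDiffOn_det fun _ _ => ((S.contDiffOn_chartMetric p).clm_apply contDiffOn_const).clm_apply
      contDiffOn_const
  exact h.sqrt fun y hy => (S.det_gram_pos hy).ne'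

variable [MeasurableSpace M]

/-- The Riemannian measure in the chart at `p`. -/
def chartMeasure (p : M) : Measure M :=
  Measure.map (extChartAt (𝓡 7) p).symm
    (((volume : Measure E7).restrict (extChartAt (𝓡 7) p).target).withDensity
      (fun y => ENNReal.ofReal (S.density p y)))

variable [BorelSpace M]

theorem measurableSet_target (p : M) : MeasurableSet (extChartAt (𝓡 7) p).target :=
  (isOpen_extChartAt_target p).measurableSet

theorem measurableSet_source (p : M) : MeasurableSet (extChartAt (𝓡 7) p).source :=
  (isOpen_extChartAt_source p).measurableSet

theorem measurableSet_target_inter (p : M) {B : Set M} (hB : MeasurableSet B) :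
    MeasurableSet ((extChartAt (𝓡 7) p).target ∩ (extChartAt (𝓡 7) p).symm ⁻¹' B) := by
  have h := (continuousOn_iff_continuous_domRestrict.1
    (continuousOn_extChartAt_symm (I := 𝓡 7) p)).measurable hB
  have h2 := (measurableSet_target p).subtype_image h
  convert h2 using 1
  ext y
  simp [and_comm]

theorem aemeasurable_symm (p : M) : AEMeasurable (extChartAt (𝓡 7) p).symm
    (((volume : Measure E7).restrict (extChartAt (𝓡 7) p).target).withDensity
      (fun y => ENNReal.ofReal (S.density p y))) :=
  ((continuousOn_extChartAt_symm p).aemeasurable (measurableSet_target p)).mono_ac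
    (withDensity_absolutelyContinuous _ _)

theorem chartMeasure_apply (p : M) {B : Set M} (hB : MeasurableSet B) :
    S.chartMeasure p B =
      ∫⁻ y in (extChartAt (𝓡 7) p).target ∩ (extChartAt (𝓡 7) p).symm ⁻¹' B,
        ENNReal.ofReal (S.density p y) := by
  have hs := measurableSet_target_inter p hB
  rw [chartMeasure, Measure.map_apply_of_aemeasurable (S.aemeasurable_symm p) hB]
  have h0 : (((volume : Measure E7).restrict (extChartAt (𝓡 7) p).target).withDensity
      (fun y => ENNReal.ofReal (S.density p y))) ((extChartAt (𝓡 7) p).target)ᶜ = 0 :=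
    withDensity_absolutelyContinuous _ _ (by
      rw [Measure.restrict_apply (measurableSet_target p).compl, Set.compl_inter_self]
      exact measure_empty)
  rw [← measure_inter_conull h0, Set.inter_comm, withDensity_apply _ hs,
    Measure.restrict_restrict hs, Set.inter_right_comm, Set.inter_self]

variable [IsManifold (𝓡 7) ∞ M]

theorem chartMeasure_eq (p q : M) {B : Set M} (hB : MeasurableSet B)
    (hp : B ⊆ (extChartAt (𝓡 7) p).source) (hq : B ⊆ (extChartAt (𝓡 7) q).source) :
    S.chartMeasure p B = S.chartMeasure q B := by
  rw [S.chartMeasure_apply p hB, S.chartMeasure_apply q hB]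
  have himg : (extChartAt (𝓡 7) q).target ∩ (extChartAt (𝓡 7) q).symm ⁻¹' B =
      chartTrans p q '' ((extChartAt (𝓡 7) p).target ∩ (extChartAt (𝓡 7) p).symm ⁻¹' B) := by
    ext z
    constructor
    · rintro ⟨hz, hzB⟩
      refine ⟨chartTrans q p z, ⟨chartTrans_mem (hp hzB), ?_⟩, ?_⟩
      · rw [Set.mem_preimage, symm_chartTrans (hp hzB)]
        exact hzB
      · rw [chartTrans_chartTrans (hp hzB), chartTrans_self hz]
    · rintro ⟨y, ⟨hy, hyB⟩, rfl⟩
      refine ⟨chartTrans_mem (hq hyB), ?_⟩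
      rw [Set.mem_preimage, symm_chartTrans (hq hyB)]
      exact hyB
  rw [himg, lintegral_image_eq_lintegral_abs_det_fderiv_mul (f' := fun y =>
    fderiv ℝ (chartTrans p q) y) _ (measurableSet_target_inter p hB)]
  · refine setLIntegral_congr_fun (measurableSet_target_inter p hB) fun y hy => ?_
    rw [S.density_trans hy.1 (hq hy.2), ENNReal.ofReal_mul (abs_nonneg _)]
  · intro y hy
    exact (differentiableAt_chartTrans hy.1 (hq hy.2)).hasFDerivAt.hasFDerivWithinAt
  · intro y hy y' hy' h
    have h1 := congrArg (extChartAt (𝓡 7) q).symm h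
    rw [symm_chartTrans (hq hy.2), symm_chartTrans (hq hy'.2)] at h1
    exact (extChartAt (𝓡 7) p).symm.injOn hy.1 hy'.1 h1

theorem chartMeasure_compl (p : M) : S.chartMeasure p ((extChartAt (𝓡 7) p).source)ᶜ = 0 := by
  rw [S.chartMeasure_apply p (measurableSet_source p).compl]
  have h : (extChartAt (𝓡 7) p).target ∩
      (extChartAt (𝓡 7) p).symm ⁻¹' ((extChartAt (𝓡 7) p).source)ᶜ = ∅ := by
    ext y
    simp only [Set.mem_inter_iff, Set.mem_preimage, Set.mem_compl_iff, Set.mem_empty_iff_false,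
      iff_false, not_and, not_not]
    exact fun hy => (extChartAt (𝓡 7) p).map_target hy
  rw [h, Measure.restrict_empty, lintegral_zero_measure]

theorem chartMeasure_inter (p : M) (B : Set M) :
    S.chartMeasure p (B ∩ (extChartAt (𝓡 7) p).source) = S.chartMeasure p B :=
  measure_inter_conull (S.chartMeasure_compl p)

theorem chartMeasure_restrict (p : M) :
    (S.chartMeasure p).restrict (extChartAt (𝓡 7) p).source = S.chartMeasure p := by
  refine Measure.ext fun B hB => ?_
  rw [Measure.restrict_apply hB, chartMeasure_inter]

/-- A bound independent of `q` up to the complement of one chart domain: inside it the measures of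
the two charts agree, outside it the volume dominates. It allows the supremum defining the volume to
be restricted. -/
theorem chartMeasure_le (p q : M) : S.chartMeasure q ≤
    S.chartMeasure p + S.vol.restrict ((extChartAt (𝓡 7) p).source)ᶜ := by
  refine Measure.le_iff.2 fun B hB => ?_
  rw [Measure.add_apply, Measure.restrict_apply hB,
    ← measure_inter_add_sdiff B (measurableSet_source p)]
  refine add_le_add ?_ ?_
  · rw [← chartMeasure_inter, ← S.chartMeasure_eq p q
      ((hB.inter (measurableSet_source p)).inter (measurableSet_source q))
      (Set.inter_subset_left.trans Set.inter_subset_right) Set.inter_subset_right]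
    exact measure_mono (Set.inter_subset_left.trans Set.inter_subset_left)
  · exact Measure.le_iff'.1 (le_iSup S.chartMeasure q) _

/-- On the domain of a chart, the volume measure is the one defined by the chart. -/
theorem vol_restrict (p : M) :
    S.vol.restrict (extChartAt (𝓡 7) p).source = S.chartMeasure p := by
  refine le_antisymm ?_ ?_
  -- After the supremum over `q`, restriction to the chart domain removes the summand carried by the
  -- complement.
  · refine (Measure.restrict_mono_measure (iSup_le fun q => S.chartMeasure_le p q) _).trans ?_
    rw [Measure.restrict_add, Measure.restrict_restrict (measurableSet_source p),
      Set.inter_compl_self, Measure.restrict_empty, add_zero, chartMeasure_restrict]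
  · rw [← chartMeasure_restrict]
    exact Measure.restrict_mono_measure (le_iSup S.chartMeasure p) _

theorem aemeasurable_density (p : M) : AEMeasurable (fun y => ENNReal.ofReal (S.density p y))
    ((volume : Measure E7).restrict (extChartAt (𝓡 7) p).target) :=
  ((S.contDiffOn_density p).continuousOn.aemeasurable (measurableSet_target p)).ennreal_ofReal

theorem continuousOn_source {p : M} {F : M → ℝ}
    (hF : ContinuousOn (fun y => F ((extChartAt (𝓡 7) p).symm y)) (extChartAt (𝓡 7) p).target) :
    ContinuousOn F (extChartAt (𝓡 7) p).source := by
  refine ContinuousOn.congr (hF.comp (continuousOn_extChartAt p)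
    fun x hx => (extChartAt (𝓡 7) p).map_source hx) fun x hx => ?_
  rw [Function.comp_apply, (extChartAt (𝓡 7) p).left_inv hx]

/-- Integration in a chart. -/
theorem integral_vol {p : M} {F : M → ℝ} (h0 : ∀ x ∉ (extChartAt (𝓡 7) p).source, F x = 0)
    (hF : ContinuousOn (fun y => F ((extChartAt (𝓡 7) p).symm y)) (extChartAt (𝓡 7) p).target) :
    ∫ x, F x ∂S.vol =
      ∫ y in (extChartAt (𝓡 7) p).target, S.density p y * F ((extChartAt (𝓡 7) p).symm y) := by
  have hm := (continuousOn_source hF).aestronglyMeasurable (μ := S.vol) (measurableSet_source p)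
  rw [← setIntegral_eq_integral_of_forall_compl_eq_zero h0]
  rw [S.vol_restrict p] at hm ⊢
  rw [chartMeasure] at hm ⊢
  rw [integral_map (S.aemeasurable_symm p) hm,
    integral_withDensity_eq_integral_toReal_smul₀ (S.aemeasurable_density p)
      (Filter.Eventually.of_forall fun _ => ENNReal.ofReal_lt_top)]
  refine integral_congr_ae (Filter.Eventually.of_forall fun y => ?_)
  simp only [smul_eq_mul]
  rw [ENNReal.toReal_ofReal (show 0 ≤ S.density p y from Real.sqrt_nonneg _)]

theorem integrableOn_density_mul {p : M} {F : M → ℝ}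
    (hF : ContinuousOn (fun y => F ((extChartAt (𝓡 7) p).symm y)) (extChartAt (𝓡 7) p).target)
    {K : Set E7} (hK : IsCompact K) (hKt : K ⊆ (extChartAt (𝓡 7) p).target)
    (hK0 : ∀ y ∈ (extChartAt (𝓡 7) p).target, y ∉ K → F ((extChartAt (𝓡 7) p).symm y) = 0) :
    IntegrableOn (fun y => S.density p y * F ((extChartAt (𝓡 7) p).symm y))
      (extChartAt (𝓡 7) p).target := by
  have h1 : IntegrableOn (fun y => S.density p y * F ((extChartAt (𝓡 7) p).symm y)) K :=
    (((S.contDiffOn_density p).continuousOn.mul hF).mono hKt).integrableOn_compact hK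
  refine h1.of_forall_sdiff_eq_zero (measurableSet_target p) fun y hy => ?_
  rw [hK0 y hy.1 hy.2, mul_zero]

theorem integrable_vol {p : M} {F : M → ℝ} (h0 : ∀ x ∉ (extChartAt (𝓡 7) p).source, F x = 0)
    (hF : ContinuousOn (fun y => F ((extChartAt (𝓡 7) p).symm y)) (extChartAt (𝓡 7) p).target)
    {K : Set E7} (hK : IsCompact K) (hKt : K ⊆ (extChartAt (𝓡 7) p).target)
    (hK0 : ∀ y ∈ (extChartAt (𝓡 7) p).target, y ∉ K → F ((extChartAt (𝓡 7) p).symm y) = 0) :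
    Integrable F S.vol := by
  have hm := (continuousOn_source hF).aestronglyMeasurable (μ := S.vol) (measurableSet_source p)
  rw [← integrableOn_iff_integrable_of_support_subset (s := (extChartAt (𝓡 7) p).source)
    fun x hx => by_contra fun hx' => hx (h0 x hx'), IntegrableOn]
  rw [S.vol_restrict p] at hm ⊢
  rw [chartMeasure] at hm ⊢
  rw [integrable_map_measure hm (S.aemeasurable_symm p),
    integrable_withDensity_iff_integrable_smul₀' (S.aemeasurable_density p)
      (Filter.Eventually.of_forall fun _ => ENNReal.ofReal_lt_top)]
  refine (S.integrableOn_density_mul hF hK hKt hK0).congr (Filter.Eventually.of_forall fun y => ?_)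
  simp only [smul_eq_mul, Function.comp_apply]
  rw [ENNReal.toReal_ofReal (show 0 ≤ S.density p y from Real.sqrt_nonneg _)]

end G2Structure

end Measure

/-! ### The divergence theorem -/

theorem integral_fderiv_eq_zero {f : E7 → ℝ} (hf : ContDiff ℝ 1 f) (hc : HasCompactSupport f)
    (v : E7) : ∫ y, fderiv ℝ f y v = 0 := by
  have h1 : Continuous fun y => fderiv ℝ f y v :=
    (hf.continuous_fderiv (by simp)).clm_apply continuous_const
  have h := integral_mul_fderiv_eq_neg_fderiv_mul_of_integrable
    (μ := MeasureTheory.volume) (f := fun _ => (1 : ℝ)) (g := f) (v := v) (by simp)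
    (by simpa using h1.integrable_of_hasCompactSupport (hc.fderiv_apply ℝ v))
    (by simpa using hf.continuous.integrable_of_hasCompactSupport hc)
    (fun _ _ => differentiableAt_const _) (fun y _ => hf.differentiable (by simp) y)
  simpa using h

/-- The integral of a divergence vanishes. -/
theorem setIntegral_sum_fderiv_eq_zero {U K : Set E7} (hU : IsOpen U) (hK : IsCompact K)
    (hKU : K ⊆ U) {X : Fin 7 → E7 → ℝ} (hX : ∀ a, ContDiffOn ℝ ∞ (X a) U)
    (hX0 : ∀ a, ∀ y ∈ U, y ∉ K → X a y = 0) :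
    ∫ y in U, ∑ a, fderiv ℝ (X a) y (stdVec a) = 0 := by
  have hsupp : ∀ a y, y ∉ K → U.indicator (X a) y = 0 := by
    intro a y hy
    by_cases hyU : y ∈ U
    · rw [Set.indicator_of_mem hyU, hX0 a y hyU hy]
    · exact Set.indicator_of_notMem hyU _
  have hloc : ∀ a y, y ∈ U → U.indicator (X a) =ᶠ[nhds y] X a := by
    intro a y hy
    filter_upwards [hU.mem_nhds hy] with y' hy'
    exact Set.indicator_of_mem hy' _
  -- Extension by zero is `C¹`: at a point outside `U`, the open complement of `K` is a
  -- neighbourhood on which the function vanishes.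
  have hsm : ∀ a, ContDiff ℝ 1 (U.indicator (X a)) := by
    intro a
    rw [contDiff_iff_contDiffAt]
    intro y
    by_cases hy : y ∈ U
    · exact (((hX a).contDiffAt (hU.mem_nhds hy)).of_le (by simp)).congr_of_eventuallyEq
        (hloc a y hy)
    · have h : U.indicator (X a) =ᶠ[nhds y] fun _ => 0 := by
        filter_upwards [hK.isClosed.isOpen_compl.mem_nhds fun h => hy (hKU h)] with y' hy'
        exact hsupp a y' hy'
      exact contDiffAt_const.congr_of_eventuallyEq h
  have hcs : ∀ a, HasCompactSupport (U.indicator (X a)) := fun a =>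
    HasCompactSupport.intro hK fun y hy => hsupp a y hy
  have h1 : ∀ a, MeasureTheory.Integrable fun y =>
      fderiv ℝ (U.indicator (X a)) y (stdVec a) := fun a =>
    (((hsm a).continuous_fderiv (by simp)).clm_apply
      continuous_const).integrable_of_hasCompactSupport ((hcs a).fderiv_apply ℝ _)
  have h2 : ∀ y ∈ U, ∑ a, fderiv ℝ (X a) y (stdVec a) =
      ∑ a, fderiv ℝ (U.indicator (X a)) y (stdVec a) := by
    intro y hy
    exact Finset.sum_congr rfl fun a _ => by rw [(hloc a y hy).fderiv_eq]
  rw [MeasureTheory.setIntegral_congr_fun hU.measurableSet h2,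
    MeasureTheory.setIntegral_eq_integral_of_forall_compl_eq_zero,
    MeasureTheory.integral_finsetSum _ fun a _ => h1 a]
  · exact Finset.sum_eq_zero fun a _ => integral_fderiv_eq_zero (hsm a) (hcs a) _
  · intro y hy
    refine Finset.sum_eq_zero fun a _ => ?_
    have h : U.indicator (X a) =ᶠ[nhds y] fun _ => 0 := by
      filter_upwards [hK.isClosed.isOpen_compl.mem_nhds fun h => hy (hKU h)] with y' hy'
      exact hsupp a y' hy'
    rw [h.fderiv_eq]
    simp

theorem chart_image_compact {M : Type*} [TopologicalSpace M] [ChartedSpace E7 M] {p : M}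
    {K : Set M} (hK : IsCompact K) (hKp : K ⊆ (extChartAt (𝓡 7) p).source) :
    IsCompact (extChartAt (𝓡 7) p '' K) ∧ extChartAt (𝓡 7) p '' K ⊆ (extChartAt (𝓡 7) p).target ∧
      ∀ y ∈ (extChartAt (𝓡 7) p).target, y ∉ extChartAt (𝓡 7) p '' K →
        (extChartAt (𝓡 7) p).symm y ∉ K := by
  refine ⟨hK.image_of_continuousOn ((continuousOn_extChartAt p).mono hKp), ?_, fun y hy hyK h =>
    hyK ⟨_, h, (extChartAt (𝓡 7) p).right_inv hy⟩⟩
  rintro _ ⟨x, hx, rfl⟩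
  exact (extChartAt (𝓡 7) p).map_source (hKp hx)

section DivergenceTheorem

open Filter Topology MeasureTheory

variable {M : Type*} [TopologicalSpace M] [ChartedSpace E7 M]

namespace G2Structure

variable (S : G2Structure M)

/-- The divergence of the vector field `W` with `g(W, z) = B(z, α_#)`. -/
def fluxDiv (B : M → E7 →L[ℝ] E7 →L[ℝ] ℝ) (α : Form M 1) (x : M) : ℝ :=
  S.divSum B α x (extChartAt (𝓡 7) x x) (frame (S.coframe x))

variable [IsManifold (𝓡 7) ∞ M]

theorem density_mul_fluxDiv {B : M → E7 →L[ℝ] E7 →L[ℝ] ℝ}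
    (hB : ∀ p, ContDiffOn ℝ ∞ (bilinChart B p) (extChartAt (𝓡 7) p).target) {α : Form M 1}
    (hα : α.IsSmooth) {p : M} {y : E7} (hy : y ∈ (extChartAt (𝓡 7) p).target) :
    S.density p y * S.fluxDiv B α ((extChartAt (𝓡 7) p).symm y) =
      ∑ a, fderiv ℝ (fun y' => S.density p y' * S.fluxField B α p y' a) y (stdVec a) := by
  rw [fluxDiv, ← S.divSum_frame hB hα hy]
  exact (S.sum_frame_fluxField (hB p) hα hy).symm

theorem density_pos {p : M} {y : E7} (hy : y ∈ (extChartAt (𝓡 7) p).target) :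
    0 < S.density p y := Real.sqrt_pos.2 (S.det_gram_pos hy)

theorem contDiffOn_density_mul_fluxField {B : M → E7 →L[ℝ] E7 →L[ℝ] ℝ}
    (hB : ∀ p, ContDiffOn ℝ ∞ (bilinChart B p) (extChartAt (𝓡 7) p).target) {α : Form M 1}
    (hα : α.IsSmooth) (p : M) (a : Fin 7) :
    ContDiffOn ℝ ∞ (fun y => S.density p y * S.fluxField B α p y a)
      (extChartAt (𝓡 7) p).target :=
  (S.contDiffOn_density p).mul
    ((EuclideanSpace.proj (𝕜 := ℝ) a).contDiff.comp_contDiffOn (S.contDiffOn_fluxField (hB p) hα))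

/-- The definition uses a chart and a frame that change with the point. Continuity is seen from the
coordinate expression divided by the positive density. -/
theorem continuousOn_fluxDiv {B : M → E7 →L[ℝ] E7 →L[ℝ] ℝ}
    (hB : ∀ p, ContDiffOn ℝ ∞ (bilinChart B p) (extChartAt (𝓡 7) p).target) {α : Form M 1}
    (hα : α.IsSmooth) (p : M) :
    ContinuousOn (fun y => S.fluxDiv B α ((extChartAt (𝓡 7) p).symm y))
      (extChartAt (𝓡 7) p).target := by
  have h : ContinuousOn (fun y => (S.density p y)⁻¹ *
      ∑ a, fderiv ℝ (fun y' => S.density p y' * S.fluxField B α p y' a) y (stdVec a))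
      (extChartAt (𝓡 7) p).target := by
    refine ((S.contDiffOn_density p).continuousOn.inv₀ fun y hy => (S.density_pos hy).ne').mul ?_
    refine continuousOn_finsetSum _ fun a _ => ContinuousOn.clm_apply ?_ continuousOn_const
    exact (S.contDiffOn_density_mul_fluxField hB hα p a).continuousOn_fderiv_of_isOpen
      (isOpen_extChartAt_target p) (by simp)
  refine h.congr fun y hy => ?_
  show _ = (S.density p y)⁻¹ * _
  rw [← S.density_mul_fluxDiv hB hα hy, inv_mul_cancel_left₀ (S.density_pos hy).ne']

theorem chartLinear_eq_zero {α : Form M 1} {p : M} {y : E7}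
    (h : α ((extChartAt (𝓡 7) p).symm y) = 0) : α.chartLinear p y = 0 := by
  ext v
  rw [Form.chartLinear_apply, Form.inChart, h]
  rfl

theorem fluxField_eq_zero (B : M → E7 →L[ℝ] E7 →L[ℝ] ℝ) {α : Form M 1} {p : M} {y : E7}
    (h : α ((extChartAt (𝓡 7) p).symm y) = 0) : S.fluxField B α p y = 0 := by
  have h0 : S.raise p y 0 = 0 := by simp [raise]
  rw [fluxField, chartLinear_eq_zero h, h0, map_zero, h0]

theorem fluxDiv_eq_zero (B : M → E7 →L[ℝ] E7 →L[ℝ] ℝ) {α : Form M 1} {x : M}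
    (h : ∀ᶠ x' in 𝓝 x, α x' = 0) : S.fluxDiv B α x = 0 := by
  have h1 : Tendsto (extChartAt (𝓡 7) x).symm (𝓝 (extChartAt (𝓡 7) x x)) (𝓝 x) := by
    have h2 := continuousAt_extChartAt_symm (I := 𝓡 7) x
    rwa [ContinuousAt, extChartAt_to_inv] at h2
  have h2 : α.chartLinear x =ᶠ[𝓝 (extChartAt (𝓡 7) x x)] fun _ => 0 := by
    filter_upwards [h1.eventually h] with y hy
    exact chartLinear_eq_zero hy
  have h3 : fderiv ℝ (α.chartLinear x) (extChartAt (𝓡 7) x x) = 0 := by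
    rw [h2.fderiv_eq]
    exact fderiv_const_apply _
  simp only [fluxDiv, divSum, covLinear, h2.eq_of_nhds, h3]
  simp

variable [T2Space M] [MeasurableSpace M] [BorelSpace M]

/-- The divergence theorem in a chart. -/
theorem integral_fluxDiv_of_chart {B : M → E7 →L[ℝ] E7 →L[ℝ] ℝ}
    (hB : ∀ p, ContDiffOn ℝ ∞ (bilinChart B p) (extChartAt (𝓡 7) p).target) {α : Form M 1}
    (hα : α.IsSmooth) {p : M} {K : Set M} (hK : IsCompact K)
    (hKp : K ⊆ (extChartAt (𝓡 7) p).source) (hα0 : ∀ x ∉ K, α x = 0) :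
    Integrable (S.fluxDiv B α) S.vol ∧ ∫ x, S.fluxDiv B α x ∂S.vol = 0 := by
  have h0 : ∀ x ∉ K, S.fluxDiv B α x = 0 := fun x hx =>
    S.fluxDiv_eq_zero B (Filter.mem_of_superset (hK.isClosed.isOpen_compl.mem_nhds hx) hα0)
  obtain ⟨hcomp, hsub, hnot⟩ := chart_image_compact hK hKp
  refine ⟨S.integrable_vol (fun x hx => h0 x fun h => hx (hKp h))
    (S.continuousOn_fluxDiv hB hα p) hcomp hsub fun y hy hyK => h0 _ (hnot y hy hyK), ?_⟩
  rw [S.integral_vol (p := p) (fun x hx => h0 x fun h => hx (hKp h))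
    (S.continuousOn_fluxDiv hB hα p), setIntegral_congr_fun (measurableSet_target p)
    fun y hy => S.density_mul_fluxDiv hB hα hy]
  refine setIntegral_sum_fderiv_eq_zero (isOpen_extChartAt_target p) hcomp hsub
    (S.contDiffOn_density_mul_fluxField hB hα p) fun a y hy hyK => ?_
  rw [S.fluxField_eq_zero B (hα0 _ (hnot y hy hyK))]
  exact mul_zero _

end G2Structure

end DivergenceTheorem

/-! ### Passage to the whole manifold; existence and uniqueness of the adjoint -/

section Global

open Filter Topology MeasureTheory

variable {M : Type*} [TopologicalSpace M] [ChartedSpace E7 M]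

theorem Form.IsSmooth.smul [IsManifold (𝓡 7) ∞ M] {k : ℕ} {η : Form M k} (hη : η.IsSmooth)
    {f : M → ℝ} (hf : ContMDiff (𝓡 7) 𝓘(ℝ) ∞ f) :
    Form.IsSmooth (fun x => f x • η x : Form M k) := by
  intro p
  have h1 : ContDiffOn ℝ ∞ (fun y => f ((extChartAt (𝓡 7) p).symm y))
      (extChartAt (𝓡 7) p).target :=
    (hf.comp_contMDiffOn (contMDiffOn_extChartAt_symm p)).contDiffOn
  exact ContDiffOn.fun_smul h1 (hη p)

theorem Form.IsSmooth.add {k : ℕ} {η ζ : Form M k} (hη : η.IsSmooth) (hζ : ζ.IsSmooth) :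
    Form.IsSmooth (fun x => η x + ζ x : Form M k) :=
  fun p => ContDiffOn.add (hη p) (hζ p)

theorem Form.IsSmooth.sub {k : ℕ} {η ζ : Form M k} (hη : η.IsSmooth) (hζ : ζ.IsSmooth) :
    Form.IsSmooth (fun x => η x - ζ x : Form M k) :=
  fun p => ContDiffOn.sub (hη p) (hζ p)

theorem Form.isSmooth_zero {k : ℕ} : Form.IsSmooth (fun _ => 0 : Form M k) := fun p => by
  have h : Form.inChart (fun _ => 0 : Form M k) p = fun _ => 0 := rfl
  rw [h]
  exact contDiffOn_const

namespace G2Structure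

variable (S : G2Structure M)

variable [IsManifold (𝓡 7) ∞ M]

theorem innerAt_inChart (β α : Form M 1) {p : M} {y : E7}
    (hy : y ∈ (extChartAt (𝓡 7) p).target) :
    S.innerAt ((extChartAt (𝓡 7) p).symm y) (β _) (α _) = ∑ b, ∑ c, (S.gram p y)⁻¹ b c *
      (β.chartLinear p y (stdVec b) * α.chartLinear p y (stdVec c)) := by
  rw [gram_eq, S.chartMetric_eq hy, ← sum_frame_eq (S.chartCoframeEquiv hy)
    fun s t => β.chartLinear p y s * α.chartLinear p y t, innerAt_one]
  · refine Finset.sum_congr rfl fun i _ => ?_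
    rw [Form.chartLinear_apply, Form.chartLinear_apply, form_one_inChart, form_one_inChart,
      S.chartInvDeriv_frame hy]
  all_goals
    intros
    simp only [map_add, map_smul, smul_eq_mul]
    ring

theorem continuousOn_innerAt {β α : Form M 1} (hβ : β.IsSmooth) (hα : α.IsSmooth) (p : M) :
    ContinuousOn (fun y => S.innerAt ((extChartAt (𝓡 7) p).symm y) (β _) (α _))
      (extChartAt (𝓡 7) p).target := by
  refine ContinuousOn.congr ?_ fun y hy => S.innerAt_inChart β α hy
  refine continuousOn_finsetSum _ fun b _ => continuousOn_finsetSum _ fun c _ =>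
    (S.contDiffOn_gram_inv p b c).continuousOn.mul ?_
  exact ((hβ.contDiffOn_chartLinear p).continuousOn.clm_apply continuousOn_const).mul
    ((hα.contDiffOn_chartLinear p).continuousOn.clm_apply continuousOn_const)

theorem fluxDiv_add (B : M → E7 →L[ℝ] E7 →L[ℝ] ℝ) {α α' : Form M 1}
    (hα : α.IsSmooth) (hα' : α'.IsSmooth) (x : M) :
    S.fluxDiv B (fun x => α x + α' x) x = S.fluxDiv B α x + S.fluxDiv B α' x := by
  have hx := mem_extChartAt_target (I := 𝓡 7) x
  have h1 : Form.chartLinear (fun x => α x + α' x) x =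
      fun y => α.chartLinear x y + α'.chartLinear x y := rfl
  have h2 := fderiv_fun_add (differentiableAt_of_target (hα.contDiffOn_chartLinear x) hx)
    (differentiableAt_of_target (hα'.contDiffOn_chartLinear x) hx)
  simp only [fluxDiv, divSum, covLinear, ← Finset.sum_add_distrib]
  refine Finset.sum_congr rfl fun i _ => Finset.sum_congr rfl fun j _ => ?_
  rw [h1, h2]
  simp only [add_apply]
  ring

variable [T2Space M] [MeasurableSpace M] [BorelSpace M]

/-- Smoothness of the partial sums is carried through the induction because additivity of `fluxDiv`
needs it in order to differentiate. -/
theorem integral_fluxDiv_sum {B : M → E7 →L[ℝ] E7 →L[ℝ] ℝ} {ι : Type*} (s : Finset ι)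
    {α : ι → Form M 1} (hα : ∀ i, (α i).IsSmooth)
    (h : ∀ i, Integrable (S.fluxDiv B (α i)) S.vol ∧ ∫ x, S.fluxDiv B (α i) x ∂S.vol = 0) :
    Form.IsSmooth (fun x => ∑ i ∈ s, α i x : Form M 1) ∧
      Integrable (S.fluxDiv B fun x => ∑ i ∈ s, α i x) S.vol ∧
      ∫ x, S.fluxDiv B (fun x => ∑ i ∈ s, α i x) x ∂S.vol = 0 := by
  classical
  induction s using Finset.induction_on with
  | empty =>
    have h0 : S.fluxDiv B (fun x => ∑ i ∈ (∅ : Finset ι), α i x) = fun _ => 0 :=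
      funext fun x => S.fluxDiv_eq_zero B (Eventually.of_forall fun _ => Finset.sum_empty)
    rw [h0]
    exact ⟨Form.isSmooth_zero, integrable_zero _ _ _, integral_zero _ _⟩
  | insert a s ha ih =>
    have h0 : (fun x => ∑ i ∈ insert a s, α i x : Form M 1) =
        fun x => α a x + ∑ i ∈ s, α i x := funext fun x => Finset.sum_insert ha
    have h1 : S.fluxDiv B (fun x => α a x + ∑ i ∈ s, α i x) =
        fun x => S.fluxDiv B (α a) x + S.fluxDiv B (fun x => ∑ i ∈ s, α i x) x :=
      funext fun x => S.fluxDiv_add B (hα a) ih.1 x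
    rw [h0, h1]
    refine ⟨(hα a).add ih.1, (h a).1.add ih.2.1, ?_⟩
    rw [integral_add (h a).1 ih.2.1, (h a).2, ih.2.2, add_zero]

variable [SigmaCompactSpace M]

/-- The divergence theorem. -/
theorem integral_fluxDiv {B : M → E7 →L[ℝ] E7 →L[ℝ] ℝ}
    (hB : ∀ p, ContDiffOn ℝ ∞ (bilinChart B p) (extChartAt (𝓡 7) p).target) {α : Form M 1}
    (hα : α.IsSmooth) (hc : α.IsCompactlySupported) :
    Integrable (S.fluxDiv B α) S.vol ∧ ∫ x, S.fluxDiv B α x ∂S.vol = 0 := by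
  obtain ⟨f, hf⟩ := SmoothPartitionOfUnity.exists_isSubordinate_chartAt_source (𝓡 7) M
  -- By local finiteness only finitely many functions of the partition meet the compact support, so
  -- `α` is a finite sum of forms, each supported in one chart.
  have hfin : {i | (Function.support (f i) ∩ closure {x | α x ≠ 0}).Nonempty}.Finite :=
    f.locallyFinite.finite_nonempty_inter_compact hc
  have hsum : α = fun x => ∑ i ∈ hfin.toFinset, f i x • α x := by
    funext x
    by_cases hx : α x = 0
    · simp only [hx, smul_zero, Finset.sum_const_zero]
    · have h1 : ∑ i ∈ hfin.toFinset, f i x = 1 := by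
        rw [← f.sum_eq_one (Set.mem_univ x)]
        refine (finsum_eq_sum_of_support_subset _ fun i hi => ?_).symm
        rw [Set.Finite.coe_toFinset]
        exact ⟨x, hi, subset_closure hx⟩
      rw [← Finset.sum_smul, h1, one_smul]
  have key := S.integral_fluxDiv_sum (B := B) hfin.toFinset (α := fun i x => f i x • α x)
    (fun i => hα.smul (f i).contMDiff) fun i => by
      refine S.integral_fluxDiv_of_chart hB (hα.smul (f i).contMDiff) (p := i)
        (hc.inter_left (isClosed_tsupport (f i))) ?_ ?_
      · rw [extChartAt_source]
        exact Set.inter_subset_left.trans (hf i)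
      · intro x hx
        rw [Set.mem_inter_iff, not_and_or] at hx
        rcases hx with hx | hx
        · rw [image_eq_zero_of_notMem_tsupport hx, zero_smul]
        · rw [not_not.1 fun h => hx (subset_closure h), smul_zero]
  rw [hsum]
  exact key.2

/-- The two integrands differ pointwise by half a divergence, whose integral vanishes. -/
theorem isD27_7_adjointForm (hS : S.TorsionFree) {γ : Form M 3} (hγ : S.IsOmega27 γ) :
    S.IsD27_7 γ (S.adjointForm (S.jBilin γ)) := by
  have hB := S.contDiffOn_jBilin hγ.1
  refine ⟨S.isSmooth_adjointForm hB, fun α hα hc => ?_⟩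
  obtain ⟨hi, h0⟩ := S.integral_fluxDiv hB hα hc
  have h1 : ∀ x, S.innerAt x (γ x) (S.d7_27 α x) =
      S.innerAt x (S.adjointForm (S.jBilin γ) x) (α x) +
        (1 / 2 : ℝ) * S.fluxDiv (S.jBilin γ) α x := fun x =>
    sub_eq_iff_eq_add'.1 (S.innerAt_d7_27_sub hS hγ hα x)
  have hi2 := hi.const_mul (1 / 2 : ℝ)
  simp only [h1]
  -- The divergence is integrable, so both integrands are integrable or neither is; in the latter
  -- case both integrals have the default value `0`.
  by_cases hF : Integrable (fun x => S.innerAt x (S.adjointForm (S.jBilin γ) x) (α x)) S.vol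
  · rw [integral_add hF hi2, integral_const_mul, h0, mul_zero, add_zero]
  · rw [integral_undef hF, integral_undef]
    exact fun h => hF ((integrable_add_iff_integrable_left hi2).1 h)

/-- If `f` is a bump function at `x₀` and `∫ f |δ|² = 0`, then `δ = 0` at `x₀`. -/
theorem eq_zero_of_integral_bump_smul {δ : Form M 1} (hδ : δ.IsSmooth) {x₀ : M}
    (f : SmoothBumpFunction (𝓡 7) x₀) (hz : ∫ x, S.innerAt x (δ x) (f x • δ x) ∂S.vol = 0) :
    δ x₀ = 0 := by
  have hα : Form.IsSmooth (fun x => f x • δ x : Form M 1) := hδ.smul f.contMDiff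
  have h0 : ∀ x ∉ tsupport f, S.innerAt x (δ x) (f x • δ x) = 0 := fun x hx => by
    rw [image_eq_zero_of_notMem_tsupport hx, zero_smul]
    exact map_zero _
  obtain ⟨hcomp, hsub, hnot⟩ := chart_image_compact f.hasCompactSupport
    f.tsupport_subset_extChartAt_source
  have hcont := S.continuousOn_innerAt hδ hα x₀
  rw [S.integral_vol (p := x₀)
    (fun x hx => h0 x fun h => hx (f.tsupport_subset_extChartAt_source h)) hcont] at hz
  have hnn : ∀ y ∈ (extChartAt (𝓡 7) x₀).target, 0 ≤ S.density x₀ y *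
      S.innerAt ((extChartAt (𝓡 7) x₀).symm y) (δ _)
        (f ((extChartAt (𝓡 7) x₀).symm y) • δ _) := fun y hy => by
    refine mul_nonneg (S.density_pos hy).le ?_
    rw [innerAt_one]
    refine Finset.sum_nonneg fun j _ => ?_
    have : ∀ s t : ℝ, 0 ≤ t → 0 ≤ s * (t * s) := fun s t ht => by
      nlinarith [mul_nonneg ht (mul_self_nonneg s)]
    exact this _ _ (f.nonneg (x := (extChartAt (𝓡 7) x₀).symm y))
  have hae := (setIntegral_eq_zero_iff_of_nonneg_ae
    ((ae_restrict_iff' (measurableSet_target x₀)).2 (Eventually.of_forall hnn))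
    (S.integrableOn_density_mul (F := fun x => S.innerAt x (δ x) (f x • δ x)) hcont hcomp hsub
      fun y hy hyK => h0 _ (hnot y hy hyK))).1 hz
  -- The integrand is nonnegative with zero integral, hence zero almost everywhere; being continuous
  -- on an open set, it vanishes at every point, including the centre, where the bump function is
  -- `1`.
  have heq := Measure.eqOn_open_of_ae_eq hae (isOpen_extChartAt_target x₀)
    ((S.contDiffOn_density x₀).continuousOn.mul hcont) continuousOn_const
  have hx₀ := mem_extChartAt_target (I := 𝓡 7) x₀
  have h2 := (mul_eq_zero.1 (heq hx₀)).resolve_left (S.density_pos hx₀).ne'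
  rw [extChartAt_to_inv, f.eq_one, one_smul] at h2
  exact formInner_self_eq_zero _ _ h2

/-- Test both adjoint relations on `f • (β - β')` with a bump function `f` at `x₀`: subtracting them
gives `∫ f |β - β'|² = 0`. The compact support of `f` supplies the integrability needed to subtract.
-/
theorem isD27_7_unique {γ : Form M 3} {β β' : Form M 1} (hβ : S.IsD27_7 γ β)
    (hβ' : S.IsD27_7 γ β') : β = β' := by
  funext x₀
  obtain ⟨f⟩ : Nonempty (SmoothBumpFunction (𝓡 7) x₀) := inferInstance
  have hδ : Form.IsSmooth (fun x => β x - β' x : Form M 1) := hβ.1.sub hβ'.1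
  have hα : Form.IsSmooth (fun x => f x • (β x - β' x) : Form M 1) := hδ.smul f.contMDiff
  have hα0 : ∀ x ∉ tsupport f, f x • (β x - β' x) = 0 := fun x hx => by
    rw [image_eq_zero_of_notMem_tsupport hx, zero_smul]
  have hc : Form.IsCompactlySupported (fun x => f x • (β x - β' x) : Form M 1) :=
    f.hasCompactSupport.isCompact.of_isClosed_subset isClosed_closure
      (closure_minimal (fun x hx => by_contra fun h => hx (hα0 x h)) (isClosed_tsupport f))
  obtain ⟨hcomp, hsub, hnot⟩ := chart_image_compact f.hasCompactSupport
    f.tsupport_subset_extChartAt_source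
  have hint : ∀ {η : Form M 1}, η.IsSmooth →
      Integrable (fun x => S.innerAt x (η x) (f x • (β x - β' x))) S.vol := by
    intro η hη
    have h0 : ∀ x ∉ tsupport f, S.innerAt x (η x) (f x • (β x - β' x)) = 0 := fun x hx => by
      rw [hα0 x hx]
      exact map_zero _
    exact S.integrable_vol (fun x hx => h0 x fun h => hx (f.tsupport_subset_extChartAt_source h))
      (S.continuousOn_innerAt hη hα x₀) hcomp hsub fun y hy hyK => h0 _ (hnot y hy hyK)
  refine sub_eq_zero.1 (S.eq_zero_of_integral_bump_smul hδ f ?_)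
  have hsubt : ∀ x, S.innerAt x (β x - β' x) (f x • (β x - β' x)) =
      S.innerAt x (β x) (f x • (β x - β' x)) - S.innerAt x (β' x) (f x • (β x - β' x)) :=
    fun x => LinearMap.map_sub₂ _ _ _ _
  refine (integral_congr_ae (Eventually.of_forall hsubt)).trans ?_
  rw [integral_sub (hint hβ.1) (hint hβ'.1), sub_eq_zero]
  exact (hβ.2 _ hα hc).trans (hβ'.2 _ hα hc).symm

theorem existsUnique_isD27_7 (hS : S.TorsionFree) {γ : Form M 3} (hγ : S.IsOmega27 γ) :
    ∃! β : Form M 1, S.IsD27_7 γ β :=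
  ⟨_, S.isD27_7_adjointForm hS hγ, fun _ hβ => S.isD27_7_unique hβ (S.isD27_7_adjointForm hS hγ)⟩

/-- The operator is defined by choice; uniqueness identifies the chosen form with the explicit one.
-/
theorem d27_7_eq (hS : S.TorsionFree) {γ : Form M 3} (hγ : S.IsOmega27 γ) :
    S.d27_7 γ = S.adjointForm (S.jBilin γ) := by
  have h : ∃ β : Form M 1, S.IsD27_7 γ β := ⟨_, S.isD27_7_adjointForm hS hγ⟩
  rw [d27_7, dif_pos h]
  exact S.isD27_7_unique (Classical.choose_spec h) (S.isD27_7_adjointForm hS hγ)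

end G2Structure

end Global

/-! ### The adjoint as a divergence -/

section Sharp

variable {M : Type*} [TopologicalSpace M] [ChartedSpace E7 M] [IsManifold (𝓡 7) ∞ M]

namespace G2Structure

variable (S : G2Structure M)

theorem sharp_adjointForm {γ : Form M 3} (hγ : S.IsOmega27 γ) (x : M) :
    S.sharp x (S.adjointForm (S.jBilin γ) x) = (-(1 / 2) : ℝ) • S.div (S.j γ) x := by
  rw [S.j_eq fun x => (hγ.2 x).1, sharp, div, Finset.sum_comm, Finset.smul_sum]
  refine Finset.sum_congr rfl fun j _ => ?_
  rw [← Finset.sum_smul, ← mul_smul]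
  refine congrArg (fun c : ℝ => c • frame (S.coframe x) j) ?_
  refine (S.adjointCovector_apply (S.jBilin γ) x (frame (S.coframe x) j)).trans
    (congrArg _ (Finset.sum_congr rfl fun i _ => ?_))
  exact (S.covDeriv_bilinTensor (S.contDiffOn_jBilin hγ.1) x _ _ _).symm

end G2Structure

end Sharp

end G2

end

theorem mainTheorem5 :
    ∃ A : ℝ, A ≠ 0 ∧
      ∀ (M : Type*) [TopologicalSpace M] [T2Space M] [SigmaCompactSpace M]
        [ChartedSpace G2.E7 M] [IsManifold (𝓡 7) ∞ M] [MeasurableSpace M] [BorelSpace M]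
        (S : G2.G2Structure M), S.TorsionFree →
        ∀ γ : G2.Form M 3, S.IsOmega27 γ →
          (∃! β : G2.Form M 1, S.IsD27_7 γ β) ∧
          ∀ x : M, S.sharp x (S.d27_7 γ x) = A • S.div (S.j γ) x := by
  -- The `½` is `3/3!` from pairing `γ` with an alternation of three terms; the sign comes from
  -- integration by parts.
  refine ⟨-(1 / 2), by norm_num, fun M _ _ _ _ _ _ _ S hS γ hγ =>
    ⟨S.existsUnique_isD27_7 hS hγ, fun x => ?_⟩⟩
  rw [S.d27_7_eq hS hγ]
  exact S.sharp_adjointForm hγ x
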